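/- Let $\|\cdot\|$ and $\langle\cdot,\cdot\rangle$ be the Euclidean norm and scalar product on $\mathbb{R}^n$, $S^{n-1}$ the unit sphere, $\angle(u,w)\in[0,\pi]$ the angle between non-zero vectors, and $\gamma_n$ the standard Gaussian measure on $\mathbb{R}^n$. For a convex body $K\subset\mathbb{R}^n$ with the origin in its interior put $$\|x\|_K=\min\{t\ge 0: x\in tK\},\qquad \ell(K)=\int_{\mathbb{R}^n}\|x\|_K\,\gamma_n(dx),\qquad K^\circ=\{x\in\mathbb{R}^n:\langle x,y\rangle\le 1\ \ \forall y\in K\}.$$ Let $\Delta_n$ be a regular $n$-simplex in $\mathbb{R}^n$ whose vertices lie on $S^{n-1}$. Let $n+1\le k\le 2n^2$, let $u_1,\dots,u_k\in S^{n-1}$ and $c_1,\dots,c_k>0$ satisfy $$\sum_{i=1}^k c_i\,u_i\otimes u_i=\mathrm{Id}_n,\qquad \sum_{i=1}^k c_iu_i=0,$$ let $C=\mathrm{conv}\{u_1,\dots,u_k\}$ and let $0<\varepsilon<n^{-60n}$. Assume that at least one of the following two conditions holds: (a) $\ell(C)\ge(1-\varepsilon)\,\ell(\Delta_n)$; (c)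 $\ell(C^\circ)\le(1+\varepsilon)\,\ell(\Delta_n^\circ)$. Then $\eta:=n^{15n}\varepsilon^{1/4}$ lies in $(0,1)$, and there exist a regular $n$-simplex with vertices $w_1,\dots,w_{n+1}\in S^{n-1}$ and pairwise distinct indices $i_1,\dots,i_{n+1}\in\{1,\dots,k\}$ such that $$\angle(u_{i_j},w_j)\le\eta\qquad\text{for } j=1,\dots,n+1.$$ -/

import Mathlib

open MeasureTheory ProbabilityTheory

/-- The `ℓ`-norm `ℓ(K) = ∫ ‖x‖_K dγ_n(x)` of a convex body `K ⊆ ℝⁿ` containing the origin in its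
interior. Here `γ_n` is the standard Gaussian measure and `gauge K x` is the Minkowski functional
`‖x‖_K = min {t ≥ 0 : x ∈ t K}`. -/
noncomputable def ellNorm {n : ℕ} (K : Set (EuclideanSpace ℝ (Fin n))) : ℝ :=
  ∫ x, gauge K x ∂(stdGaussian (EuclideanSpace ℝ (Fin n)))

/-- The polar `K° = {x : ⟪x, y⟫ ≤ 1 for all y ∈ K}` of a set `K ⊆ ℝⁿ`. (It is one-sided: Mathlib's
`polar` is the absolute polar, which differs from this one when `K ≠ -K`.) -/
def polarBody {n : ℕ} (K : Set (EuclideanSpace ℝ (Fin n))) : Set (EuclideanSpace ℝ (Fin n)) :=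
  {x | ∀ y ∈ K, inner ℝ x y ≤ 1}

/-- `S` is a regular `n`-simplex in `ℝⁿ` all of whose vertices lie on the unit sphere `S^{n-1}`,
that is, a regular simplex inscribed into the unit ball. -/
def IsInscribedRegular {n : ℕ} (S : Affine.Simplex ℝ (EuclideanSpace ℝ (Fin n)) n) : Prop :=
  S.Regular ∧ ∀ j, ‖S.points j‖ = 1

/-- The convex hull of the vertices of the simplex `S`. -/
def simplexBody {n : ℕ} (S : Affine.Simplex ℝ (EuclideanSpace ℝ (Fin n)) n) :
    Set (EuclideanSpace ℝ (Fin n)) :=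
  convexHull ℝ (Set.range S.points)

/-- The unit vectors `u₁, …, u_k` (not necessarily distinct) and the weights `c₁, …, c_k > 0`
satisfy `∑ cᵢ uᵢ ⊗ uᵢ = Id` and `∑ cᵢ uᵢ = 0`. -/
structure IsCenteredIsotropic {n k : ℕ} (u : Fin k → EuclideanSpace ℝ (Fin n))
    (c : Fin k → ℝ) : Prop where
  norm_eq_one : ∀ i, ‖u i‖ = 1
  weight_pos : ∀ i, 0 < c i
  isotropic : ∑ i, c i • InnerProductSpace.rankOne ℝ (u i) (u i) =
    ContinuousLinearMap.id ℝ (EuclideanSpace ℝ (Fin n))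
  centered : ∑ i, c i • u i = 0

/-! The vectors `u i` are lifted to unit vectors `v i` of `ℝⁿ⁺¹` which form a tight frame with
weights `(n+1)/n · c i` and lie on a common hyperplane `⟪e, ·⟫ = 1`. The vertices of a regular
simplex become an orthonormal basis. Adding an independent centred Gaussian coordinate to the gauges
turns `ℓ(C°)` and `ℓ(C)` into expectations of `polarVar` and `hullVar`, up to explicit factors. The
event `polarVar < t` forces `⟪z, v i⟫ < t` for all `i`, which by the Gaussian Brascamp-Lieb
inequality has probability at most `Φ(t)ⁿ⁺¹`. The event `hullVar ≤ t` contains all frame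
combinations with coefficients at most `t`, which by Barthe's reverse inequality has probability at
least `Φ(t)ⁿ⁺¹`. For the simplex `polarVar ≤ hullVar`, so both bounds are sharp there, and
integration over `t` gives the extremality of the simplex.

Stability comes from the transport proof of both inequalities. With `Φ(F(s)) = a Φ(s)`, the map `x ↦
∑ cᵢ F(⟪x, vᵢ⟫) vᵢ` has Jacobian at least `∏ F'(⟪x, vᵢ⟫)^cᵢ`. The norm of its value loses exactly
`frameForm`, the squared distance of `(F(⟪x, vᵢ⟫))ᵢ` to the range of the analysis map. This loss is
kept in `lintegral_one_add_frameForm_le`. For `t ∈ [2, 5/2]` the map `F` is uniformly convex (`a =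
1/Φ(t)`) or uniformly concave (`a = Φ(t)`) near `0`. Splitting off a square and using rotation
invariance on a small ball bounds the mean loss below by a multiple of `frameSpread = ∑ cᵢcⱼ ρᵢⱼ²(1
- ρᵢⱼ)`, where `ρᵢⱼ = ⟪vᵢ, vⱼ⟫` (`le_setIntegral_frameForm`). Hence near-extremality makes the
spread of order `ε`.

A small spread means that any two heavy frame vectors are nearly orthogonal or nearly equal. The
heavy vectors cluster, each cluster has weight barely above one, and the total weight `n+1` forces
`n+1` clusters (`exists_nearly_orthonormal`). One representative from each gives vectors `u i` whose
Gram matrix is within order `√ε` of that of the simplex. A polar decomposition then moves the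
simplex onto them with error of order `ε^(1/4)` (`exists_isometry_norm_sub_le`). -/

/-! ### Tight frames and the determinant inequality -/

/-- The unit vectors `v i` with the positive weights `c i` form a tight frame:
`∑ cᵢ vᵢ ⊗ vᵢ = Id`. -/
structure IsTightFrame {V ι : Type*} [NormedAddCommGroup V] [InnerProductSpace ℝ V] [Fintype ι]
    (v : ι → V) (c : ι → ℝ) : Prop where
  norm_eq_one : ∀ i, ‖v i‖ = 1
  weight_pos : ∀ i, 0 < c i
  expand : ∀ x, ∑ i, (c i * inner ℝ x (v i)) • v i = x

/-- The bilinear form of the squared weighted distance of a vector to the range of the analysis map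
`x ↦ (⟪x, vᵢ⟫)ᵢ` of a frame. -/
noncomputable def frameForm {V ι : Type*} [NormedAddCommGroup V] [InnerProductSpace ℝ V] [Fintype ι]
    (v : ι → V) (c : ι → ℝ) (a b : ι → ℝ) : ℝ :=
  ∑ i, c i * (a i * b i) - inner ℝ (∑ i, (c i * a i) • v i) (∑ i, (c i * b i) • v i)

namespace IsTightFrame

variable {V ι : Type*} [NormedAddCommGroup V] [InnerProductSpace ℝ V] [Fintype ι]
  {v : ι → V} {c : ι → ℝ}

theorem sum_inner_mul_inner (h : IsTightFrame v c) (x y : V) :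
    ∑ i, c i * (inner ℝ x (v i) * inner ℝ y (v i)) = inner ℝ x y := by
  conv_rhs => rw [← h.expand x, sum_inner]
  refine Finset.sum_congr rfl fun i _ => ?_
  rw [real_inner_smul_left, real_inner_comm y (v i)]; ring

theorem sum_inner_sq (h : IsTightFrame v c) (x : V) :
    ∑ i, c i * inner ℝ x (v i) ^ 2 = ‖x‖ ^ 2 := by
  rw [← real_inner_self_eq_norm_sq, ← h.sum_inner_mul_inner x x]
  exact Finset.sum_congr rfl fun i _ => by ring

theorem sum_weights [FiniteDimensional ℝ V] (h : IsTightFrame v c) :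
    ∑ i, c i = Module.finrank ℝ V := by
  let b := stdOrthonormalBasis ℝ V
  have h1 : ∀ i, c i = ∑ k, c i * inner ℝ (b k) (v i) ^ 2 := fun i => by
    rw [← Finset.mul_sum]
    have := b.sum_sq_norm_inner_right (v i)
    simp only [Real.norm_eq_abs, sq_abs, h.norm_eq_one] at this
    rw [this]; ring
  calc ∑ i, c i = ∑ i, ∑ k, c i * inner ℝ (b k) (v i) ^ 2 := Finset.sum_congr rfl fun i _ => h1 i
    _ = ∑ k, ∑ i, c i * inner ℝ (b k) (v i) ^ 2 := Finset.sum_comm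
    _ = ∑ k : Fin (Module.finrank ℝ V), (1 : ℝ) := by
      refine Finset.sum_congr rfl fun k _ => ?_
      rw [h.sum_inner_sq, b.orthonormal.norm_eq_one]; norm_num
    _ = _ := by simp

/-- Pythagoras: the analysis map is an isometry into weighted `ℓ²` with adjoint `a ↦ ∑ (cⱼ aⱼ) vⱼ`,
so composing the two is the orthogonal projection onto its range. -/
theorem frameForm_self (h : IsTightFrame v c) (a : ι → ℝ) :
    frameForm v c a a =
      ∑ i, c i * (a i - inner ℝ (∑ j, (c j * a j) • v j) (v i)) ^ 2 := by
  set y := ∑ j, (c j * a j) • v j with hy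
  have h1 : ∑ i, c i * (a i * inner ℝ y (v i)) = inner ℝ y y := by
    conv_rhs => rw [hy, sum_inner]
    refine Finset.sum_congr rfl fun i _ => ?_
    rw [real_inner_smul_left, ← hy, real_inner_comm y (v i)]; ring
  have h2 := h.sum_inner_mul_inner y y
  have h3 : ∀ i, c i * (a i - inner ℝ y (v i)) ^ 2 = c i * (a i * a i)
      - 2 * (c i * (a i * inner ℝ y (v i))) + c i * (inner ℝ y (v i) * inner ℝ y (v i)) :=
    fun i => by ring
  simp only [h3, Finset.sum_add_distrib, Finset.sum_sub_distrib, ← Finset.mul_sum, h1, h2]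
  simp only [frameForm, ← hy]; ring

theorem frameForm_self_nonneg (h : IsTightFrame v c) (a : ι → ℝ) : 0 ≤ frameForm v c a a := by
  rw [h.frameForm_self]
  exact Finset.sum_nonneg fun i _ => mul_nonneg (h.weight_pos i).le (sq_nonneg _)

variable [FiniteDimensional ℝ V]

/-- In an eigenbasis `b` of the operator, the `k`-th eigenvalue is the mean of the `t i` with
weights `c i ⟪b k, v i⟫²`, which sum to one over `i`. Apply the weighted AM-GM inequality to each
eigenvalue and multiply; the exponents of `t i` add up to `c i` because `v i` is a unit vector. -/
theorem prod_rpow_le_det (h : IsTightFrame v c) (t : ι → ℝ) (ht : ∀ i, 0 < t i) :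
    ∏ i, t i ^ c i ≤
      (∑ i, (c i * t i) • InnerProductSpace.rankOne ℝ (v i) (v i) : V →L[ℝ] V).det := by
  set G : V →L[ℝ] V := ∑ i, (c i * t i) • InnerProductSpace.rankOne ℝ (v i) (v i) with hG
  have hGx : ∀ x, G x = ∑ i, (c i * t i) • (inner ℝ (v i) x • v i) := fun x => by
    simp [hG]
  have hsym : (G : V →ₗ[ℝ] V).IsSymmetric := fun x y => by
    simp only [ContinuousLinearMap.coe_coe, hGx, sum_inner, inner_sum, real_inner_smul_left,
      real_inner_smul_right]
    refine Finset.sum_congr rfl fun i _ => ?_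
    rw [real_inner_comm x (v i)]; ring
  have hdet : G.det = ∏ k, hsym.eigenvalues rfl k := by
    rw [ContinuousLinearMap.det, hsym.det_eq_prod_eigenvalues rfl]; simp
  let b := hsym.eigenvectorBasis rfl
  have hμ : ∀ k, hsym.eigenvalues rfl k = ∑ i, (c i * inner ℝ (b k) (v i) ^ 2) * t i := fun k => by
    have h1 : inner ℝ (b k) (G (b k)) = hsym.eigenvalues rfl k := by
      have := hsym.apply_eigenvectorBasis rfl k
      simp only [ContinuousLinearMap.coe_coe] at this
      rw [show G (b k) = _ from this, inner_smul_right, real_inner_self_eq_norm_sq,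
        show ‖hsym.eigenvectorBasis rfl k‖ = 1 from b.orthonormal.norm_eq_one k]
      simp
    rw [← h1, hGx, inner_sum]
    refine Finset.sum_congr rfl fun i _ => ?_
    rw [real_inner_smul_right, real_inner_smul_right, real_inner_comm (b k) (v i)]; ring
  have hle : ∀ k, ∏ i, t i ^ (c i * inner ℝ (b k) (v i) ^ 2) ≤ hsym.eigenvalues rfl k := fun k => by
    rw [hμ]
    refine Real.geom_mean_le_arith_mean_weighted _ _ _
      (fun i _ => mul_nonneg (h.weight_pos i).le (sq_nonneg _)) ?_ (fun i _ => (ht i).le)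
    rw [h.sum_inner_sq, b.orthonormal.norm_eq_one]; norm_num
  rw [hdet]
  calc ∏ i, t i ^ c i = ∏ i, ∏ k, t i ^ (c i * inner ℝ (b k) (v i) ^ 2) := by
        refine Finset.prod_congr rfl fun i _ => ?_
        rw [← Real.rpow_sum_of_pos (ht i), ← Finset.mul_sum]
        have := b.sum_sq_norm_inner_right (v i)
        simp only [Real.norm_eq_abs, sq_abs, h.norm_eq_one] at this
        rw [this]; norm_num
    _ = ∏ k, ∏ i, t i ^ (c i * inner ℝ (b k) (v i) ^ 2) := Finset.prod_comm
    _ ≤ _ := Finset.prod_le_prod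
        (fun k _ => Finset.prod_nonneg fun i _ => Real.rpow_nonneg (ht i).le _) fun k _ => hle k

end IsTightFrame

/-! ### The transport proof of the Gaussian Brascamp-Lieb inequalities, with a deficit -/

/-- Both sides have the same characteristic function. The density makes the change of variables for
Lebesgue measure available. -/
theorem stdGaussian_eq_withDensity (V : Type*) [NormedAddCommGroup V] [InnerProductSpace ℝ V]
    [FiniteDimensional ℝ V] [MeasurableSpace V] [BorelSpace V] :
    stdGaussian V = volume.withDensity fun x => ENNReal.ofReal
      ((2 * Real.pi) ^ (-(Module.finrank ℝ V : ℝ) / 2) * Real.exp (-‖x‖ ^ 2 / 2)) := by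
  set Z : ℝ := (2 * Real.pi) ^ (-(Module.finrank ℝ V : ℝ) / 2) with hZ
  have hZ0 : 0 < Z := by positivity
  have hint : Integrable (fun x : V => Z * Real.exp (-‖x‖ ^ 2 / 2)) := by
    have := (GaussianFourier.integrable_cexp_neg_mul_sq_norm_add (V := V) (b := 1 / 2)
      (by norm_num) 0 0).norm
    refine (this.congr (Filter.Eventually.of_forall fun x => ?_)).const_mul Z
    simp only [Complex.norm_exp]
    congr 1
    simp [← Complex.ofReal_pow]; ring
  have hfin : IsFiniteMeasure (volume.withDensity fun x : V => ENNReal.ofReal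
      (Z * Real.exp (-‖x‖ ^ 2 / 2))) :=
    isFiniteMeasure_withDensity_ofReal hint.2
  refine Measure.ext_of_charFun ?_
  ext t
  rw [charFun_stdGaussian, charFun_apply, integral_withDensity_eq_integral_toReal_smul
    (by fun_prop) (by simp)]
  have h := GaussianFourier.integral_cexp_neg_mul_sq_norm_add (V := V) (b := 1 / 2)
      (by norm_num) Complex.I t
  have h2 : ∀ x : V, (ENNReal.ofReal (Z * Real.exp (-‖x‖ ^ 2 / 2))).toReal •
      Complex.exp (inner ℝ x t * Complex.I) =
      (Z : ℂ) * Complex.exp (-(1 / 2) * ‖x‖ ^ 2 + Complex.I * inner ℝ t x) := fun x => by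
    rw [ENNReal.toReal_ofReal (by positivity), real_inner_comm, Complex.real_smul,
      Complex.exp_add]
    push_cast
    rw [mul_assoc]
    congr 3
    · ring
    · ring
  simp only [h2]
  rw [integral_const_mul, h, ← mul_assoc]
  have h3 : (Z : ℂ) * (Real.pi / (1 / 2)) ^ ((Module.finrank ℝ V : ℂ) / 2) = 1 := by
    have : ((Real.pi : ℂ) / (1 / 2)) = ((2 * Real.pi : ℝ) : ℂ) := by push_cast; ring
    rw [this, show ((Module.finrank ℝ V : ℂ) / 2) = (((Module.finrank ℝ V : ℝ) / 2 : ℝ) : ℂ) by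
      push_cast; rfl, ← Complex.ofReal_cpow (by positivity), ← Complex.ofReal_mul, hZ,
      ← Real.rpow_add (by positivity)]
    ring_nf; simp
  rw [h3, one_mul, Complex.I_sq]
  congr 1; ring

namespace IsTightFrame

variable {V ι : Type*} [NormedAddCommGroup V] [InnerProductSpace ℝ V] [Fintype ι]
  {v : ι → V} {c : ι → ℝ} [FiniteDimensional ℝ V]

/-- Raise the one-dimensional Jacobian equations to the powers `c i` and multiply: `∑ c i = dim V`
and `∑ c i ⟪x, v i⟫² = ‖x‖²` turn the right sides into the Gaussian factor at `x`. Replacing `∑ c i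
F i²` by the squared norm of the image point gains `exp (frameForm / 2) ≥ 1 + frameForm / 2`. -/
theorem pow_mul_exp_le_det (h : IsTightFrame v c) {a : ℝ} (ha : 0 < a) (x : V) (F F' : ι → ℝ)
    (hF' : ∀ i, 0 < F' i)
    (hjac : ∀ i, Real.exp (-F i ^ 2 / 2) * F' i = a * Real.exp (-inner ℝ x (v i) ^ 2 / 2)) :
    a ^ Module.finrank ℝ V * Real.exp (-‖x‖ ^ 2 / 2) * (1 + frameForm v c F F / 2) ≤
      |(∑ i, (c i * F' i) • InnerProductSpace.rankOne ℝ (v i) (v i) : V →L[ℝ] V).det| *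
        Real.exp (-‖∑ i, (c i * F i) • v i‖ ^ 2 / 2) := by
  have h1 : ∀ i, F' i = Real.exp (Real.log a - inner ℝ x (v i) ^ 2 / 2 + F i ^ 2 / 2) := fun i => by
    have : F' i = Real.exp (F i ^ 2 / 2) * (Real.exp (-F i ^ 2 / 2) * F' i) := by
      rw [← mul_assoc, ← Real.exp_add]; ring_nf; simp
    rw [this, hjac, Real.exp_add, Real.exp_sub, Real.exp_log ha, neg_div, Real.exp_neg]
    field_simp
  have h2 : ∏ i, F' i ^ c i = Real.exp (Module.finrank ℝ V * Real.log a - ‖x‖ ^ 2 / 2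
      + (∑ i, c i * (F i * F i)) / 2) := by
    rw [← h.sum_weights, ← h.sum_inner_sq x, Finset.sum_mul, Finset.sum_div, Finset.sum_div,
      ← Finset.sum_sub_distrib, ← Finset.sum_add_distrib, Real.exp_sum]
    refine Finset.prod_congr rfl fun i _ => ?_
    rw [h1, ← Real.exp_mul]
    congr 1; ring
  have h3 := (h.prod_rpow_le_det F' hF').trans (le_abs_self _)
  refine le_trans ?_ (mul_le_mul_of_nonneg_right h3 (Real.exp_pos _).le)
  rw [h2, ← Real.exp_add]
  have h4 : a ^ Module.finrank ℝ V = Real.exp (Module.finrank ℝ V * Real.log a) := by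
    rw [Real.exp_nat_mul, Real.exp_log ha]
  have h5 : Real.exp (Module.finrank ℝ V * Real.log a - ‖x‖ ^ 2 / 2
      + (∑ i, c i * (F i * F i)) / 2 + -‖∑ i, (c i * F i) • v i‖ ^ 2 / 2) =
      Real.exp (Module.finrank ℝ V * Real.log a) * Real.exp (-‖x‖ ^ 2 / 2) *
        Real.exp (frameForm v c F F / 2) := by
    rw [← Real.exp_add, ← Real.exp_add, frameForm, real_inner_self_eq_norm_sq]
    congr 1; ring
  rw [h5, h4]
  refine mul_le_mul_of_nonneg_left ?_ (by positivity)
  linarith [Real.add_one_le_exp (frameForm v c F F / 2)]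

variable [MeasurableSpace V] [BorelSpace V]

/-- A one-dimensional monotone map transporting the standard Gaussian measure to a multiple of
itself induces a map of `V` which shows a Gaussian Brascamp-Lieb inequality with a deficit. -/
theorem lintegral_one_add_frameForm_le (h : IsTightFrame v c) {a : ℝ} (ha : 0 < a) {J : Set ℝ}
    (hJ : IsOpen J) {F F' : ℝ → ℝ} (hF : ∀ s ∈ J, HasDerivAt F (F' s) s)
    (hF' : ∀ s ∈ J, 0 < F' s) (hmono : StrictMonoOn F J)
    (hjac : ∀ s ∈ J, Real.exp (-F s ^ 2 / 2) * F' s = a * Real.exp (-s ^ 2 / 2)) :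
    ENNReal.ofReal (a ^ Module.finrank ℝ V) *
      ∫⁻ x in {x : V | ∀ i, inner ℝ x (v i) ∈ J}, ENNReal.ofReal
        (1 + frameForm v c (fun i => F (inner ℝ x (v i))) (fun i => F (inner ℝ x (v i))) / 2)
        ∂(stdGaussian V) ≤
      stdGaussian V ((fun x => ∑ i, (c i * F (inner ℝ x (v i))) • v i) ''
        {x : V | ∀ i, inner ℝ x (v i) ∈ J}) := by
  set O := {x : V | ∀ i, inner ℝ x (v i) ∈ J} with hO
  set Θ : V → V := fun x => ∑ i, (c i * F (inner ℝ x (v i))) • v i with hΘ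
  have hOo : IsOpen O := by
    have : O = ⋂ i, (fun x : V => inner ℝ x (v i)) ⁻¹' J := by ext; simp [hO]
    rw [this]
    exact isOpen_iInter_of_finite fun i => hJ.preimage (by fun_prop)
  have hOm := hOo.measurableSet
  let Θ' : V → V →L[ℝ] V := fun x =>
    ∑ i, (c i * F' (inner ℝ x (v i))) • InnerProductSpace.rankOne ℝ (v i) (v i)
  have hder : ∀ x ∈ O, HasFDerivWithinAt Θ (Θ' x) O x := fun x hx => by
    refine HasFDerivAt.hasFDerivWithinAt ?_
    refine HasFDerivAt.fun_sum fun i _ => ?_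
    have h1 : HasFDerivAt (fun x : V => inner ℝ x (v i)) (innerSL ℝ (v i)) x := by
      simpa [real_inner_comm] using (innerSL ℝ (v i)).hasFDerivAt (x := x)
    have h2 := ((hF _ (hx i)).comp_hasFDerivAt x h1).const_mul (c i)
    have h3 := h2.smul_const (v i)
    convert! h3 using 1
    ext y
    simp [InnerProductSpace.rankOne_apply, smul_smul]
  -- `Θ` is a monotone operator: `⟪Θ x - Θ y, x - y⟫` is a sum of nonnegative terms. If it vanishes,
  -- all frame coefficients of `x` and `y` agree.
  have hinj : Set.InjOn Θ O := fun x hx y hy hxy => by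
    by_contra hne
    have h1 : ∑ i, c i * ((F (inner ℝ x (v i)) - F (inner ℝ y (v i))) *
        (inner ℝ x (v i) - inner ℝ y (v i))) = 0 := by
      have : inner ℝ (Θ x - Θ y) (x - y) = 0 := by rw [hxy, sub_self, inner_zero_left]
      rw [← this, hΘ]
      simp only
      rw [← Finset.sum_sub_distrib, sum_inner]
      refine Finset.sum_congr rfl fun i _ => ?_
      rw [← sub_smul, real_inner_smul_left, inner_sub_right, real_inner_comm x, real_inner_comm y]
      ring
    have h2 : ∀ i, 0 ≤ c i * ((F (inner ℝ x (v i)) - F (inner ℝ y (v i))) *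
        (inner ℝ x (v i) - inner ℝ y (v i))) := fun i => by
      refine mul_nonneg (h.weight_pos i).le ?_
      rcases le_total (inner ℝ x (v i)) (inner ℝ y (v i)) with h3 | h3
      · exact mul_nonneg_of_nonpos_of_nonpos
          (sub_nonpos.2 (hmono.monotoneOn (hx i) (hy i) h3)) (sub_nonpos.2 h3)
      · exact mul_nonneg
          (sub_nonneg.2 (hmono.monotoneOn (hy i) (hx i) h3)) (sub_nonneg.2 h3)
    have h3 := (Finset.sum_eq_zero_iff_of_nonneg fun i _ => h2 i).1 h1
    refine hne ?_
    rw [← h.expand x, ← h.expand y]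
    refine Finset.sum_congr rfl fun i hi => ?_
    have h4 := (mul_eq_zero.1 (h3 i hi)).resolve_left (h.weight_pos i).ne'
    have h5 : inner ℝ x (v i) = inner ℝ y (v i) := by
      rcases mul_eq_zero.1 h4 with h5 | h5
      · exact hmono.injOn (hx i) (hy i) (sub_eq_zero.1 h5)
      · exact sub_eq_zero.1 h5
    rw [h5]
  rw [stdGaussian_eq_withDensity V]
  set Z : ℝ := (2 * Real.pi) ^ (-(Module.finrank ℝ V : ℝ) / 2) with hZ
  have hZ0 : 0 < Z := by positivity
  rw [withDensity_apply' _, lintegral_image_eq_lintegral_abs_det_fderiv_mul volume hOm hder hinj,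
    setLIntegral_withDensity_eq_setLIntegral_mul_non_measurable _ (by fun_prop) _ hOm (by simp),
    ← lintegral_const_mul' _ _ ENNReal.ofReal_ne_top]
  refine setLIntegral_mono' hOm fun x hx => ?_
  have h1 := h.pow_mul_exp_le_det ha x (fun i => F (inner ℝ x (v i)))
    (fun i => F' (inner ℝ x (v i))) (fun i => hF' _ (hx i)) (fun i => hjac _ (hx i))
  simp only [Pi.mul_apply]
  rw [← ENNReal.ofReal_mul (by positivity), ← ENNReal.ofReal_mul (by positivity),
    ← ENNReal.ofReal_mul (by positivity)]
  refine ENNReal.ofReal_le_ofReal ?_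
  calc _ = Z * (a ^ Module.finrank ℝ V * Real.exp (-‖x‖ ^ 2 / 2) * (1 +
        frameForm v c (fun i => F (inner ℝ x (v i))) (fun i => F (inner ℝ x (v i))) / 2)) := by ring
    _ ≤ Z * _ := mul_le_mul_of_nonneg_left h1 hZ0.le
    _ = _ := by simp only [hΘ, Θ']; ring

end IsTightFrame

/-! ### The Gaussian distribution function, its inverse and the transport maps on the line -/

theorem exists_sub_eq_mul_sub {f f' : ℝ → ℝ} (hf : ∀ x, HasDerivAt f (f' x) x) {x y : ℝ}
    (hxy : x < y) : ∃ z ∈ Set.Ioo x y, f y - f x = f' z * (y - x) := by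
  obtain ⟨z, hz, h⟩ := exists_hasDerivAt_eq_slope f f' hxy
    (fun s _ => (hf s).continuousAt.continuousWithinAt) fun s _ => hf s
  exact ⟨z, hz, by rw [h, div_mul_cancel₀ _ (sub_pos.2 hxy).ne']⟩

/-- The density of the standard Gaussian measure on the line. -/
noncomputable def gaussDensity (s : ℝ) : ℝ := (√(2 * Real.pi))⁻¹ * Real.exp (-s ^ 2 / 2)

/-- The distribution function of the standard Gaussian measure on the line. -/
noncomputable def gaussCdf (s : ℝ) : ℝ := 1 / 2 + ∫ u in (0 : ℝ)..s, gaussDensity u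

theorem continuous_gaussDensity : Continuous gaussDensity := by
  unfold gaussDensity; fun_prop

theorem gaussDensity_pos (s : ℝ) : 0 < gaussDensity s := by
  unfold gaussDensity; positivity

theorem hasDerivAt_gaussDensity (s : ℝ) :
    HasDerivAt gaussDensity (-s * gaussDensity s) s := by
  unfold gaussDensity
  have h1 : HasDerivAt (fun s : ℝ => -s ^ 2 / 2) (-s) s := by
    convert! ((hasDerivAt_pow 2 s).neg).div_const 2 using 1
    simp; ring
  convert! h1.exp.const_mul (√(2 * Real.pi))⁻¹ using 1
  ring

theorem hasDerivAt_gaussCdf (s : ℝ) : HasDerivAt gaussCdf (gaussDensity s) s :=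
  (intervalIntegral.integral_hasDerivAt_right (continuous_gaussDensity.intervalIntegrable _ _)
    continuous_gaussDensity.stronglyMeasurable.stronglyMeasurableAtFilter
    continuous_gaussDensity.continuousAt).const_add _

theorem strictMono_gaussCdf : StrictMono gaussCdf := fun x y hxy => by
  obtain ⟨z, -, h⟩ := exists_sub_eq_mul_sub hasDerivAt_gaussCdf hxy
  have := mul_pos (gaussDensity_pos z) (sub_pos.2 hxy)
  linarith

theorem continuous_gaussCdf : Continuous gaussCdf :=
  continuous_iff_continuousAt.2 fun s => (hasDerivAt_gaussCdf s).continuousAt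

theorem gaussCdf_zero : gaussCdf 0 = 1 / 2 := by simp [gaussCdf]

theorem gaussCdf_neg (s : ℝ) : gaussCdf (-s) = 1 - gaussCdf s := by
  have h : ∫ u in (0 : ℝ)..s, gaussDensity u = ∫ u in -s..(0 : ℝ), gaussDensity u := by
    have := intervalIntegral.integral_comp_neg (a := 0) (b := s) gaussDensity
    simp only [neg_zero] at this
    rw [← this]
    simp [gaussDensity]
  simp only [gaussCdf, h]
  rw [intervalIntegral.integral_symm (-s) 0]; ring

theorem tendsto_gaussCdf_atTop : Filter.Tendsto gaussCdf Filter.atTop (nhds 1) := by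
  have h0 : ∀ u, gaussDensity u = (√(2 * Real.pi))⁻¹ * Real.exp (-(1 / 2) * u ^ 2) := fun u => by
    unfold gaussDensity; ring_nf
  have h1 : ∫ u in Set.Ioi (0 : ℝ), gaussDensity u = 1 / 2 := by
    simp only [h0, integral_const_mul, integral_gaussian_Ioi]
    have : Real.pi / (1 / 2) = 2 * Real.pi := by ring
    rw [this]
    have : √(2 * Real.pi) ≠ 0 := by positivity
    field_simp
  have hi : Integrable gaussDensity := by
    simp only [funext h0]
    exact (integrable_exp_neg_mul_sq (by norm_num)).const_mul _
  have h2 := (intervalIntegral_tendsto_integral_Ioi (μ := volume) 0 hi.integrableOn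
    Filter.tendsto_id).const_add (1 / 2)
  rw [h1] at h2
  norm_num at h2
  exact h2.congr fun s => by simp [gaussCdf]

theorem gaussCdf_lt_one (s : ℝ) : gaussCdf s < 1 :=
  (strictMono_gaussCdf (lt_add_one s)).trans_le
    (strictMono_gaussCdf.monotone.ge_of_tendsto tendsto_gaussCdf_atTop _)

theorem gaussCdf_pos (s : ℝ) : 0 < gaussCdf s := by
  have := gaussCdf_neg s
  have := gaussCdf_lt_one (-s)
  linarith

theorem exists_gaussCdf_eq {y : ℝ} (h0 : 0 < y) (h1 : y < 1) : ∃ s, gaussCdf s = y := by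
  have hup : ∀ z < 1, ∃ s, z < gaussCdf s := fun z hz =>
    (tendsto_gaussCdf_atTop.eventually (lt_mem_nhds hz)).exists
  obtain ⟨s, hs⟩ := hup y h1
  obtain ⟨r, hr⟩ := hup (1 - y) (by linarith)
  have hr' := gaussCdf_neg r
  exact mem_range_of_exists_le_of_exists_ge continuous_gaussCdf ⟨-r, by linarith⟩ ⟨s, hs.le⟩

/-- The quantile function of the standard Gaussian measure on the line. -/
noncomputable def gaussQuantile : ℝ → ℝ := Function.invFun gaussCdf

theorem gaussCdf_gaussQuantile {y : ℝ} (h0 : 0 < y) (h1 : y < 1) :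
    gaussCdf (gaussQuantile y) = y :=
  Function.invFun_eq (exists_gaussCdf_eq h0 h1)

theorem gaussQuantile_gaussCdf (s : ℝ) : gaussQuantile (gaussCdf s) = s :=
  Function.leftInverse_invFun strictMono_gaussCdf.injective s

theorem hasDerivAt_gaussQuantile {y : ℝ} (h0 : 0 < y) (h1 : y < 1) :
    HasDerivAt gaussQuantile (gaussDensity (gaussQuantile y))⁻¹ y := by
  have hmem : Set.Ioo (0 : ℝ) 1 ∈ nhds y := Ioo_mem_nhds h0 h1
  have hmono : StrictMonoOn gaussQuantile (Set.Ioo 0 1) := fun x hx z hz hxz => by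
    rw [← strictMono_gaussCdf.lt_iff_lt, gaussCdf_gaussQuantile hx.1 hx.2,
      gaussCdf_gaussQuantile hz.1 hz.2]
    exact hxz
  have himg : gaussQuantile '' Set.Ioo 0 1 = Set.univ :=
    Set.eq_univ_of_forall fun s =>
      ⟨gaussCdf s, ⟨gaussCdf_pos s, gaussCdf_lt_one s⟩, gaussQuantile_gaussCdf s⟩
  refine HasDerivAt.of_local_left_inverse
    (hmono.continuousAt_of_image_mem_nhds hmem (by rw [himg]; exact Filter.univ_mem))
    (hasDerivAt_gaussCdf _) (gaussDensity_pos _).ne' ?_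
  filter_upwards [hmem] with z hz using gaussCdf_gaussQuantile hz.1 hz.2

/-- The monotone map with `Φ(F(s)) = a Φ(s)`, where `Φ` is the Gaussian distribution function. -/
noncomputable def gaussTransport (a s : ℝ) : ℝ := gaussQuantile (a * gaussCdf s)

section Transport

variable {a : ℝ}

theorem gaussCdf_gaussTransport (ha : 0 < a) {s : ℝ} (hs : a * gaussCdf s < 1) :
    gaussCdf (gaussTransport a s) = a * gaussCdf s :=
  gaussCdf_gaussQuantile (mul_pos ha (gaussCdf_pos s)) hs

theorem hasDerivAt_gaussTransport (ha : 0 < a) {s : ℝ} (hs : a * gaussCdf s < 1) :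
    HasDerivAt (gaussTransport a) (a * Real.exp ((gaussTransport a s ^ 2 - s ^ 2) / 2)) s := by
  have h := (hasDerivAt_gaussQuantile (mul_pos ha (gaussCdf_pos s)) hs).comp s
    ((hasDerivAt_gaussCdf s).const_mul a)
  convert! h using 1
  change _ = (gaussDensity (gaussTransport a s))⁻¹ * _
  have : Real.exp ((gaussTransport a s ^ 2 - s ^ 2) / 2) =
      Real.exp (-s ^ 2 / 2) * (Real.exp (-gaussTransport a s ^ 2 / 2))⁻¹ := by
    rw [← Real.exp_neg, ← Real.exp_add]; ring_nf
  rw [this, gaussDensity, gaussDensity]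
  have : √(2 * Real.pi) ≠ 0 := by positivity
  field_simp

theorem exp_mul_deriv_gaussTransport (s : ℝ) :
    Real.exp (-gaussTransport a s ^ 2 / 2) *
      (a * Real.exp ((gaussTransport a s ^ 2 - s ^ 2) / 2)) = a * Real.exp (-s ^ 2 / 2) := by
  rw [mul_left_comm, ← Real.exp_add]; ring_nf

theorem hasDerivAt_deriv_gaussTransport (ha : 0 < a) {s : ℝ} (hs : a * gaussCdf s < 1) :
    HasDerivAt (fun s => a * Real.exp ((gaussTransport a s ^ 2 - s ^ 2) / 2))
      (a * Real.exp ((gaussTransport a s ^ 2 - s ^ 2) / 2) *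
        (gaussTransport a s * (a * Real.exp ((gaussTransport a s ^ 2 - s ^ 2) / 2)) - s)) s := by
  have h := ((((hasDerivAt_gaussTransport ha hs).fun_pow 2).fun_sub
    (hasDerivAt_pow 2 s)).div_const 2).exp.const_mul a
  convert! h using 1
  simp; ring

theorem strictMonoOn_gaussTransport (ha : 0 < a) {J : Set ℝ}
    (hJ : ∀ s ∈ J, a * gaussCdf s < 1) : StrictMonoOn (gaussTransport a) J := fun x hx y hy hxy => by
  rw [← strictMono_gaussCdf.lt_iff_lt, gaussCdf_gaussTransport ha (hJ x hx),
    gaussCdf_gaussTransport ha (hJ y hy)]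
  exact mul_lt_mul_of_pos_left (strictMono_gaussCdf hxy) ha

end Transport

/-! ### Numerical bounds for the Gaussian density and tails -/

theorem gaussDensity_zero_le : (√(2 * Real.pi))⁻¹ ≤ 2 / 5 := by
  rw [inv_le_comm₀ (by positivity) (by norm_num)]
  refine Real.le_sqrt_of_sq_le ?_
  nlinarith [Real.pi_gt_d2]

theorem le_gaussDensity_zero : 39 / 100 ≤ (√(2 * Real.pi))⁻¹ := by
  rw [le_inv_comm₀ (by norm_num) (by positivity), Real.sqrt_le_left (by norm_num)]
  nlinarith [Real.pi_lt_d2]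

theorem gaussDensity_le (s : ℝ) : gaussDensity s ≤ 2 / 5 := by
  have h : Real.exp (-s ^ 2 / 2) ≤ 1 := Real.exp_le_one_iff.2 (by nlinarith [sq_nonneg s])
  have := gaussDensity_zero_le
  have h0 : 0 ≤ (√(2 * Real.pi))⁻¹ := by positivity
  unfold gaussDensity
  nlinarith [Real.exp_pos (-s ^ 2 / 2)]

theorem le_gaussDensity_of_abs_le {s r : ℝ} (hs : |s| ≤ r) :
    39 / 100 * (1 - r ^ 2 / 2) ≤ gaussDensity s := by
  have h := Real.add_one_le_exp (-s ^ 2 / 2)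
  have h1 : s ^ 2 ≤ r ^ 2 := by
    rw [← sq_abs]; exact pow_le_pow_left₀ (abs_nonneg s) hs 2
  have := le_gaussDensity_zero
  unfold gaussDensity
  have h2 := mul_le_mul this (show 1 - s ^ 2 / 2 ≤ Real.exp (-s ^ 2 / 2) by linarith)
  rcases le_total 0 (1 - s ^ 2 / 2) with h3 | h3
  · nlinarith [h2 h3 (by positivity)]
  · have : 0 ≤ (√(2 * Real.pi))⁻¹ * Real.exp (-s ^ 2 / 2) := by positivity
    nlinarith

theorem gaussCdf_sub_le {x y : ℝ} (hxy : x ≤ y) : gaussCdf y - gaussCdf x ≤ 2 / 5 * (y - x) := by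
  rcases hxy.eq_or_lt with rfl | h
  · simp
  obtain ⟨z, -, hz⟩ := exists_sub_eq_mul_sub hasDerivAt_gaussCdf h
  rw [hz]
  exact mul_le_mul_of_nonneg_right (gaussDensity_le z) (sub_nonneg.2 hxy)

/-- Since `φ' = -s φ`, the function `Φ + φ/2` decreases on `[2, ∞)`; it exceeds `Φ`, which tends to
`1`. Hence `1 - Φ(2) ≤ φ(2)/2`. -/
theorem one_sub_gaussCdf_two_le : 1 - gaussCdf 2 ≤ 1 / 25 := by
  have hanti : AntitoneOn (fun s => gaussCdf s + gaussDensity s / 2) (Set.Ici 2) := by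
    refine antitoneOn_of_hasDerivWithinAt_nonpos (convex_Ici 2)
      (f' := fun s => gaussDensity s + (-s * gaussDensity s) / 2) ?_ ?_ ?_
    · exact (continuous_gaussCdf.add (continuous_gaussDensity.div_const 2)).continuousOn
    · exact fun s _ => ((hasDerivAt_gaussCdf s).add
        ((hasDerivAt_gaussDensity s).div_const 2)).hasDerivWithinAt
    · intro s hs
      rw [interior_Ici] at hs
      nlinarith [gaussDensity_pos s, Set.mem_Ioi.1 hs]
  have h1 : (1 : ℝ) ≤ gaussCdf 2 + gaussDensity 2 / 2 := by
    refine le_of_tendsto tendsto_gaussCdf_atTop ?_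
    filter_upwards [Filter.eventually_ge_atTop (2 : ℝ)] with s hs
    have h2 := hanti (Set.mem_Ici.2 le_rfl) (Set.mem_Ici.2 hs) hs
    have := gaussDensity_pos s
    simp only at h2
    linarith
  have h2 : Real.exp (-2 ^ 2 / 2) ≤ 1 / 5 := by
    rw [show (-2 ^ 2 / 2 : ℝ) = -2 by norm_num, Real.exp_neg, one_div]
    refine inv_anti₀ (by norm_num) ?_
    have := Real.quadratic_le_exp_of_nonneg (x := 2) (by norm_num)
    linarith
  have h3 : gaussDensity 2 ≤ 2 / 5 * (1 / 5) :=
    mul_le_mul gaussDensity_zero_le h2 (Real.exp_pos _).le (by norm_num)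
  linarith

/-- The mass of `[5/2, 3]` alone suffices, with `e^(9/2) ≤ 92`. The bound keeps `a = Φ(t)^{±1}` away
from `1`, where the transport is the identity and has no curvature. -/
theorem le_one_sub_gaussCdf {t : ℝ} (ht : t ≤ 5 / 2) : 1 / 480 ≤ 1 - gaussCdf t := by
  obtain ⟨z, hz, h⟩ := exists_sub_eq_mul_sub hasDerivAt_gaussCdf (show (5 / 2 : ℝ) < 3 by norm_num)
  have h1 := strictMono_gaussCdf.monotone ht
  have h2 := gaussCdf_lt_one 3
  have h3 : (1 : ℝ) / 92 ≤ Real.exp (-z ^ 2 / 2) := by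
    have h4 : Real.exp (-(9 / 2)) ≤ Real.exp (-z ^ 2 / 2) :=
      Real.exp_le_exp.2 (by nlinarith [hz.1, hz.2])
    refine le_trans ?_ h4
    rw [Real.exp_neg, one_div]
    refine inv_anti₀ (Real.exp_pos _) ?_
    refine le_of_sq_le_sq ?_ (by norm_num)
    rw [← Real.exp_nat_mul, show ((2 : ℕ) : ℝ) * (9 / 2) = (9 : ℕ) * 1 by norm_num, Real.exp_nat_mul]
    calc Real.exp 1 ^ 9 ≤ 2.7182818286 ^ 9 := by gcongr; exact Real.exp_one_lt_d9.le
      _ ≤ 92 ^ 2 := by norm_num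
  have h5 : 39 / 100 * (1 / 92) ≤ gaussDensity z :=
    mul_le_mul le_gaussDensity_zero h3 (by norm_num) (by positivity)
  linarith

/-! ### Uniform convexity and concavity of the transport maps near the origin -/

/-- The reciprocal of the logarithmic derivative of the Gaussian distribution function, times the
variable. -/
noncomputable def gaussMills (s : ℝ) : ℝ := s * gaussCdf s / gaussDensity s

theorem hasDerivAt_gaussMills (s : ℝ) :
    HasDerivAt gaussMills (s + (1 + s ^ 2) * (gaussCdf s / gaussDensity s)) s := by
  have h := ((hasDerivAt_id s).mul (hasDerivAt_gaussCdf s)).div (hasDerivAt_gaussDensity s)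
    (gaussDensity_pos s).ne'
  convert! h using 1
  have := (gaussDensity_pos s).ne'
  simp only [id, Pi.mul_apply]
  field_simp
  ring

/-- To the right of `-1/2` one has `Φ/φ ≥ (3/10)/(2/5) = 3/4`, so the derivative is at least `z +
3/4 (1 + z²) ≥ 1/4`. -/
theorem le_gaussMills_sub {x y : ℝ} (hx : -(1 / 2) ≤ x) (hxy : x ≤ y) :
    1 / 4 * (y - x) ≤ gaussMills y - gaussMills x := by
  rcases hxy.eq_or_lt with rfl | h
  · simp
  obtain ⟨z, hz, hz'⟩ := exists_sub_eq_mul_sub hasDerivAt_gaussMills h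
  rw [hz']
  refine mul_le_mul_of_nonneg_right ?_ (sub_nonneg.2 hxy)
  have hz1 := hz.1
  have h1 : 3 / 10 ≤ gaussCdf z := by
    have h2 := gaussCdf_sub_le (show -(1 / 2) ≤ (0 : ℝ) by norm_num)
    have h3 := strictMono_gaussCdf.monotone (hx.trans hz1.le)
    rw [gaussCdf_zero] at h2
    linarith
  have h4 : 3 / 4 ≤ gaussCdf z / gaussDensity z := by
    rw [le_div_iff₀ (gaussDensity_pos z)]
    linarith [gaussDensity_le z]
  nlinarith [sq_nonneg z]

section SecondDerivative

variable {a : ℝ}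

/-- Substitute `F' = a φ(s)/φ(F)` and `a = Φ(F)/Φ(s)`. As `F'' = F' (F F' - s)`, the sign of `F''`
is that of `gaussMills F - gaussMills s`; where `gaussMills` increases, it is the sign of `F - s`.
-/
theorem gaussTransport_mul_deriv_sub (ha : 0 < a) {s : ℝ} (hs : a * gaussCdf s < 1) :
    gaussTransport a s * (a * Real.exp ((gaussTransport a s ^ 2 - s ^ 2) / 2)) - s =
      gaussDensity s / gaussCdf s * (gaussMills (gaussTransport a s) - gaussMills s) := by
  have h1 : Real.exp ((gaussTransport a s ^ 2 - s ^ 2) / 2) =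
      gaussDensity s / gaussDensity (gaussTransport a s) := by
    have : Real.exp ((gaussTransport a s ^ 2 - s ^ 2) / 2) =
        Real.exp (-s ^ 2 / 2) * (Real.exp (-gaussTransport a s ^ 2 / 2))⁻¹ := by
      rw [← Real.exp_neg, ← Real.exp_add]; ring_nf
    rw [this, gaussDensity, gaussDensity]
    have : √(2 * Real.pi) ≠ 0 := by positivity
    field_simp
  have h2 := (gaussDensity_pos s).ne'
  have h3 := (gaussDensity_pos (gaussTransport a s)).ne'
  have h4 := (gaussCdf_pos s).ne'
  rw [h1, gaussMills, gaussMills, gaussCdf_gaussTransport ha hs]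
  field_simp

theorem le_deriv_gaussTransport (ha : 24 / 25 ≤ a) {s : ℝ} (hs : |s| ≤ 1 / 4) :
    9 / 10 ≤ a * Real.exp ((gaussTransport a s ^ 2 - s ^ 2) / 2) := by
  have h1 := Real.add_one_le_exp ((gaussTransport a s ^ 2 - s ^ 2) / 2)
  have h2 : s ^ 2 ≤ (1 / 4) ^ 2 := by
    rw [← sq_abs]; exact pow_le_pow_left₀ (abs_nonneg s) hs 2
  nlinarith [sq_nonneg (gaussTransport a s)]

theorem gaussCdf_bounds {s : ℝ} (hs : |s| ≤ 1 / 4) : 2 / 5 ≤ gaussCdf s ∧ gaussCdf s ≤ 3 / 5 := by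
  obtain ⟨h1, h2⟩ := abs_le.1 hs
  have h3 := strictMono_gaussCdf.monotone h1
  have h4 := strictMono_gaussCdf.monotone h2
  have h5 := gaussCdf_sub_le (show (0 : ℝ) ≤ 1 / 4 by norm_num)
  rw [gaussCdf_neg] at h3
  rw [gaussCdf_zero] at h5
  constructor <;> linarith

theorem le_gaussDensity_div_gaussCdf {s : ℝ} (hs : |s| ≤ 1 / 4) :
    5 / 8 ≤ gaussDensity s / gaussCdf s := by
  rw [le_div_iff₀ (gaussCdf_pos s)]
  have := le_gaussDensity_of_abs_le hs
  have := (gaussCdf_bounds hs).2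
  linarith

/-- For `a > 1` the transport moves points to the right, here by at least `1/480`, so `F''` is
positive. Quantitatively `F'' ≥ 9/10 · 5/8 · 1/1920`, which exceeds `2/2^13`, the second derivative
of the subtracted square. -/
theorem convexOn_gaussTransport_sub_sq (ha : 1 + 1 / 480 ≤ a)
    (hs : ∀ s ∈ Set.Icc (-(1 / 4)) (1 / 4 : ℝ), a * gaussCdf s < 1) :
    ConvexOn ℝ (Set.Icc (-(1 / 4)) (1 / 4 : ℝ))
      (fun s => gaussTransport a s - 1 / 2 ^ 13 * s ^ 2) := by
  have ha0 : 0 < a := by linarith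
  refine convexOn_of_hasDerivWithinAt2_nonneg (convex_Icc _ _)
    (f' := fun s => a * Real.exp ((gaussTransport a s ^ 2 - s ^ 2) / 2) - 1 / 2 ^ 13 * (2 * s))
    (f'' := fun s => a * Real.exp ((gaussTransport a s ^ 2 - s ^ 2) / 2) *
        (gaussTransport a s * (a * Real.exp ((gaussTransport a s ^ 2 - s ^ 2) / 2)) - s) -
        1 / 2 ^ 13 * 2) ?_ ?_ ?_ ?_
  · intro s h
    exact ((hasDerivAt_gaussTransport ha0 (hs s h)).sub
      ((hasDerivAt_pow 2 s).const_mul _)).continuousAt.continuousWithinAt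
  · intro s h
    convert! ((hasDerivAt_gaussTransport ha0 (hs s (interior_subset h))).sub
      ((hasDerivAt_pow 2 s).const_mul (1 / 2 ^ 13))).hasDerivWithinAt using 1
    simp
  · intro s h
    convert! ((hasDerivAt_deriv_gaussTransport ha0 (hs s (interior_subset h))).sub
      (((hasDerivAt_id s).const_mul 2).const_mul (1 / 2 ^ 13))).hasDerivWithinAt using 1
    simp
  · intro s h
    have hI := interior_subset h
    have habs : |s| ≤ 1 / 4 := abs_le.2 hI
    obtain ⟨h1, h2⟩ := gaussCdf_bounds habs
    have hF := gaussCdf_gaussTransport ha0 (hs s hI)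
    have hlt : s < gaussTransport a s := by
      rw [← strictMono_gaussCdf.lt_iff_lt, hF]; nlinarith
    have h3 := gaussCdf_sub_le hlt.le
    have h4 : 1 / 480 ≤ gaussTransport a s - s := by rw [hF] at h3; nlinarith
    have h5 := le_gaussMills_sub (by linarith [hI.1]) hlt.le
    have h6 : 1 / 1920 ≤ gaussMills (gaussTransport a s) - gaussMills s := by linarith
    have h7 := mul_le_mul (le_gaussDensity_div_gaussCdf habs) h6 (by norm_num)
      (div_pos (gaussDensity_pos s) (gaussCdf_pos s)).le
    have h8 := mul_le_mul (le_deriv_gaussTransport (a := a) (by linarith) habs) h7 (by norm_num)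
      (by positivity)
    rw [gaussTransport_mul_deriv_sub ha0 (hs s hI)]
    linarith

theorem convexOn_neg_gaussTransport_sub_sq (ha : 24 / 25 ≤ a) (ha' : a ≤ 1 - 1 / 480) :
    ConvexOn ℝ (Set.Icc (-(1 / 4)) (1 / 4 : ℝ))
      (fun s => -gaussTransport a s - 1 / 2 ^ 13 * s ^ 2) := by
  have ha0 : 0 < a := by linarith
  have hs : ∀ s, a * gaussCdf s < 1 := fun s => by
    nlinarith [gaussCdf_lt_one s, gaussCdf_pos s]
  refine convexOn_of_hasDerivWithinAt2_nonneg (convex_Icc _ _)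
    (f' := fun s => -(a * Real.exp ((gaussTransport a s ^ 2 - s ^ 2) / 2)) - 1 / 2 ^ 13 * (2 * s))
    (f'' := fun s => -(a * Real.exp ((gaussTransport a s ^ 2 - s ^ 2) / 2) *
        (gaussTransport a s * (a * Real.exp ((gaussTransport a s ^ 2 - s ^ 2) / 2)) - s)) -
        1 / 2 ^ 13 * 2) ?_ ?_ ?_ ?_
  · intro s h
    exact ((hasDerivAt_gaussTransport ha0 (hs s)).neg.sub
      ((hasDerivAt_pow 2 s).const_mul _)).continuousAt.continuousWithinAt
  · intro s h
    convert! ((hasDerivAt_gaussTransport ha0 (hs s)).neg.sub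
      ((hasDerivAt_pow 2 s).const_mul (1 / 2 ^ 13))).hasDerivWithinAt using 1
    simp
  · intro s h
    convert! ((hasDerivAt_deriv_gaussTransport ha0 (hs s)).neg.sub
      (((hasDerivAt_id s).const_mul 2).const_mul (1 / 2 ^ 13))).hasDerivWithinAt using 1
    simp
  · intro s h
    have hI := interior_subset h
    have habs : |s| ≤ 1 / 4 := abs_le.2 hI
    obtain ⟨h1, h2⟩ := gaussCdf_bounds habs
    have hF := gaussCdf_gaussTransport ha0 (hs s)
    have hlt : gaussTransport a s < s := by
      rw [← strictMono_gaussCdf.lt_iff_lt, hF]; nlinarith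
    have h3 := gaussCdf_sub_le hlt.le
    have h4 : 1 / 480 ≤ s - gaussTransport a s := by rw [hF] at h3; nlinarith
    -- The transport now moves points to the left, so its value must be kept in the range where
    -- `gaussMills` is known to increase. Passing from `-1/4` to `-1/2` costs more mass than the
    -- factor `a ≥ 24/25` can remove.
    have hge : -(1 / 2) ≤ gaussTransport a s := by
      obtain ⟨z, hz, hz'⟩ := exists_sub_eq_mul_sub hasDerivAt_gaussCdf
        (show -(1 / 2 : ℝ) < -(1 / 4) by norm_num)
      have h5 := le_gaussDensity_of_abs_le (s := z) (r := 1 / 2)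
        (abs_le.2 ⟨hz.1.le, by linarith [hz.2]⟩)
      have h6 := strictMono_gaussCdf.monotone hI.1
      rw [← strictMono_gaussCdf.le_iff_le, hF]
      nlinarith
    have h5 := le_gaussMills_sub hge hlt.le
    have h6 : 1 / 1920 ≤ gaussMills s - gaussMills (gaussTransport a s) := by linarith
    have h7 := mul_le_mul (le_gaussDensity_div_gaussCdf habs) h6 (by norm_num)
      (div_pos (gaussDensity_pos s) (gaussCdf_pos s)).le
    have h8 := mul_le_mul (le_deriv_gaussTransport (a := a) (by linarith) habs) h7 (by norm_num)
      (by positivity)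
    rw [gaussTransport_mul_deriv_sub ha0 (hs s)]
    linarith

end SecondDerivative

/-! ### Moments over a ball and rotation invariance -/

section Rotation

variable {V : Type*} [NormedAddCommGroup V] [InnerProductSpace ℝ V]
  [FiniteDimensional ℝ V] [MeasurableSpace V] [BorelSpace V]

theorem setIntegral_closedBall_comp_isometry (U : V ≃ₗᵢ[ℝ] V) (r : ℝ) (g : V → ℝ) :
    ∫ x in Metric.closedBall 0 r, g (U x) ∂(stdGaussian V) =
      ∫ x in Metric.closedBall 0 r, g x ∂(stdGaussian V) := by
  have hU : MeasurePreserving U (stdGaussian V) (stdGaussian V) :=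
    ⟨U.continuous.measurable, stdGaussian_map U⟩
  have h := hU.setIntegral_preimage_emb U.toHomeomorph.measurableEmbedding g
    (Metric.closedBall 0 r)
  rwa [U.preimage_closedBall, map_zero] at h

/-- The Gaussian integral over a ball of a function of one coordinate times the square of
another one. -/
noncomputable def ballMoment (r : ℝ) (f : ℝ → ℝ) (v w : V) : ℝ :=
  ∫ x in Metric.closedBall 0 r, f (inner ℝ x v) * inner ℝ x w ^ 2 ∂(stdGaussian V)

theorem ballMoment_map (U : V ≃ₗᵢ[ℝ] V) (r : ℝ) (f : ℝ → ℝ) (v w : V) :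
    ballMoment r f (U v) (U w) = ballMoment r f v w := by
  unfold ballMoment
  rw [← setIntegral_closedBall_comp_isometry U]
  simp only [U.inner_map_map]

omit [FiniteDimensional ℝ V] [MeasurableSpace V] [BorelSpace V] in
theorem continuousOn_comp_inner {r : ℝ} {f : ℝ → ℝ} (hf : ContinuousOn f (Set.Icc (-r) r)) {v : V}
    (hv : ‖v‖ = 1) : ContinuousOn (fun x : V => f (inner ℝ x v)) (Metric.closedBall 0 r) := by
  refine hf.comp (by fun_prop) fun x hx => ?_
  rw [mem_closedBall_zero_iff] at hx
  have := abs_real_inner_le_norm x v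
  rw [hv, mul_one] at this
  exact abs_le.1 (this.trans hx)

theorem integrableOn_closedBall {r : ℝ} {g : V → ℝ} (hg : ContinuousOn g (Metric.closedBall 0 r)) :
    IntegrableOn g (Metric.closedBall 0 r) (stdGaussian V) :=
  hg.integrableOn_compact (isCompact_closedBall 0 r)

variable {e₁ e₂ : V} (h₁ : ‖e₁‖ = 1) (h₂ : ‖e₂‖ = 1) (h₁₂ : inner ℝ e₁ e₂ = (0 : ℝ))
include h₁ h₂ h₁₂

/-- A rotation takes `v` to `e₁` and `w` into the plane of `e₁, e₂`. Expanding the square leaves a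
mixed term, which is odd under the reflection of `e₂` and integrates to zero. -/
theorem ballMoment_eq {r : ℝ} {f : ℝ → ℝ} (hf : ContinuousOn f (Set.Icc (-r) r)) {v w : V}
    (hv : ‖v‖ = 1) (hw : ‖w‖ = 1) :
    ballMoment r f v w = inner ℝ v w ^ 2 * ballMoment r f e₁ e₁ +
      (1 - inner ℝ v w ^ 2) * ballMoment r f e₁ e₂ := by
  let U := (ℝ ∙ (v - e₁))ᗮ.reflection
  have hUv : U v = e₁ := Submodule.reflection_sub (hv.trans h₁.symm)
  rw [← U.inner_map_map v w, ← ballMoment_map U, hUv]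
  have hw' : ‖U w‖ = 1 := by rw [U.norm_map, hw]
  generalize U w = w' at hw'
  set ρ : ℝ := inner ℝ e₁ w' with hρ
  set w₂ := w' - ρ • e₁ with hw₂
  have h1 : inner ℝ e₁ w₂ = (0 : ℝ) := by
    rw [hw₂, inner_sub_right, real_inner_smul_right, real_inner_self_eq_norm_sq, h₁, ← hρ]; ring
  have hn : ‖w₂‖ ^ 2 = 1 - ρ ^ 2 := by
    rw [hw₂, norm_sub_sq_real, real_inner_smul_right, real_inner_comm, ← hρ, norm_smul, h₁, hw']
    simp; ring
  -- This reflection fixes `e₁`, since both `w₂` and `e₂` are orthogonal to it.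
  let T := (ℝ ∙ (w₂ - ‖w₂‖ • e₂))ᗮ.reflection
  have hTw : T w₂ = ‖w₂‖ • e₂ := Submodule.reflection_sub (by rw [norm_smul, h₂]; simp)
  have hTe : T e₁ = e₁ := by
    refine Submodule.reflection_mem_subspace_eq_self ?_
    rw [Submodule.mem_orthogonal_singleton_iff_inner_right, inner_sub_left, real_inner_smul_left,
      real_inner_comm, h1, real_inner_comm, h₁₂]; simp
  have hTw' : T w' = ρ • e₁ + ‖w₂‖ • e₂ := by
    have : w' = ρ • e₁ + w₂ := by rw [hw₂]; abel
    rw [this, map_add, map_smul, hTe, hTw]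
  rw [← ballMoment_map T, hTe, hTw']
  have hc := continuousOn_comp_inner hf h₁
  have hcross : ∫ x in Metric.closedBall 0 r,
      f (inner ℝ x e₁) * (inner ℝ x e₁ * inner ℝ x e₂) ∂(stdGaussian V) = 0 := by
    let S := (ℝ ∙ e₂)ᗮ.reflection
    have hS1 : S e₁ = e₁ := by
      refine Submodule.reflection_mem_subspace_eq_self ?_
      rw [Submodule.mem_orthogonal_singleton_iff_inner_right, real_inner_comm, h₁₂]
    have hS2 : S e₂ = -e₂ := Submodule.reflection_orthogonalComplement_singleton_eq_neg e₂
    have h := setIntegral_closedBall_comp_isometry S r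
      (fun x => f (inner ℝ x e₁) * (inner ℝ x e₁ * inner ℝ x e₂))
    have hx1 : ∀ x, inner ℝ (S x) e₁ = (inner ℝ x e₁ : ℝ) := fun x => by
      conv_lhs => rw [← hS1]
      exact S.inner_map_map _ _
    have hx2 : ∀ x, inner ℝ (S x) e₂ = -(inner ℝ x e₂ : ℝ) := fun x => by
      rw [← inner_neg_right, ← S.inner_map_map x (-e₂), map_neg, hS2, neg_neg]
    simp only [hx1, hx2, mul_neg, integral_neg] at h
    linarith
  have hi1 : IntegrableOn (fun x => f (inner ℝ x e₁) * inner ℝ x e₁ ^ 2)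
      (Metric.closedBall 0 r) (stdGaussian V) :=
    integrableOn_closedBall (hc.mul (by fun_prop))
  have hi2 : IntegrableOn (fun x => f (inner ℝ x e₁) * inner ℝ x e₂ ^ 2)
      (Metric.closedBall 0 r) (stdGaussian V) :=
    integrableOn_closedBall (hc.mul (by fun_prop))
  have hi3 : IntegrableOn (fun x => f (inner ℝ x e₁) * (inner ℝ x e₁ * inner ℝ x e₂))
      (Metric.closedBall 0 r) (stdGaussian V) :=
    integrableOn_closedBall (hc.mul (by fun_prop))
  have hexp : ∀ x, f (inner ℝ x e₁) * inner ℝ x (ρ • e₁ + ‖w₂‖ • e₂) ^ 2 =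
      ρ ^ 2 * (f (inner ℝ x e₁) * inner ℝ x e₁ ^ 2) +
      (1 - ρ ^ 2) * (f (inner ℝ x e₁) * inner ℝ x e₂ ^ 2) +
      2 * ρ * ‖w₂‖ * (f (inner ℝ x e₁) * (inner ℝ x e₁ * inner ℝ x e₂)) := fun x => by
    rw [← hn, inner_add_right, real_inner_smul_right, real_inner_smul_right]; ring
  unfold ballMoment
  simp only [hexp]
  rw [integral_add ((hi1.const_mul _).fun_add (hi2.const_mul _)) (hi3.const_mul _),
    integral_add (hi1.const_mul _) (hi2.const_mul _), integral_const_mul, integral_const_mul,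
    integral_const_mul, hcross, mul_zero, add_zero]

/-- Average the difference with its image under the reflection exchanging `e₁` and `e₂`. The
integrand becomes a product of two differences, as in Chebyshev's inequality. -/
theorem ballMoment_sub_eq {r : ℝ} {f : ℝ → ℝ} (hf : ContinuousOn f (Set.Icc (-r) r)) :
    ballMoment r f e₁ e₁ - ballMoment r f e₁ e₂ = 2⁻¹ * ∫ x in Metric.closedBall 0 r,
      (f (inner ℝ x e₁) - f (inner ℝ x e₂)) * (inner ℝ x e₁ ^ 2 - inner ℝ x e₂ ^ 2)
        ∂(stdGaussian V) := by
  let S := (ℝ ∙ (e₁ - e₂))ᗮ.reflection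
  have hS1 : S e₁ = e₂ := Submodule.reflection_sub (h₁.trans h₂.symm)
  have hS2 : S e₂ = e₁ := by rw [← hS1]; exact Submodule.reflection_reflection _ _
  have hc1 := continuousOn_comp_inner hf h₁
  have hc2 := continuousOn_comp_inner hf h₂
  have ha := ballMoment_map S r f e₁ e₁
  have hb := ballMoment_map S r f e₁ e₂
  rw [hS1] at ha
  rw [hS1, hS2] at hb
  have hi : ∀ e ∈ ({e₁, e₂} : Set V), ∀ e' : V, IntegrableOn
      (fun x => f (inner ℝ x e) * inner ℝ x e' ^ 2) (Metric.closedBall 0 r) (stdGaussian V) := by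
    rintro e (rfl | rfl) e'
    · exact integrableOn_closedBall (hc1.mul (by fun_prop))
    · exact integrableOn_closedBall (hc2.mul (by fun_prop))
  have hexp : ∀ x : V,
      (f (inner ℝ x e₁) - f (inner ℝ x e₂)) * (inner ℝ x e₁ ^ 2 - inner ℝ x e₂ ^ 2) =
      f (inner ℝ x e₁) * inner ℝ x e₁ ^ 2 - f (inner ℝ x e₁) * inner ℝ x e₂ ^ 2 +
      (f (inner ℝ x e₂) * inner ℝ x e₂ ^ 2 - f (inner ℝ x e₂) * inner ℝ x e₁ ^ 2) :=
    fun x => by ring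
  simp only [hexp]
  rw [integral_add ((hi _ (by simp) _).fun_sub (hi _ (by simp) _))
    ((hi _ (by simp) _).fun_sub (hi _ (by simp) _)), integral_sub (hi _ (by simp) _) (hi _ (by simp) _),
    integral_sub (hi _ (by simp) _) (hi _ (by simp) _)]
  unfold ballMoment at *
  linarith

/-- The moments only see the even part of `f`. An even convex function increases with `s²`, so the
two factors in `ballMoment_sub_eq` have the same sign. -/
theorem ballMoment_le_of_convexOn {r : ℝ} {f : ℝ → ℝ} (hf : ContinuousOn f (Set.Icc (-r) r))
    (hconv : ConvexOn ℝ (Set.Icc (-r) r) f) : ballMoment r f e₁ e₂ ≤ ballMoment r f e₁ e₁ := by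
  let g : ℝ → ℝ := fun s => f s + f (-s)
  have hfn : ContinuousOn (fun s => f (-s)) (Set.Icc (-r) r) :=
    hf.comp (by fun_prop) fun x hx => ⟨by linarith [hx.2], by linarith [hx.1]⟩
  have hg : ContinuousOn g (Set.Icc (-r) r) := hf.add hfn
  have hneg : ∀ w : V, ballMoment r (fun s => f (-s)) e₁ w = ballMoment r f e₁ w := fun w => by
    rw [← ballMoment_map (LinearIsometryEquiv.neg ℝ) r f e₁ w]
    simp [ballMoment]
  have hsum : ∀ w : V, ballMoment r g e₁ w = 2 * ballMoment r f e₁ w := fun w => by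
    have i1 : IntegrableOn (fun x => f (inner ℝ x e₁) * inner ℝ x w ^ 2)
        (Metric.closedBall 0 r) (stdGaussian V) :=
      integrableOn_closedBall ((continuousOn_comp_inner hf h₁).mul (by fun_prop))
    have i2 : IntegrableOn (fun x => f (-inner ℝ x e₁) * inner ℝ x w ^ 2)
        (Metric.closedBall 0 r) (stdGaussian V) :=
      integrableOn_closedBall ((continuousOn_comp_inner hfn h₁).mul (by fun_prop))
    rw [two_mul]
    nth_rewrite 2 [← hneg w]
    unfold ballMoment
    rw [← integral_add i1 i2]
    simp only [g, add_mul]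
  -- If `y² ≤ x²`, then `y` and `-y` are convex combinations of `x` and `-x` with swapped weights;
  -- add the two convexity inequalities.
  have hmono : ∀ x ∈ Set.Icc (-r) r, ∀ y ∈ Set.Icc (-r) r, y ^ 2 ≤ x ^ 2 → g y ≤ g x := by
    intro x hx y hy hxy
    have hx' : -x ∈ Set.Icc (-r) r := ⟨by linarith [hx.2], by linarith [hx.1]⟩
    rcases eq_or_ne x 0 with rfl | hx0
    · have : y = 0 := by nlinarith
      rw [this]
    have h3 : |y / x| ≤ 1 := by
      rw [abs_div, div_le_one (abs_pos.2 hx0)]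
      exact sq_le_sq.1 hxy
    obtain ⟨h4, h5⟩ := abs_le.1 h3
    have h6 := hconv.2 hx hx' (show 0 ≤ (1 + y / x) / 2 by linarith)
      (show 0 ≤ (1 - y / x) / 2 by linarith) (by ring)
    have h7 := hconv.2 hx' hx (show 0 ≤ (1 + y / x) / 2 by linarith)
      (show 0 ≤ (1 - y / x) / 2 by linarith) (by ring)
    simp only [smul_eq_mul] at h6 h7
    rw [show (1 + y / x) / 2 * x + (1 - y / x) / 2 * -x = y by field_simp; ring] at h6
    rw [show (1 + y / x) / 2 * -x + (1 - y / x) / 2 * x = -y by field_simp; ring] at h7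
    simp only [g]
    nlinarith
  have h := ballMoment_sub_eq h₁ h₂ h₁₂ hg
  rw [hsum, hsum] at h
  have hnn : 0 ≤ ∫ x in Metric.closedBall 0 r,
      (g (inner ℝ x e₁) - g (inner ℝ x e₂)) * (inner ℝ x e₁ ^ 2 - inner ℝ x e₂ ^ 2)
        ∂(stdGaussian V) := by
    refine setIntegral_nonneg measurableSet_closedBall fun x hx => ?_
    rw [mem_closedBall_zero_iff] at hx
    have hm : ∀ e : V, ‖e‖ = 1 → inner ℝ x e ∈ Set.Icc (-r) r := fun e he => by
      have := abs_real_inner_le_norm x e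
      rw [he, mul_one] at this
      exact abs_le.1 (this.trans hx)
    rcases le_total (inner ℝ x e₁ ^ 2 : ℝ) (inner ℝ x e₂ ^ 2) with h3 | h3
    · exact mul_nonneg_of_nonpos_of_nonpos
        (sub_nonpos.2 (hmono _ (hm _ h₂) _ (hm _ h₁) h3)) (sub_nonpos.2 h3)
    · exact mul_nonneg
        (sub_nonneg.2 (hmono _ (hm _ h₁) _ (hm _ h₂) h3)) (sub_nonneg.2 h3)
  linarith

end Rotation

/-! ### The spread of a frame bounds the deficit from below -/

/-- A measure of the distance of a frame to an orthonormal basis with repetitions: it is small if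
any two vectors of the frame are nearly orthogonal or nearly equal. -/
noncomputable def frameSpread {V ι : Type*} [NormedAddCommGroup V] [InnerProductSpace ℝ V]
    [Fintype ι] (v : ι → V) (c : ι → ℝ) : ℝ :=
  ∑ i, ∑ j, c i * c j * (inner ℝ (v i) (v j) ^ 2 * (1 - inner ℝ (v i) (v j)))

namespace IsTightFrame

variable {V ι : Type*} [NormedAddCommGroup V] [InnerProductSpace ℝ V] [Fintype ι]
  {v : ι → V} {c : ι → ℝ}

theorem frameSpread_eq (h : IsTightFrame v c) :
    frameSpread v c = ∑ i, c i - ∑ i, ∑ j, c i * c j * inner ℝ (v i) (v j) ^ 3 := by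
  have h1 : ∑ i, ∑ j, c i * c j * inner ℝ (v i) (v j) ^ 2 = ∑ i, c i := by
    refine Finset.sum_congr rfl fun i _ => ?_
    have := h.sum_inner_sq (v i)
    simp only [mul_assoc, ← Finset.mul_sum]
    rw [this, h.norm_eq_one]; ring
  rw [← h1, frameSpread, ← Finset.sum_sub_distrib]
  refine Finset.sum_congr rfl fun i _ => ?_
  rw [← Finset.sum_sub_distrib]
  exact Finset.sum_congr rfl fun j _ => by ring

/-- The frame expansion of `e` is `e = ∑ c j v j`; pair it with each `v i`. This is where the common
hyperplane of the lifted vectors enters. -/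
theorem sum_mul_inner_eq (h : IsTightFrame v c) {e : V} (he : ∀ i, inner ℝ e (v i) = (1 : ℝ)) :
    ∑ i, ∑ j, c i * c j * inner ℝ (v i) (v j) = ∑ i, c i := by
  have h1 := h.expand e
  simp only [he, mul_one] at h1
  refine Finset.sum_congr rfl fun i _ => ?_
  have : inner ℝ (v i) (∑ j, c j • v j) = (1 : ℝ) := by rw [h1, real_inner_comm, he]
  simp only [inner_sum, real_inner_smul_right] at this
  simp only [mul_assoc, ← Finset.mul_sum]
  rw [this, mul_one]

theorem frameForm_expand (a b : ι → ℝ) :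
    frameForm v c a b =
      ∑ i, c i * (a i * b i) - ∑ i, ∑ j, c i * c j * inner ℝ (v i) (v j) * (a i * b j) := by
  rw [frameForm, sum_inner]
  congr 1
  refine Finset.sum_congr rfl fun i _ => ?_
  rw [inner_sum]
  refine Finset.sum_congr rfl fun j _ => ?_
  rw [real_inner_smul_left, real_inner_smul_right]; ring

theorem frameForm_add_self (l : ℝ) (q b : ι → ℝ) :
    frameForm v c (fun i => l * q i + b i) (fun i => l * q i + b i) =
      l ^ 2 * frameForm v c q q + 2 * l * frameForm v c b q + frameForm v c b b := by
  have h1 : ∑ i, (c i * (l * q i + b i)) • v i =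
      l • ∑ i, (c i * q i) • v i + ∑ i, (c i * b i) • v i := by
    rw [Finset.smul_sum, ← Finset.sum_add_distrib]
    refine Finset.sum_congr rfl fun i _ => ?_
    rw [smul_smul, ← add_smul]; congr 1; ring
  have h2 : ∑ i, c i * ((l * q i + b i) * (l * q i + b i)) =
      l ^ 2 * ∑ i, c i * (q i * q i) + 2 * l * ∑ i, c i * (b i * q i) + ∑ i, c i * (b i * b i) := by
    rw [Finset.mul_sum, Finset.mul_sum, ← Finset.sum_add_distrib, ← Finset.sum_add_distrib]
    exact Finset.sum_congr rfl fun i _ => by ring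
  simp only [frameForm, h1, h2]
  generalize ∑ i, (c i * q i) • v i = x
  generalize ∑ i, (c i * b i) • v i = y
  rw [inner_add_add_self, real_inner_smul_left, real_inner_smul_left, real_inner_smul_right,
    real_inner_smul_right, real_inner_comm y x]
  ring

theorem frameForm_neg_neg (a b : ι → ℝ) :
    frameForm v c (fun i => -a i) (fun i => -b i) = frameForm v c a b := by
  simp [frameForm_expand]

variable [FiniteDimensional ℝ V] [MeasurableSpace V] [BorelSpace V]
  {e₁ e₂ : V} (h₁ : ‖e₁‖ = 1) (h₂ : ‖e₂‖ = 1) (h₁₂ : inner ℝ e₁ e₂ = (0 : ℝ))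

omit [FiniteDimensional ℝ V] [MeasurableSpace V] [BorelSpace V] in
theorem continuousOn_frameForm (h : IsTightFrame v c) {r : ℝ} {f g : ℝ → ℝ}
    (hf : ContinuousOn f (Set.Icc (-r) r)) (hg : ContinuousOn g (Set.Icc (-r) r)) :
    ContinuousOn (fun x => frameForm v c (fun i => f (inner ℝ x (v i)))
      (fun i => g (inner ℝ x (v i)))) (Metric.closedBall 0 r) := by
  simp only [frameForm_expand]
  have hf' := fun i => continuousOn_comp_inner hf (h.norm_eq_one i)
  have hg' := fun i => continuousOn_comp_inner hg (h.norm_eq_one i)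
  refine ContinuousOn.sub (continuousOn_finsetSum _ fun i _ => ?_)
    (continuousOn_finsetSum _ fun i _ => continuousOn_finsetSum _ fun j _ => ?_)
  · exact continuousOn_const.mul ((hf' i).mul (hg' i))
  · exact continuousOn_const.mul ((hf' i).mul (hg' j))

include h₁ h₂ h₁₂

/-- By `ballMoment_eq` each double-sum term contributes a combination of `ρ³` and `ρ`, with `ρ = ⟪v
i, v j⟫`. The linear parts sum to `∑ c i` by the hyperplane condition, and `frameSpread_eq`
identifies the rest. -/
theorem setIntegral_frameForm_sq (h : IsTightFrame v c) {e : V}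
    (he : ∀ i, inner ℝ e (v i) = (1 : ℝ)) {r : ℝ} {f : ℝ → ℝ}
    (hf : ContinuousOn f (Set.Icc (-r) r)) :
    ∫ x in Metric.closedBall 0 r, frameForm v c (fun i => f (inner ℝ x (v i)))
      (fun i => inner ℝ x (v i) ^ 2) ∂(stdGaussian V) =
      (ballMoment r f e₁ e₁ - ballMoment r f e₁ e₂) * frameSpread v c := by
  have hi : ∀ i j, IntegrableOn (fun x : V => f (inner ℝ x (v i)) * inner ℝ x (v j) ^ 2)
      (Metric.closedBall 0 r) (stdGaussian V) := fun i j =>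
    integrableOn_closedBall ((continuousOn_comp_inner hf (h.norm_eq_one i)).mul (by fun_prop))
  have hij : ∀ i j, ∫ x in Metric.closedBall 0 r,
      f (inner ℝ x (v i)) * inner ℝ x (v j) ^ 2 ∂(stdGaussian V) = _ := fun i j =>
    ballMoment_eq h₁ h₂ h₁₂ hf (h.norm_eq_one i) (h.norm_eq_one j)
  simp only [frameForm_expand]
  rw [integral_sub (integrable_finsetSum _ fun i _ => (hi i i).const_mul _)
    (integrable_finsetSum _ fun i _ => integrable_finsetSum _ fun j _ => (hi i j).const_mul _),
    integral_finsetSum _ fun i _ => (hi i i).const_mul _,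
    integral_finsetSum _ fun i _ => integrable_finsetSum _ fun j _ => (hi i j).const_mul _]
  simp only [integral_finsetSum _ fun j _ => (hi _ j).const_mul _, integral_const_mul, hij,
    real_inner_self_eq_norm_sq, h.norm_eq_one]
  set A := ballMoment r f e₁ e₁
  set B := ballMoment r f e₁ e₂
  have h1 : ∑ i, ∑ j, c i * c j * inner ℝ (v i) (v j) *
      (inner ℝ (v i) (v j) ^ 2 * A + (1 - inner ℝ (v i) (v j) ^ 2) * B) =
      (A - B) * ∑ i, ∑ j, c i * c j * inner ℝ (v i) (v j) ^ 3 +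
        B * ∑ i, ∑ j, c i * c j * inner ℝ (v i) (v j) := by
    rw [Finset.mul_sum, Finset.mul_sum, ← Finset.sum_add_distrib]
    refine Finset.sum_congr rfl fun i _ => ?_
    rw [Finset.mul_sum, Finset.mul_sum, ← Finset.sum_add_distrib]
    exact Finset.sum_congr rfl fun j _ => by ring
  rw [h1, h.sum_mul_inner_eq he, h.frameSpread_eq, ← Finset.sum_mul]
  ring

/-- If `f - l s²` is convex then the deficit of `f` is bounded below by the spread. -/
theorem le_setIntegral_frameForm (h : IsTightFrame v c) {e : V}
    (he : ∀ i, inner ℝ e (v i) = (1 : ℝ)) {r l : ℝ} (hl : 0 ≤ l) {f : ℝ → ℝ}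
    (hf : ContinuousOn f (Set.Icc (-r) r))
    (hconv : ConvexOn ℝ (Set.Icc (-r) r) (fun s => f s - l * s ^ 2)) :
    l ^ 2 * (2⁻¹ * ∫ x in Metric.closedBall 0 r,
      (inner ℝ x e₁ ^ 2 - inner ℝ x e₂ ^ 2) ^ 2 ∂(stdGaussian V)) * frameSpread v c ≤
    ∫ x in Metric.closedBall 0 r, frameForm v c (fun i => f (inner ℝ x (v i)))
      (fun i => f (inner ℝ x (v i))) ∂(stdGaussian V) := by
  let b : ℝ → ℝ := fun s => f s - l * s ^ 2
  have hb : ContinuousOn b (Set.Icc (-r) r) := hf.sub (by fun_prop)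
  have hq : ContinuousOn (fun s : ℝ => s ^ 2) (Set.Icc (-r) r) := by fun_prop
  have hfb : ∀ x : V, frameForm v c (fun i => f (inner ℝ x (v i)))
      (fun i => f (inner ℝ x (v i))) =
      l ^ 2 * frameForm v c (fun i => inner ℝ x (v i) ^ 2) (fun i => inner ℝ x (v i) ^ 2) +
      2 * l * frameForm v c (fun i => b (inner ℝ x (v i))) (fun i => inner ℝ x (v i) ^ 2) +
      frameForm v c (fun i => b (inner ℝ x (v i))) (fun i => b (inner ℝ x (v i))) := fun x => by
    rw [← frameForm_add_self]; simp [b]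
  simp only [hfb]
  have i1 := integrableOn_closedBall (h.continuousOn_frameForm hq hq)
  have i2 := integrableOn_closedBall (h.continuousOn_frameForm hb hq)
  have i3 := integrableOn_closedBall (h.continuousOn_frameForm hb hb)
  rw [integral_add ((i1.const_mul _).fun_add (i2.const_mul _)) i3,
    integral_add (i1.const_mul _) (i2.const_mul _), integral_const_mul, integral_const_mul,
    h.setIntegral_frameForm_sq h₁ h₂ h₁₂ he hq, h.setIntegral_frameForm_sq h₁ h₂ h₁₂ he hb,
    ballMoment_sub_eq h₁ h₂ h₁₂ hq]
  have hS : 0 ≤ frameSpread v c := by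
    refine Finset.sum_nonneg fun i _ => Finset.sum_nonneg fun j _ => ?_
    have := (real_inner_le_norm (v i) (v j))
    rw [h.norm_eq_one, h.norm_eq_one] at this
    exact mul_nonneg (mul_pos (h.weight_pos i) (h.weight_pos j)).le
      (mul_nonneg (sq_nonneg _) (by linarith))
  -- In the expansion of `f = l s² + b` the cross term is nonnegative because `b` is convex, and the
  -- `b` term because the form is positive semidefinite. Only the pure square survives in the bound.
  have hm := ballMoment_le_of_convexOn h₁ h₂ h₁₂ hb hconv
  have hnn : 0 ≤ ∫ x in Metric.closedBall 0 r, frameForm v c (fun i => b (inner ℝ x (v i)))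
      (fun i => b (inner ℝ x (v i))) ∂(stdGaussian V) :=
    integral_nonneg fun x => h.frameForm_self_nonneg _
  have := mul_nonneg (mul_nonneg (by norm_num : (0 : ℝ) ≤ 2) hl)
    (mul_nonneg (sub_nonneg.2 hm) hS)
  simp only [← pow_two]
  linarith

end IsTightFrame

/-! ### An explicit lower bound for the fourth-order moment -/

theorem le_gaussianReal_Icc {x y h : ℝ} (hx : -(1 / 4) ≤ x) (hy : y ≤ 1 / 4)
    (hxy : h / 4 ≤ y - x) :
    ENNReal.ofReal (3 * h / 32) ≤ gaussianReal 0 1 (Set.Icc x y) := by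
  rw [gaussianReal_apply 0 (by norm_num)]
  have h1 : ∀ s ∈ Set.Icc x y, ENNReal.ofReal (3 / 8) ≤ gaussianPDF 0 1 s := fun s hs => by
    have h2 := le_gaussDensity_of_abs_le (s := s) (r := 1 / 4)
      (abs_le.2 ⟨hx.trans hs.1, hs.2.trans hy⟩)
    refine ENNReal.ofReal_le_ofReal ?_
    have : gaussianPDFReal 0 1 s = gaussDensity s := by simp [gaussianPDFReal, gaussDensity]
    rw [this]; linarith
  refine le_trans ?_ (setLIntegral_mono' measurableSet_Icc h1)
  rw [setLIntegral_const, Real.volume_Icc, ← ENNReal.ofReal_mul (by norm_num)]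
  exact ENNReal.ofReal_le_ofReal (by linarith)

theorem le_ballMoment_sq (m : ℕ) :
    1 / (57 * (4 * (m + 2 : ℝ)) ^ 4 * (43 * (m + 2 : ℝ)) ^ (m + 2)) ≤
      2⁻¹ * ∫ x in Metric.closedBall (0 : EuclideanSpace ℝ (Fin (m + 2))) (1 / 4),
      (inner ℝ x (EuclideanSpace.single 0 1) ^ 2 - inner ℝ x (EuclideanSpace.single 1 1) ^ 2) ^ 2
        ∂(stdGaussian (EuclideanSpace ℝ (Fin (m + 2)))) := by
  set N : ℝ := m + 2 with hN
  have hN0 : 2 ≤ N := by rw [hN]; linarith [(Nat.cast_nonneg m : (0 : ℝ) ≤ m)]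
  set h : ℝ := 1 / (4 * N) with hh
  have h0 : 0 < h := by positivity
  have h4 : h ≤ 1 / 4 := by
    rw [hh, div_le_div_iff₀ (by positivity) (by norm_num)]; linarith
  -- A box inside the ball with `x₀ ≥ h/2` and `0 ≤ x₁ ≤ h/4`, so that `x₀² - x₁² ≥ 3h²/16`. Every
  -- side is at least `h/4` long and lies where the density is at least `3/8`, hence the mass
  -- `3h/32` per coordinate.
  let lo : Fin (m + 2) → ℝ := fun i => if i = 0 then h / 2 else if i = 1 then 0 else -h
  let hi : Fin (m + 2) → ℝ := fun i => if i = 1 then h / 4 else h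
  set box : Set (EuclideanSpace ℝ (Fin (m + 2))) := {x | ∀ i, x i ∈ Set.Icc (lo i) (hi i)} with hbox
  have hlo : ∀ i, -h ≤ lo i := fun i => by simp only [lo]; split_ifs <;> linarith
  have hhi : ∀ i, hi i ≤ h := fun i => by simp only [hi]; split_ifs <;> linarith
  have hlen : ∀ i, h / 4 ≤ hi i - lo i := fun i => by
    simp only [hi, lo]
    split_ifs with a b <;> first | linarith | (exact absurd (a.symm.trans b) (by simp))
  have hboxm : MeasurableSet box := by
    have : box = ⋂ i, (fun x : EuclideanSpace ℝ (Fin (m + 2)) => x i) ⁻¹' Set.Icc (lo i) (hi i) := by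
      ext; simp [hbox]
    rw [this]
    exact MeasurableSet.iInter fun i => measurableSet_Icc.preimage (by fun_prop)
  have hsub : box ⊆ Metric.closedBall 0 (1 / 4) := fun x hx => by
    rw [mem_closedBall_zero_iff]
    refine (sq_le_sq₀ (norm_nonneg x) (by norm_num)).1 ?_
    rw [EuclideanSpace.real_norm_sq_eq]
    calc ∑ i, x i ^ 2 ≤ ∑ i : Fin (m + 2), h ^ 2 := Finset.sum_le_sum fun i _ =>
          sq_le_sq' ((hlo i).trans (hx i).1) ((hx i).2.trans (hhi i))
      _ = N * h ^ 2 := by simp [hN]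
      _ ≤ (1 / 4) ^ 2 := by
        rw [hh]
        have : N * (1 / (4 * N)) ^ 2 = (1 / 4) ^ 2 * (1 / N) := by field_simp
        rw [this]
        have : 1 / N ≤ 1 := by rw [div_le_one (by linarith)]; linarith
        nlinarith
  have hmeas : (3 * h / 32) ^ (m + 2) ≤
      (stdGaussian (EuclideanSpace ℝ (Fin (m + 2)))).real box := by
    rw [measureReal_def, ← ENNReal.ofReal_le_iff_le_toReal (measure_ne_top _ _),
      ← map_pi_eq_stdGaussian, Measure.map_apply (by fun_prop) hboxm]
    have : (WithLp.toLp 2) ⁻¹' box = Set.pi Set.univ fun i => Set.Icc (lo i) (hi i) := by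
      ext; simp only [hbox, Set.mem_preimage, Set.mem_ofPred_eq, Set.mem_pi, Set.mem_univ, true_imp_iff]
    rw [this, Measure.pi_pi, ENNReal.ofReal_pow (by positivity)]
    calc ENNReal.ofReal (3 * h / 32) ^ (m + 2)
        = ∏ i : Fin (m + 2), ENNReal.ofReal (3 * h / 32) := by simp
      _ ≤ _ := Finset.prod_le_prod' fun i _ => le_gaussianReal_Icc
        (by linarith [hlo i]) (by linarith [hhi i]) (hlen i)
  have hint : ∀ x : EuclideanSpace ℝ (Fin (m + 2)), (inner ℝ x (EuclideanSpace.single 0 1) ^ 2 -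
      inner ℝ x (EuclideanSpace.single 1 1) ^ 2) ^ 2 = (x 0 ^ 2 - x 1 ^ 2) ^ 2 := fun x => by
    rw [EuclideanSpace.inner_single_right, EuclideanSpace.inner_single_right]; simp
  simp only [hint]
  have hio : IntegrableOn (fun x : EuclideanSpace ℝ (Fin (m + 2)) => (x 0 ^ 2 - x 1 ^ 2) ^ 2)
      (Metric.closedBall 0 (1 / 4)) (stdGaussian _) := integrableOn_closedBall (by fun_prop)
  have h1 : (9 * h ^ 4 / 256) * (3 * h / 32) ^ (m + 2) ≤
      ∫ x in Metric.closedBall (0 : EuclideanSpace ℝ (Fin (m + 2))) (1 / 4),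
        (x 0 ^ 2 - x 1 ^ 2) ^ 2 ∂(stdGaussian (EuclideanSpace ℝ (Fin (m + 2)))) := by
    calc _ ≤ (9 * h ^ 4 / 256) * (stdGaussian (EuclideanSpace ℝ (Fin (m + 2)))).real box := by
          gcongr
      _ = ∫ x in box, (9 * h ^ 4 / 256) ∂(stdGaussian (EuclideanSpace ℝ (Fin (m + 2)))) := by
          rw [setIntegral_const, smul_eq_mul, mul_comm]
      _ ≤ ∫ x in box, (x 0 ^ 2 - x 1 ^ 2) ^ 2 ∂(stdGaussian (EuclideanSpace ℝ (Fin (m + 2)))) := by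
          refine setIntegral_mono_on (by simp) (hio.mono_set hsub) hboxm fun x hx => ?_
          have a0 := hx 0
          have a1 := hx 1
          simp only [lo, hi, if_true, one_ne_zero, zero_ne_one, if_false, Set.mem_Icc] at a0 a1
          have b0 : (h / 2) ^ 2 ≤ x 0 ^ 2 := pow_le_pow_left₀ (by positivity) a0.1 2
          have b1 : x 1 ^ 2 ≤ (h / 4) ^ 2 := pow_le_pow_left₀ a1.1 a1.2 2
          have b2 : 3 * h ^ 2 / 16 ≤ x 0 ^ 2 - x 1 ^ 2 := by linarith
          calc 9 * h ^ 4 / 256 = (3 * h ^ 2 / 16) ^ 2 := by ring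
            _ ≤ _ := pow_le_pow_left₀ (by positivity) b2 2
      _ ≤ _ := setIntegral_mono_set hio (Filter.Eventually.of_forall fun x => sq_nonneg _)
          (Filter.Eventually.of_forall hsub)
  calc 1 / (57 * (4 * N) ^ 4 * (43 * N) ^ (m + 2))
      = (1 / 57) * h ^ 4 * (1 / (43 * N)) ^ (m + 2) := by
        rw [hh, div_pow, div_pow, one_pow, one_pow]
        field_simp
    _ ≤ 2⁻¹ * (9 / 256) * h ^ 4 * (3 * h / 32) ^ (m + 2) := by
        have : 1 / (43 * N) ≤ 3 * h / 32 := by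
          rw [hh, show 3 * (1 / (4 * N)) / 32 = 3 / (128 * N) by field_simp; norm_num,
            div_le_div_iff₀ (by positivity) (by positivity)]
          linarith
        gcongr
        norm_num
    _ = 2⁻¹ * ((9 * h ^ 4 / 256) * (3 * h / 32) ^ (m + 2)) := by ring
    _ ≤ _ := by gcongr

/-! ### Brascamp-Lieb and its reverse for half-lines, with and without the deficit -/

namespace IsTightFrame

section

variable {V ι : Type*} [NormedAddCommGroup V] [InnerProductSpace ℝ V] [Fintype ι]
  {v : ι → V} {c : ι → ℝ} [FiniteDimensional ℝ V] [MeasurableSpace V] [BorelSpace V]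

omit [BorelSpace V] in
theorem measure_le_lintegral_one_add (h : IsTightFrame v c) (O : Set V) (f : ℝ → ℝ) :
    stdGaussian V O ≤ ∫⁻ x in O, ENNReal.ofReal
      (1 + frameForm v c (fun i => f (inner ℝ x (v i))) (fun i => f (inner ℝ x (v i))) / 2)
        ∂(stdGaussian V) := by
  rw [← setLIntegral_one]
  refine lintegral_mono fun x => ?_
  rw [← ENNReal.ofReal_one]
  exact ENNReal.ofReal_le_ofReal (by
    linarith [h.frameForm_self_nonneg fun i => f (inner ℝ x (v i))])

theorem measure_add_le_lintegral_one_add (h : IsTightFrame v c) {O : Set V} {r : ℝ}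
    (hO : Metric.closedBall 0 r ⊆ O) {f : ℝ → ℝ} (hf : ContinuousOn f (Set.Icc (-r) r)) {s : ℝ}
    (hs : s ≤ ∫ x in Metric.closedBall 0 r, frameForm v c (fun i => f (inner ℝ x (v i)))
      (fun i => f (inner ℝ x (v i))) ∂(stdGaussian V)) :
    stdGaussian V O + ENNReal.ofReal (s / 2) ≤ ∫⁻ x in O, ENNReal.ofReal
      (1 + frameForm v c (fun i => f (inner ℝ x (v i))) (fun i => f (inner ℝ x (v i))) / 2)
        ∂(stdGaussian V) := by
  have hnn := fun x : V => h.frameForm_self_nonneg fun i => f (inner ℝ x (v i))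
  have h1 : ∀ x : V, ENNReal.ofReal (1 + frameForm v c (fun i => f (inner ℝ x (v i)))
      (fun i => f (inner ℝ x (v i))) / 2) = 1 + ENNReal.ofReal (frameForm v c
      (fun i => f (inner ℝ x (v i))) (fun i => f (inner ℝ x (v i))) / 2) := fun x => by
    rw [ENNReal.ofReal_add (by norm_num) (by linarith [hnn x]), ENNReal.ofReal_one]
  simp only [h1]
  rw [lintegral_add_left measurable_const, setLIntegral_one]
  refine add_le_add_right ?_ _
  refine le_trans ?_ (lintegral_mono_set hO)
  rw [← ofReal_integral_eq_lintegral_ofReal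
    ((integrableOn_closedBall (h.continuousOn_frameForm hf hf)).div_const 2)
    (Filter.Eventually.of_forall fun x => by simpa using by linarith [hnn x]), integral_div]
  exact ENNReal.ofReal_le_ofReal (by linarith)

/-- The reverse inequality: for `a = Φ(t)` the transport maps the line into `(-∞, t)`, so every
image point is a frame combination with coefficients below `t`. -/
theorem le_measure_combinations (h : IsTightFrame v c) (t : ℝ) :
    ENNReal.ofReal (gaussCdf t ^ Module.finrank ℝ V) *
      ∫⁻ x, ENNReal.ofReal (1 + frameForm v c (fun i => gaussTransport (gaussCdf t) (inner ℝ x (v i)))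
        (fun i => gaussTransport (gaussCdf t) (inner ℝ x (v i))) / 2) ∂(stdGaussian V) ≤
      stdGaussian V {y | ∃ a : ι → ℝ, (∀ i, a i ≤ t) ∧ y = ∑ i, (c i * a i) • v i} := by
  have hlt : ∀ s, gaussCdf t * gaussCdf s < 1 := fun s => by
    nlinarith [gaussCdf_lt_one s, gaussCdf_pos s, gaussCdf_lt_one t, gaussCdf_pos t]
  have := h.lintegral_one_add_frameForm_le (gaussCdf_pos t) isOpen_univ
    (fun s _ => hasDerivAt_gaussTransport (gaussCdf_pos t) (hlt s))
    (fun s _ => mul_pos (gaussCdf_pos t) (Real.exp_pos _))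
    (strictMonoOn_gaussTransport (gaussCdf_pos t) fun s _ => hlt s)
    (fun s _ => exp_mul_deriv_gaussTransport s)
  have hu : {x : V | ∀ i, inner ℝ x (v i) ∈ (Set.univ : Set ℝ)} = Set.univ := by ext; simp
  rw [hu, setLIntegral_univ] at this
  refine this.trans (measure_mono ?_)
  rintro _ ⟨x, -, rfl⟩
  refine ⟨_, fun i => ?_, rfl⟩
  rw [← strictMono_gaussCdf.le_iff_le, gaussCdf_gaussTransport (gaussCdf_pos t) (hlt _)]
  nlinarith [gaussCdf_lt_one (inner ℝ x (v i)), gaussCdf_pos t]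

/-- The direct inequality: for `a = 1/Φ(t)` the transport is defined on `(-∞, t)`, and the image of
the intersection of half-spaces has measure at most one. -/
theorem lintegral_halfspaces_le (h : IsTightFrame v c) (t : ℝ) :
      ∫⁻ x in {x : V | ∀ i, inner ℝ x (v i) < t},
        ENNReal.ofReal (1 + frameForm v c
          (fun i => gaussTransport (gaussCdf t)⁻¹ (inner ℝ x (v i)))
          (fun i => gaussTransport (gaussCdf t)⁻¹ (inner ℝ x (v i))) / 2) ∂(stdGaussian V) ≤
      ENNReal.ofReal (gaussCdf t ^ Module.finrank ℝ V) := by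
  have ht := gaussCdf_pos t
  have hlt : ∀ s ∈ Set.Iio t, (gaussCdf t)⁻¹ * gaussCdf s < 1 := fun s hs => by
    rw [inv_mul_lt_iff₀ ht, mul_one]
    exact strictMono_gaussCdf hs
  have := h.lintegral_one_add_frameForm_le (inv_pos.2 ht) isOpen_Iio
    (fun s hs => hasDerivAt_gaussTransport (inv_pos.2 ht) (hlt s hs))
    (fun s _ => mul_pos (inv_pos.2 ht) (Real.exp_pos _))
    (strictMonoOn_gaussTransport (inv_pos.2 ht) hlt)
    (fun s _ => exp_mul_deriv_gaussTransport s)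
  have h1 := this.trans prob_le_one
  simp only [Set.mem_Iio] at h1
  set I := ∫⁻ x in {x : V | ∀ i, inner ℝ x (v i) < t},
        ENNReal.ofReal (1 + frameForm v c
          (fun i => gaussTransport (gaussCdf t)⁻¹ (inner ℝ x (v i)))
          (fun i => gaussTransport (gaussCdf t)⁻¹ (inner ℝ x (v i))) / 2) ∂(stdGaussian V)
  calc I = ENNReal.ofReal (gaussCdf t ^ Module.finrank ℝ V) *
        (ENNReal.ofReal ((gaussCdf t)⁻¹ ^ Module.finrank ℝ V) * I) := by
        rw [← mul_assoc, ← ENNReal.ofReal_mul (by positivity), ← mul_pow, mul_inv_cancel₀ ht.ne']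
        simp
    _ ≤ ENNReal.ofReal (gaussCdf t ^ Module.finrank ℝ V) * 1 := by gcongr
    _ = _ := mul_one _

theorem ofReal_gaussCdf_pow_le_measure (h : IsTightFrame v c) (t : ℝ) :
    ENNReal.ofReal (gaussCdf t ^ Module.finrank ℝ V) ≤
      stdGaussian V {y | ∃ a : ι → ℝ, (∀ i, a i ≤ t) ∧ y = ∑ i, (c i * a i) • v i} := by
  refine le_trans ?_ (h.le_measure_combinations t)
  have h1 := h.measure_le_lintegral_one_add Set.univ (gaussTransport (gaussCdf t))
  rw [measure_univ, setLIntegral_univ] at h1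
  calc _ = ENNReal.ofReal (gaussCdf t ^ Module.finrank ℝ V) * 1 := (mul_one _).symm
    _ ≤ _ := by gcongr

theorem measure_halfspaces_le (h : IsTightFrame v c) (t : ℝ) :
    stdGaussian V {x : V | ∀ i, inner ℝ x (v i) < t} ≤
      ENNReal.ofReal (gaussCdf t ^ Module.finrank ℝ V) :=
  (h.measure_le_lintegral_one_add _ _).trans (h.lintegral_halfspaces_le t)

end

variable {ι : Type*} [Fintype ι] {m : ℕ} {v : ι → EuclideanSpace ℝ (Fin (m + 2))} {c : ι → ℝ}

theorem frameSpread_nonneg {V : Type*} [NormedAddCommGroup V] [InnerProductSpace ℝ V]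
    {v : ι → V} (h : IsTightFrame v c) : 0 ≤ frameSpread v c := by
  refine Finset.sum_nonneg fun i _ => Finset.sum_nonneg fun j _ => ?_
  have := real_inner_le_norm (v i) (v j)
  rw [h.norm_eq_one, h.norm_eq_one] at this
  exact mul_nonneg (mul_pos (h.weight_pos i) (h.weight_pos j)).le
    (mul_nonneg (sq_nonneg _) (by linarith))

/-- The lower bound for the Brascamp-Lieb deficit in terms of the spread of the frame. -/
noncomputable def spreadDeficit (m : ℕ) (s : ℝ) : ℝ :=
  (1 / 2 ^ 13) ^ 2 * (1 / (57 * (4 * (m + 2 : ℝ)) ^ 4 * (43 * (m + 2 : ℝ)) ^ (m + 2))) * s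

theorem spreadDeficit_le (h : IsTightFrame v c) {e : EuclideanSpace ℝ (Fin (m + 2))}
    (he : ∀ i, inner ℝ e (v i) = (1 : ℝ)) {f : ℝ → ℝ}
    (hf : ContinuousOn f (Set.Icc (-(1 / 4)) (1 / 4)))
    (hconv : ConvexOn ℝ (Set.Icc (-(1 / 4)) (1 / 4)) (fun s => f s - 1 / 2 ^ 13 * s ^ 2)) :
    spreadDeficit m (frameSpread v c) ≤ ∫ x in Metric.closedBall 0 (1 / 4),
      frameForm v c (fun i => f (inner ℝ x (v i)))
      (fun i => f (inner ℝ x (v i))) ∂(stdGaussian (EuclideanSpace ℝ (Fin (m + 2)))) := by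
  refine le_trans ?_ (h.le_setIntegral_frameForm (e₁ := EuclideanSpace.single 0 1)
    (e₂ := EuclideanSpace.single 1 1) (by simp) (by simp)
    (by rw [EuclideanSpace.inner_single_left]; simp) he (by norm_num) hf hconv)
  unfold spreadDeficit
  have := le_ballMoment_sq m
  have := h.frameSpread_nonneg
  gcongr

/-- The range of `t` serves two purposes: `t ≥ 2` puts the ball of radius `1/4` inside the
half-spaces, and `t ≤ 5/2` keeps `1/Φ(t)` above `1 + 1/480`, so the transport is uniformly convex.
-/
theorem measure_halfspaces_add_le (h : IsTightFrame v c) {e : EuclideanSpace ℝ (Fin (m + 2))}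
    (he : ∀ i, inner ℝ e (v i) = (1 : ℝ)) {t : ℝ} (ht : t ∈ Set.Icc (2 : ℝ) (5 / 2)) :
    stdGaussian (EuclideanSpace ℝ (Fin (m + 2))) {x | ∀ i, inner ℝ x (v i) < t} +
      ENNReal.ofReal (spreadDeficit m (frameSpread v c) / 2) ≤
      ENNReal.ofReal (gaussCdf t ^ (m + 2)) := by
  have h1 := h.lintegral_halfspaces_le t
  rw [finrank_euclideanSpace_fin] at h1
  refine le_trans ?_ h1
  have hlt : ∀ s ∈ Set.Icc (-(1 / 4) : ℝ) (1 / 4), (gaussCdf t)⁻¹ * gaussCdf s < 1 := fun s hs => by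
    rw [inv_mul_lt_iff₀ (gaussCdf_pos t), mul_one]
    exact strictMono_gaussCdf (by linarith [hs.2, ht.1])
  have ha : 1 + 1 / 480 ≤ (gaussCdf t)⁻¹ := by
    rw [le_inv_comm₀ (by norm_num) (gaussCdf_pos t)]
    have := le_one_sub_gaussCdf ht.2
    norm_num
    linarith
  have hc : ContinuousOn (gaussTransport (gaussCdf t)⁻¹) (Set.Icc (-(1 / 4)) (1 / 4)) :=
    fun s hs => (hasDerivAt_gaussTransport
      (inv_pos.2 (gaussCdf_pos t)) (hlt s hs)).continuousAt.continuousWithinAt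
  refine h.measure_add_le_lintegral_one_add (O := {x | ∀ i, inner ℝ x (v i) < t}) (r := 1 / 4)
    (fun x hx i => ?_) hc
    (h.spreadDeficit_le he hc (convexOn_gaussTransport_sub_sq ha hlt))
  rw [mem_closedBall_zero_iff] at hx
  have := real_inner_le_norm x (v i)
  rw [h.norm_eq_one, mul_one] at this
  linarith [ht.1]

theorem gaussCdf_pow_add_le_measure (h : IsTightFrame v c)
    {e : EuclideanSpace ℝ (Fin (m + 2))}
    (he : ∀ i, inner ℝ e (v i) = (1 : ℝ)) {t : ℝ} (ht : t ∈ Set.Icc (2 : ℝ) (5 / 2)) :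
    ENNReal.ofReal (gaussCdf t ^ (m + 2) * (1 + spreadDeficit m (frameSpread v c) / 2)) ≤
      stdGaussian (EuclideanSpace ℝ (Fin (m + 2)))
        {y | ∃ a : ι → ℝ, (∀ i, a i ≤ t) ∧ y = ∑ i, (c i * a i) • v i} := by
  have h1 := h.le_measure_combinations t
  rw [finrank_euclideanSpace_fin] at h1
  refine le_trans ?_ h1
  have hlt : ∀ s, gaussCdf t * gaussCdf s < 1 := fun s => by
    nlinarith [gaussCdf_lt_one s, gaussCdf_pos s, gaussCdf_lt_one t, gaussCdf_pos t]
  have ha := le_one_sub_gaussCdf ht.2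
  have ha' : 24 / 25 ≤ gaussCdf t := by
    linarith [one_sub_gaussCdf_two_le, strictMono_gaussCdf.monotone ht.1]
  have hc : ContinuousOn (gaussTransport (gaussCdf t)) (Set.Icc (-(1 / 4)) (1 / 4)) :=
    fun s _ => (hasDerivAt_gaussTransport (gaussCdf_pos t)
      (hlt s)).continuousAt.continuousWithinAt
  -- For `a < 1` the transport is concave. The form is quadratic, so the convex bound may be applied
  -- to its negative.
  have hS := h.spreadDeficit_le he (f := fun s => -gaussTransport (gaussCdf t) s) hc.neg
    (convexOn_neg_gaussTransport_sub_sq ha' (by linarith))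
  simp only [frameForm_neg_neg] at hS
  have h2 := h.measure_add_le_lintegral_one_add (Set.subset_univ _) hc hS
  rw [measure_univ, setLIntegral_univ] at h2
  have hnn : 0 ≤ spreadDeficit m (frameSpread v c) := by
    have := h.frameSpread_nonneg
    unfold spreadDeficit; positivity
  have hpos := gaussCdf_pos t
  rw [ENNReal.ofReal_mul (by positivity), ENNReal.ofReal_add (by norm_num) (by linarith),
    ENNReal.ofReal_one]
  gcongr

end IsTightFrame

/-! ### From distribution functions to expectations -/

/-- If the distribution functions of two real random variables are ordered, with a gap on an
interval, then their expectations are ordered with a gap. -/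
theorem mul_sub_le_integral_sub_of_measure_le {Ω : Type*} [MeasurableSpace Ω] {μ : Measure Ω}
    [IsProbabilityMeasure μ] {X Y : Ω → ℝ} (hX : Measurable X) (hY : Measurable Y)
    (hXi : Integrable X μ) (hYi : Integrable Y μ) {a b d : ℝ} (hd : 0 ≤ d)
    (hle : ∀ t, μ {ω | Y ω < t} ≤ μ {ω | X ω ≤ t})
    (hgap : ∀ t ∈ Set.Icc a b, μ {ω | Y ω < t} + ENNReal.ofReal d ≤ μ {ω | X ω ≤ t}) :
    d * (b - a) ≤ ∫ ω, Y ω ∂μ - ∫ ω, X ω ∂μ := by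
  -- By Tonelli the regions between the graphs, `S` and `T`, have measures `E (X - Y)⁺` and `E (Y -
  -- X)⁺`. Their sections at height `t` are the differences of the events `Y < t` and `X ≤ t`. This
  -- avoids splitting the layer-cake formula by sign.
  let S : Set (ℝ × Ω) := {p | Y p.2 < p.1 ∧ p.1 < X p.2}
  let T : Set (ℝ × Ω) := {p | X p.2 ≤ p.1 ∧ p.1 ≤ Y p.2}
  have hX2 : Measurable fun p : ℝ × Ω => X p.2 := hX.comp measurable_snd
  have hY2 : Measurable fun p : ℝ × Ω => Y p.2 := hY.comp measurable_snd
  have hS : MeasurableSet S :=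
    (measurableSet_lt hY2 measurable_fst).inter (measurableSet_lt measurable_fst hX2)
  have hT : MeasurableSet T :=
    (measurableSet_le hX2 measurable_fst).inter (measurableSet_le measurable_fst hY2)
  have hSv : ∫⁻ t, μ (Prod.mk t ⁻¹' S) = ∫⁻ ω, ENNReal.ofReal (X ω - Y ω) ∂μ := by
    rw [← Measure.prod_apply hS, Measure.prod_apply_symm hS]
    refine lintegral_congr fun ω => ?_
    rw [← Real.volume_Ioo]; rfl
  have hTv : ∫⁻ t, μ (Prod.mk t ⁻¹' T) = ∫⁻ ω, ENNReal.ofReal (Y ω - X ω) ∂μ := by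
    rw [← Measure.prod_apply hT, Measure.prod_apply_symm hT]
    refine lintegral_congr fun ω => ?_
    rw [← Real.volume_Icc]; rfl
  have hpt : ∀ t, (Set.Icc a b).indicator (fun _ => ENNReal.ofReal d) t + μ (Prod.mk t ⁻¹' S) ≤
      μ (Prod.mk t ⁻¹' T) := fun t => by
    have h1 : μ {ω | Y ω < t} + (Set.Icc a b).indicator (fun _ => ENNReal.ofReal d) t ≤
        μ {ω | X ω ≤ t} := by
      by_cases ht : t ∈ Set.Icc a b
      · rw [Set.indicator_of_mem ht]; exact hgap t ht
      · rw [Set.indicator_of_notMem ht, add_zero]; exact hle t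
    have hYm : MeasurableSet {ω | Y ω < t} := measurableSet_lt hY measurable_const
    have hXm : MeasurableSet {ω | X ω ≤ t} := measurableSet_le hX measurable_const
    have h2 := measure_sdiff_add_inter (μ := μ) {ω | Y ω < t} hXm
    have h3 := measure_sdiff_add_inter (μ := μ) {ω | X ω ≤ t} hYm
    have h4 : {ω | Y ω < t} \ {ω | X ω ≤ t} = Prod.mk t ⁻¹' S := by
      ext ω; simp [S]
    have h5 : {ω | X ω ≤ t} \ {ω | Y ω < t} = Prod.mk t ⁻¹' T := by
      ext ω; simp [T]
    rw [h4] at h2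
    rw [h5, Set.inter_comm] at h3
    rw [← h2, ← h3] at h1
    refine (ENNReal.add_le_add_iff_left
      (measure_ne_top μ ({ω | Y ω < t} ∩ {ω | X ω ≤ t}))).1 ?_
    convert! h1 using 1 <;> abel
  have hint := lintegral_mono (μ := volume) hpt
  rw [lintegral_add_left ((measurable_const).indicator measurableSet_Icc), hSv, hTv,
    lintegral_indicator measurableSet_Icc, setLIntegral_const, Real.volume_Icc,
    ← ENNReal.ofReal_mul hd] at hint
  have hi : Integrable (fun ω => Y ω - X ω) μ := hYi.sub hXi
  rw [← integral_sub hYi hXi, integral_eq_lintegral_pos_part_sub_lintegral_neg_part hi]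
  simp only [neg_sub]
  have hf1 : ∫⁻ ω, ENNReal.ofReal (X ω - Y ω) ∂μ ≠ ⊤ :=
    (hXi.sub hYi).lintegral_lt_top.ne
  have hf2 : ∫⁻ ω, ENNReal.ofReal (Y ω - X ω) ∂μ ≠ ⊤ := hi.lintegral_lt_top.ne
  have h6 := (ENNReal.toReal_le_toReal (ENNReal.add_ne_top.2 ⟨ENNReal.ofReal_ne_top, hf1⟩) hf2).2 hint
  rw [ENNReal.toReal_add ENNReal.ofReal_ne_top hf1] at h6
  rcases le_total a b with hab | hab
  · rw [ENNReal.toReal_ofReal (mul_nonneg hd (sub_nonneg.2 hab))] at h6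
    linarith
  · have : d * (b - a) ≤ 0 := mul_nonpos_of_nonneg_of_nonpos hd (sub_nonpos.2 hab)
    have := ENNReal.toReal_nonneg (a := ENNReal.ofReal (d * (b - a)))
    linarith

/-! ### The splitting `ℝⁿ⁺¹ = ℝ × ℝⁿ` and Gaussian moments -/

section Lift

variable {n : ℕ}

/-- The vector `(y, x)` of `ℝ × ℝⁿ = ℝⁿ⁺¹`. -/
noncomputable def consVec (y : ℝ) (x : EuclideanSpace ℝ (Fin n)) : EuclideanSpace ℝ (Fin (n + 1)) :=
  WithLp.toLp 2 (Fin.cons y x.ofLp)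

/-- The projection of `ℝ × ℝⁿ = ℝⁿ⁺¹` to `ℝⁿ`. -/
noncomputable def tailVec (z : EuclideanSpace ℝ (Fin (n + 1))) : EuclideanSpace ℝ (Fin n) :=
  WithLp.toLp 2 fun i => z i.succ

@[simp] theorem consVec_zero (y : ℝ) (x : EuclideanSpace ℝ (Fin n)) : consVec y x 0 = y := rfl

@[simp] theorem consVec_succ (y : ℝ) (x : EuclideanSpace ℝ (Fin n)) (i : Fin n) :
    consVec y x i.succ = x i := rfl

theorem inner_eq_inner_tailVec (z : EuclideanSpace ℝ (Fin (n + 1))) (y : ℝ)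
    (x : EuclideanSpace ℝ (Fin n)) :
    inner ℝ z (consVec y x) = z 0 * y + inner ℝ (tailVec z) x := by
  simp only [PiLp.inner_apply, Fin.sum_univ_succ]
  simp [tailVec, mul_comm]

@[simp] theorem tailVec_consVec (y : ℝ) (x : EuclideanSpace ℝ (Fin n)) :
    tailVec (consVec y x) = x := by
  ext i; simp [tailVec]

theorem ext_tailVec {z z' : EuclideanSpace ℝ (Fin (n + 1))} (h0 : z 0 = z' 0)
    (h : tailVec z = tailVec z') : z = z' := by
  ext i
  refine Fin.cases h0 (fun j => ?_) i
  simpa [tailVec] using congrArg (fun x : EuclideanSpace ℝ (Fin n) => x j) h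

theorem tailVec_sum_smul {ι : Type*} (s : Finset ι) (a : ι → ℝ)
    (z : ι → EuclideanSpace ℝ (Fin (n + 1))) :
    tailVec (∑ i ∈ s, a i • z i) = ∑ i ∈ s, a i • tailVec (z i) := by
  ext j; simp [tailVec]

theorem continuous_tailVec : Continuous (tailVec (n := n)) := by
  unfold tailVec; fun_prop

theorem map_tailVec_stdGaussian :
    (stdGaussian (EuclideanSpace ℝ (Fin (n + 1)))).map tailVec =
      stdGaussian (EuclideanSpace ℝ (Fin n)) := by
  have hm : Measurable (tailVec (n := n)) := continuous_tailVec.measurable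
  have := Measure.isProbabilityMeasure_map (μ := stdGaussian (EuclideanSpace ℝ (Fin (n + 1))))
    hm.aemeasurable
  refine Measure.ext_of_charFun ?_
  ext t
  rw [charFun_apply, integral_map hm.aemeasurable (by fun_prop)]
  have h1 : ∀ z : EuclideanSpace ℝ (Fin (n + 1)), inner ℝ (tailVec z) t =
      inner ℝ z (consVec 0 t) := fun z => by rw [inner_eq_inner_tailVec]; ring
  simp only [h1]
  rw [← charFun_apply, charFun_stdGaussian, charFun_stdGaussian]
  have h2 : ‖consVec 0 t‖ ^ 2 = ‖t‖ ^ 2 := by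
    rw [← real_inner_self_eq_norm_sq, inner_eq_inner_tailVec]; simp
  rw [← Complex.ofReal_pow, ← Complex.ofReal_pow, h2]

theorem integral_comp_tailVec (f : EuclideanSpace ℝ (Fin n) → ℝ) (hf : Continuous f) :
    ∫ z, f (tailVec z) ∂(stdGaussian (EuclideanSpace ℝ (Fin (n + 1)))) =
      ∫ x, f x ∂(stdGaussian (EuclideanSpace ℝ (Fin n))) := by
  rw [← map_tailVec_stdGaussian (n := n), integral_map continuous_tailVec.measurable.aemeasurable
    hf.aestronglyMeasurable]

theorem integrable_comp_tailVec {f : EuclideanSpace ℝ (Fin n) → ℝ}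
    (hf : Integrable f (stdGaussian (EuclideanSpace ℝ (Fin n)))) :
    Integrable (fun z => f (tailVec z)) (stdGaussian (EuclideanSpace ℝ (Fin (n + 1)))) := by
  rw [← map_tailVec_stdGaussian] at hf
  exact hf.comp_measurable continuous_tailVec.measurable

theorem integral_comp_neg_stdGaussian (f : EuclideanSpace ℝ (Fin n) → ℝ) :
    ∫ x, f (-x) ∂(stdGaussian (EuclideanSpace ℝ (Fin n))) =
      ∫ x, f x ∂(stdGaussian (EuclideanSpace ℝ (Fin n))) := by
  have h : MeasurePreserving (LinearIsometryEquiv.neg ℝ (E := EuclideanSpace ℝ (Fin n)))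
      (stdGaussian _) (stdGaussian _) :=
    ⟨(LinearIsometryEquiv.neg ℝ).continuous.measurable, stdGaussian_map _⟩
  exact h.integral_comp (LinearIsometryEquiv.neg ℝ).toHomeomorph.measurableEmbedding f

theorem integrable_norm_stdGaussian :
    Integrable (fun x => ‖x‖) (stdGaussian (EuclideanSpace ℝ (Fin n))) :=
  (IsGaussian.integrable_id (μ := stdGaussian (EuclideanSpace ℝ (Fin n)))).norm

theorem integrable_coord_stdGaussian (i : Fin n) :
    Integrable (fun x : EuclideanSpace ℝ (Fin n) => x i) (stdGaussian _) :=
  (EuclideanSpace.proj (𝕜 := ℝ) i).integrable_comp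
    (IsGaussian.integrable_id (μ := stdGaussian (EuclideanSpace ℝ (Fin n))))

theorem integral_coord_stdGaussian (i : Fin n) :
    ∫ x : EuclideanSpace ℝ (Fin n), x i ∂(stdGaussian _) = 0 :=
  integral_strongDual_stdGaussian (EuclideanSpace.proj (𝕜 := ℝ) i)

theorem integral_norm_stdGaussian_le (hn : 1 ≤ n) :
    ∫ x, ‖x‖ ∂(stdGaussian (EuclideanSpace ℝ (Fin n))) ≤ n := by
  have hsq : ∀ i : Fin n, Integrable (fun x : EuclideanSpace ℝ (Fin n) => x i ^ 2)
      (stdGaussian _) := fun i =>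
    (IsGaussian.memLp_dual (stdGaussian (EuclideanSpace ℝ (Fin n)))
      (EuclideanSpace.proj (𝕜 := ℝ) i) 2 (by simp)).integrable_sq
  have hv : ∀ i : Fin n, ∫ x : EuclideanSpace ℝ (Fin n), x i ^ 2 ∂(stdGaussian _) ≤ 1 := fun i => by
    have h1 := variance_dual_stdGaussian (EuclideanSpace.proj i : EuclideanSpace ℝ (Fin n) →L[ℝ] ℝ)
    rw [variance_of_integral_eq_zero (EuclideanSpace.proj i).continuous.aemeasurable
      (integral_coord_stdGaussian i)] at h1
    have h2 : ‖(EuclideanSpace.proj i : EuclideanSpace ℝ (Fin n) →L[ℝ] ℝ)‖ ≤ 1 :=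
      ContinuousLinearMap.opNorm_le_bound _ zero_le_one fun x => by
        rw [one_mul]; exact PiLp.norm_apply_le x i
    refine (le_of_eq h1).trans ?_
    exact pow_le_one₀ (norm_nonneg _) h2
  calc ∫ x, ‖x‖ ∂(stdGaussian (EuclideanSpace ℝ (Fin n)))
      ≤ ∫ x, (1 + ∑ i, x i ^ 2) / 2 ∂(stdGaussian (EuclideanSpace ℝ (Fin n))) := by
        refine integral_mono integrable_norm_stdGaussian (((integrable_const _).add
          (integrable_finsetSum _ fun i _ => hsq i)).div_const 2) fun x => ?_
        simp only
        rw [← EuclideanSpace.real_norm_sq_eq]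
        nlinarith [sq_nonneg (‖x‖ - 1)]
    _ = (1 + ∑ i, ∫ x : EuclideanSpace ℝ (Fin n), x i ^ 2 ∂(stdGaussian _)) / 2 := by
        rw [integral_div, integral_add (integrable_const _)
          (integrable_finsetSum _ fun i _ => hsq i), integral_finsetSum _ fun i _ => hsq i]
        simp
    _ ≤ (1 + ∑ i : Fin n, (1 : ℝ)) / 2 := by gcongr with i; exact hv i
    _ ≤ n := by
        have : (1 : ℝ) ≤ n := by exact_mod_cast hn
        simp; linarith

end Lift

/-! ### Gauges of the convex hull and of its polar -/

namespace IsCenteredIsotropic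

variable {n k : ℕ} {u : Fin k → EuclideanSpace ℝ (Fin n)} {c : Fin k → ℝ}

theorem isTightFrame (h : IsCenteredIsotropic u c) : IsTightFrame u c where
  norm_eq_one := h.norm_eq_one
  weight_pos := h.weight_pos
  expand x := by
    have := congrArg (fun L : EuclideanSpace ℝ (Fin n) →L[ℝ] EuclideanSpace ℝ (Fin n) => L x)
      h.isotropic
    simp only [sum_apply, smul_apply, InnerProductSpace.rankOne_apply,
      ContinuousLinearMap.id_apply] at this
    conv_rhs => rw [← this]
    refine Finset.sum_congr rfl fun i _ => ?_
    rw [smul_smul, real_inner_comm]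

theorem sum_weights (h : IsCenteredIsotropic u c) : ∑ i, c i = n := by
  rw [h.isTightFrame.sum_weights, finrank_euclideanSpace_fin]

/-- Since `∑ c i u i = 0`, the coefficients in the frame expansion may be shifted: `x = ∑ c i (⟪x, u
i⟫ + 1/n) u i`. For `‖x‖ ≤ 1/n` these are nonnegative, and they sum to one. -/
theorem mem_convexHull_of_norm_le (h : IsCenteredIsotropic u c) (hn : 1 ≤ n)
    {x : EuclideanSpace ℝ (Fin n)} (hx : ‖x‖ ≤ 1 / n) : x ∈ convexHull ℝ (Set.range u) := by
  have hn' : (0 : ℝ) < n := by exact_mod_cast hn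
  have h1 : ∑ i, (c i * (inner ℝ x (u i) + 1 / n)) • u i = x := by
    simp only [mul_add, add_smul, Finset.sum_add_distrib, h.isTightFrame.expand]
    simp only [mul_comm (c _) (1 / (n : ℝ)), mul_smul, ← Finset.smul_sum, h.centered, smul_zero,
      add_zero]
  have h2 : ∑ i, c i * inner ℝ x (u i) = 0 := by
    have := congrArg (fun y => inner ℝ x y) h.centered
    simpa [inner_sum, real_inner_smul_right] using this
  rw [← h1]
  refine (convex_convexHull ℝ _).sum_mem (fun i _ => ?_) ?_
    fun i _ => subset_convexHull ℝ _ ⟨i, rfl⟩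
  · have := abs_real_inner_le_norm x (u i)
    rw [h.norm_eq_one, mul_one] at this
    exact mul_nonneg (h.weight_pos i).le (by linarith [(abs_le.1 (this.trans hx)).1])
  · simp only [mul_add, Finset.sum_add_distrib, h2, ← Finset.sum_mul, h.sum_weights]
    field_simp; simp

theorem convexHull_mem_nhds (h : IsCenteredIsotropic u c) (hn : 1 ≤ n) :
    convexHull ℝ (Set.range u) ∈ nhds 0 := by
  have hn' : (0 : ℝ) < 1 / n := one_div_pos.2 (by exact_mod_cast hn)
  refine Filter.mem_of_superset (Metric.closedBall_mem_nhds 0 hn') fun x hx => ?_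
  exact h.mem_convexHull_of_norm_le hn (by simpa using hx)

theorem gauge_convexHull_le (h : IsCenteredIsotropic u c) (hn : 1 ≤ n)
    (x : EuclideanSpace ℝ (Fin n)) : gauge (convexHull ℝ (Set.range u)) x ≤ n * ‖x‖ := by
  have hn' : (0 : ℝ) < n := by exact_mod_cast hn
  have := gauge_mono (absorbent_nhds_zero (Metric.closedBall_mem_nhds (0 : EuclideanSpace ℝ (Fin n))
    (show (0 : ℝ) < 1 / n by positivity)))
    (fun x hx => h.mem_convexHull_of_norm_le hn (by simpa using hx)) x
  rw [gauge_closedBall (by positivity)] at this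
  refine this.trans (le_of_eq ?_)
  field_simp

theorem continuous_gauge_convexHull (h : IsCenteredIsotropic u c) (hn : 1 ≤ n) :
    Continuous (gauge (convexHull ℝ (Set.range u))) :=
  continuous_gauge (convex_convexHull ℝ _) (h.convexHull_mem_nhds hn)

theorem gauge_sum_smul_le {s : Fin k → EuclideanSpace ℝ (Fin n)} {a : Fin k → ℝ}
    (ha : ∀ i, 0 ≤ a i) : gauge (convexHull ℝ (Set.range s)) (∑ i, a i • s i) ≤ ∑ i, a i := by
  rcases (Finset.sum_nonneg fun i (_ : i ∈ Finset.univ) => ha i).eq_or_lt with h0 | h0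
  · have h1 := (Finset.sum_eq_zero_iff_of_nonneg fun i (_ : i ∈ Finset.univ) => ha i).1 h0.symm
    rw [Finset.sum_eq_zero fun i hi => by rw [h1 i hi, zero_smul], gauge_zero, ← h0]
  · refine gauge_le_of_mem h0.le ?_
    rw [Set.mem_smul_set_iff_inv_smul_mem₀ h0.ne', Finset.smul_sum]
    simp only [smul_smul]
    refine (convex_convexHull ℝ _).sum_mem (fun i _ => mul_nonneg (inv_nonneg.2 h0.le) (ha i)) ?_
      fun i _ => subset_convexHull ℝ _ ⟨i, rfl⟩
    rw [← Finset.mul_sum, inv_mul_cancel₀ h0.ne']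

theorem convex_polarBody (K : Set (EuclideanSpace ℝ (Fin n))) : Convex ℝ (polarBody K) := by
  intro x hx y hy a b ha hb hab z hz
  rw [inner_add_left, real_inner_smul_left, real_inner_smul_left]
  nlinarith [hx z hz, hy z hz]

theorem mem_polarBody_convexHull_iff {s : Fin k → EuclideanSpace ℝ (Fin n)}
    {x : EuclideanSpace ℝ (Fin n)} :
    x ∈ polarBody (convexHull ℝ (Set.range s)) ↔ ∀ i, inner ℝ x (s i) ≤ 1 := by
  refine ⟨fun h i => h _ (subset_convexHull ℝ _ ⟨i, rfl⟩), fun h y hy => ?_⟩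
  have hc : Convex ℝ {y | inner ℝ x y ≤ (1 : ℝ)} :=
    convex_halfSpace_le (innerₛₗ ℝ x).isLinear 1
  exact convexHull_min (by rintro _ ⟨i, rfl⟩; exact h i) hc hy

theorem closedBall_subset_polarBody (h : IsCenteredIsotropic u c) :
    Metric.closedBall 0 1 ⊆ polarBody (convexHull ℝ (Set.range u)) := fun x hx => by
  rw [mem_polarBody_convexHull_iff]
  intro i
  have := real_inner_le_norm x (u i)
  rw [h.norm_eq_one, mul_one] at this
  exact this.trans (by simpa using hx)

theorem polarBody_mem_nhds (h : IsCenteredIsotropic u c) :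
    polarBody (convexHull ℝ (Set.range u)) ∈ nhds 0 :=
  Filter.mem_of_superset (Metric.closedBall_mem_nhds 0 one_pos) h.closedBall_subset_polarBody

theorem gauge_polarBody_le (h : IsCenteredIsotropic u c) (x : EuclideanSpace ℝ (Fin n)) :
    gauge (polarBody (convexHull ℝ (Set.range u))) x ≤ ‖x‖ := by
  have := gauge_mono (absorbent_nhds_zero (Metric.closedBall_mem_nhds (0 : EuclideanSpace ℝ (Fin n))
    one_pos)) h.closedBall_subset_polarBody x
  rwa [gauge_closedBall zero_le_one, div_one] at this

theorem continuous_gauge_polarBody (h : IsCenteredIsotropic u c) :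
    Continuous (gauge (polarBody (convexHull ℝ (Set.range u)))) :=
  continuous_gauge (convex_polarBody _) h.polarBody_mem_nhds

theorem inner_le_gauge_polarBody (h : IsCenteredIsotropic u c) (x : EuclideanSpace ℝ (Fin n))
    (i : Fin k) : inner ℝ x (u i) ≤ gauge (polarBody (convexHull ℝ (Set.range u))) x := by
  refine le_of_forall_pos_lt_add fun d hd => ?_
  obtain ⟨b, hb0, hb, y, hy, rfl⟩ := exists_lt_of_gauge_lt (absorbent_nhds_zero h.polarBody_mem_nhds)
    (lt_add_of_pos_right (gauge (polarBody (convexHull ℝ (Set.range u))) x) hd)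
  refine lt_of_le_of_lt ?_ hb
  simp only
  rw [real_inner_smul_left]
  have := mem_polarBody_convexHull_iff.1 hy i
  nlinarith

/-- The hypothesis on the inner products says that `-n C ⊆ C°`, and a larger body has a smaller
gauge. It holds for the vertices of an inscribed regular simplex. -/
theorem mul_gauge_polarBody_le (h : IsCenteredIsotropic u c) (hn : 1 ≤ n)
    (hu : ∀ i j, -(1 / n : ℝ) ≤ inner ℝ (u i) (u j)) (x : EuclideanSpace ℝ (Fin n)) :
    gauge (polarBody (convexHull ℝ (Set.range u))) x ≤
      1 / n * gauge (convexHull ℝ (Set.range u)) (-x) := by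
  have hn' : (0 : ℝ) < n := by exact_mod_cast hn
  rw [← div_le_iff₀' (by positivity)]
  refine le_of_forall_pos_le_add fun d hd => ?_
  obtain ⟨b, hb0, hb, y, hy, hyx⟩ := exists_lt_of_gauge_lt
    (absorbent_nhds_zero (h.convexHull_mem_nhds hn))
    (lt_add_of_pos_right (gauge (convexHull ℝ (Set.range u)) (-x)) hd)
  refine le_trans ?_ hb.le
  rw [div_le_iff₀' (by positivity)]
  have hxy : x = -(b • y) := by rw [show b • y = -x from hyx, neg_neg]
  refine gauge_le_of_mem (by positivity) ?_
  rw [Set.mem_smul_set_iff_inv_smul_mem₀ (by positivity), mem_polarBody_convexHull_iff]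
  intro i
  have hc : Convex ℝ {y | -(1 / n : ℝ) ≤ inner ℝ (u i) y} :=
    convex_halfSpace_ge (innerₛₗ ℝ (u i)).isLinear _
  have hyi : -(1 / n : ℝ) ≤ inner ℝ (u i) y :=
    convexHull_min (by rintro _ ⟨j, rfl⟩; exact hu i j) hc hy
  rw [real_inner_smul_left, hxy, inner_neg_left, real_inner_smul_left, real_inner_comm]
  rw [inv_mul_le_iff₀ (by positivity)]
  nlinarith

/-- A crude bound, used to turn the relative error `ε` into an absolute one. -/
theorem ellNorm_convexHull_le (h : IsCenteredIsotropic u c) (hn : 1 ≤ n) :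
    ellNorm (convexHull ℝ (Set.range u)) ≤ n * n := by
  unfold ellNorm
  calc _ ≤ ∫ x, n * ‖x‖ ∂(stdGaussian (EuclideanSpace ℝ (Fin n))) :=
        integral_mono_of_nonneg (Filter.Eventually.of_forall fun x => gauge_nonneg x)
          (integrable_norm_stdGaussian.const_mul _)
          (Filter.Eventually.of_forall fun x => h.gauge_convexHull_le hn x)
    _ ≤ _ := by
        rw [integral_const_mul]
        have := integral_norm_stdGaussian_le hn
        gcongr

theorem ellNorm_polarBody_le (h : IsCenteredIsotropic u c) (hn : 1 ≤ n) :
    ellNorm (polarBody (convexHull ℝ (Set.range u))) ≤ n :=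
  (integral_mono_of_nonneg (Filter.Eventually.of_forall fun x => gauge_nonneg x)
    integrable_norm_stdGaussian
    (Filter.Eventually.of_forall fun x => h.gauge_polarBody_le x)).trans
    (integral_norm_stdGaussian_le hn)

theorem integrable_gauge_polarBody (h : IsCenteredIsotropic u c) :
    Integrable (gauge (polarBody (convexHull ℝ (Set.range u))))
      (stdGaussian (EuclideanSpace ℝ (Fin n))) :=
  integrable_norm_stdGaussian.mono' h.continuous_gauge_polarBody.aestronglyMeasurable
    (Filter.Eventually.of_forall fun x => by
      rw [Real.norm_of_nonneg (gauge_nonneg x)]; exact h.gauge_polarBody_le x)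

end IsCenteredIsotropic

/-! ### The lifted frame and the two random variables -/

/-- The lift of the unit vectors `u i` of `ℝⁿ` to unit vectors of `ℝⁿ⁺¹`, which turns the vertices of
a regular simplex into an orthonormal basis. -/
noncomputable def liftVec {n k : ℕ} (u : Fin k → EuclideanSpace ℝ (Fin n)) (i : Fin k) :
    EuclideanSpace ℝ (Fin (n + 1)) :=
  consVec √(1 / (n + 1)) (√(n / (n + 1)) • u i)

theorem inner_liftVec {n k : ℕ} (u : Fin k → EuclideanSpace ℝ (Fin n)) (i j : Fin k) :
    inner ℝ (liftVec u i) (liftVec u j) = (n * inner ℝ (u i) (u j) + 1) / (n + 1) := by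
  have hN : (0 : ℝ) < n + 1 := by positivity
  rw [liftVec, liftVec, inner_eq_inner_tailVec, tailVec_consVec, consVec_zero,
    real_inner_smul_left, real_inner_smul_right, ← mul_assoc, Real.mul_self_sqrt (by positivity),
    Real.mul_self_sqrt (by positivity)]
  field_simp; ring

namespace IsCenteredIsotropic

variable {n k : ℕ} {u : Fin k → EuclideanSpace ℝ (Fin n)} {c : Fin k → ℝ}

/-- The mixed terms between the new coordinate and `ℝⁿ` cancel because the family is centred. The
factor `(n+1)/n` makes the total weight `n + 1` and compensates both `α² = n/(n+1)` and `β² =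
1/(n+1)`. -/
theorem isTightFrame_liftVec (h : IsCenteredIsotropic u c) (hn : 1 ≤ n) :
    IsTightFrame (liftVec u) (fun i => (n + 1) / n * c i) where
  norm_eq_one i := by
    have hn' : (0 : ℝ) < n := by exact_mod_cast hn
    have := inner_liftVec u i i
    rw [real_inner_self_eq_norm_sq, real_inner_self_eq_norm_sq, h.norm_eq_one, one_pow, mul_one,
      div_self (by positivity)] at this
    nlinarith [norm_nonneg (liftVec u i)]
  weight_pos i := by
    have hn' : (0 : ℝ) < n := by exact_mod_cast hn
    have := h.weight_pos i
    positivity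
  expand z := by
    have hn' : (0 : ℝ) < n := by exact_mod_cast hn
    have hα : √((n : ℝ) / (n + 1)) * √((n : ℝ) / (n + 1)) = n / (n + 1) :=
      Real.mul_self_sqrt (by positivity)
    have hβ : √(1 / ((n : ℝ) + 1)) * √(1 / ((n : ℝ) + 1)) = 1 / (n + 1) :=
      Real.mul_self_sqrt (by positivity)
    set α := √((n : ℝ) / (n + 1)) with hα'
    set β := √(1 / ((n : ℝ) + 1)) with hβ'
    have h2 : ∑ i, c i * inner ℝ (tailVec z) (u i) = 0 := by
      have := congrArg (fun y => inner ℝ (tailVec z) y) h.centered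
      simpa [inner_sum, real_inner_smul_right] using this
    have hin : ∀ i, inner ℝ z (liftVec u i) = z 0 * β + α * inner ℝ (tailVec z) (u i) := fun i => by
      rw [liftVec, inner_eq_inner_tailVec, real_inner_smul_right]
    refine ext_tailVec ?_ ?_
    · have h3 : ∀ i, ((n + 1) / n * c i * inner ℝ z (liftVec u i)) * liftVec u i 0 =
          (n + 1) / n * (β * β) * z 0 * c i + (n + 1) / n * α * β *
            (c i * inner ℝ (tailVec z) (u i)) := fun i => by
        rw [hin, liftVec, consVec_zero]; ring
      have h4 : (∑ i, ((n + 1) / n * c i * inner ℝ z (liftVec u i)) • liftVec u i) 0 =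
          ∑ i, ((n + 1) / n * c i * inner ℝ z (liftVec u i)) * liftVec u i 0 := by simp
      rw [h4]
      simp only [h3, Finset.sum_add_distrib, ← Finset.mul_sum, h2, h.sum_weights, hβ]
      field_simp; ring
    · rw [tailVec_sum_smul]
      have h3 : ∀ i, ((n + 1) / n * c i * inner ℝ z (liftVec u i)) • tailVec (liftVec u i) =
          ((n + 1) / n * α * β * z 0) • (c i • u i) +
            (((n : ℝ) + 1) / n * (α * α)) • ((c i * inner ℝ (tailVec z) (u i)) • u i) := fun i => by
        rw [hin, liftVec, tailVec_consVec, smul_smul, smul_smul, smul_smul, ← add_smul]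
        congr 1; ring
      simp only [h3, Finset.sum_add_distrib, ← Finset.smul_sum, h.centered,
        h.isTightFrame.expand, hα, smul_zero, zero_add]
      rw [show ((n : ℝ) + 1) / n * (n / (n + 1)) = 1 by field_simp, one_smul]

theorem inner_consVec_liftVec (i : Fin k) :
    inner ℝ (consVec √((n : ℝ) + 1) 0) (liftVec u i) = (1 : ℝ) := by
  rw [liftVec, inner_eq_inner_tailVec, tailVec_consVec, consVec_zero, inner_zero_left, add_zero,
    ← Real.sqrt_mul (by positivity), mul_one_div_cancel (by positivity), Real.sqrt_one]

/-- The random variable on `ℝⁿ⁺¹` whose expectation is a multiple of `ℓ(C°)`. -/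
noncomputable def polarVar (u : Fin k → EuclideanSpace ℝ (Fin n))
    (z : EuclideanSpace ℝ (Fin (n + 1))) : ℝ :=
  √(n / (n + 1)) * gauge (polarBody (convexHull ℝ (Set.range u))) (tailVec z) +
    √(1 / (n + 1)) * z 0

/-- The random variable on `ℝⁿ⁺¹` whose expectation is a multiple of `ℓ(C)`. -/
noncomputable def hullVar (u : Fin k → EuclideanSpace ℝ (Fin n))
    (z : EuclideanSpace ℝ (Fin (n + 1))) : ℝ :=
  √(n / (n + 1)) * (1 / n * gauge (convexHull ℝ (Set.range u)) (-tailVec z)) +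
    √(1 / (n + 1)) * z 0

theorem continuous_polarVar (h : IsCenteredIsotropic u c) : Continuous (polarVar u) := by
  have := h.continuous_gauge_polarBody.comp continuous_tailVec
  unfold polarVar
  exact (continuous_const.mul this).add (by fun_prop)

theorem continuous_hullVar (h : IsCenteredIsotropic u c) (hn : 1 ≤ n) :
    Continuous (hullVar u) := by
  have := (h.continuous_gauge_convexHull hn).comp (continuous_tailVec (n := n)).neg
  unfold hullVar
  exact (continuous_const.mul (continuous_const.mul this)).add (by fun_prop)

theorem integrable_neg_gauge (h : IsCenteredIsotropic u c) (hn : 1 ≤ n) :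
    Integrable (fun x => gauge (convexHull ℝ (Set.range u)) (-x))
      (stdGaussian (EuclideanSpace ℝ (Fin n))) :=
  (integrable_norm_stdGaussian.const_mul (n : ℝ)).mono'
    ((h.continuous_gauge_convexHull hn).comp continuous_neg).aestronglyMeasurable
    (Filter.Eventually.of_forall fun x => by
      rw [Real.norm_of_nonneg (gauge_nonneg _), ← norm_neg]; exact h.gauge_convexHull_le hn _)

theorem integrable_polarVar (h : IsCenteredIsotropic u c) :
    Integrable (polarVar u) (stdGaussian (EuclideanSpace ℝ (Fin (n + 1)))) :=
  ((integrable_comp_tailVec h.integrable_gauge_polarBody).const_mul _).add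
    ((integrable_coord_stdGaussian 0).const_mul _)

theorem integrable_hullVar (h : IsCenteredIsotropic u c) (hn : 1 ≤ n) :
    Integrable (hullVar u) (stdGaussian (EuclideanSpace ℝ (Fin (n + 1)))) :=
  (((integrable_comp_tailVec (h.integrable_neg_gauge hn)).const_mul _).const_mul _).add
    ((integrable_coord_stdGaussian 0).const_mul _)

theorem integral_polarVar (h : IsCenteredIsotropic u c) :
    ∫ z, polarVar u z ∂(stdGaussian (EuclideanSpace ℝ (Fin (n + 1)))) =
      √(n / (n + 1)) * ellNorm (polarBody (convexHull ℝ (Set.range u))) := by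
  unfold polarVar ellNorm
  rw [integral_add ((integrable_comp_tailVec h.integrable_gauge_polarBody).const_mul _)
    ((integrable_coord_stdGaussian 0).const_mul _), integral_const_mul, integral_const_mul,
    integral_coord_stdGaussian, integral_comp_tailVec _ h.continuous_gauge_polarBody]
  ring

theorem integral_hullVar (h : IsCenteredIsotropic u c) (hn : 1 ≤ n) :
    ∫ z, hullVar u z ∂(stdGaussian (EuclideanSpace ℝ (Fin (n + 1)))) =
      √(n / (n + 1)) * (1 / n * ellNorm (convexHull ℝ (Set.range u))) := by
  unfold hullVar ellNorm
  rw [integral_add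
    (((integrable_comp_tailVec (h.integrable_neg_gauge hn)).const_mul _).const_mul _)
    ((integrable_coord_stdGaussian 0).const_mul _), integral_const_mul, integral_const_mul,
    integral_const_mul, integral_coord_stdGaussian, integral_comp_tailVec
    (fun x => gauge (convexHull ℝ (Set.range u)) (-x))
    ((h.continuous_gauge_convexHull hn).comp continuous_neg), integral_comp_neg_stdGaussian]
  ring

/-- The gauge of the polar dominates every `⟪·, u i⟫`, hence `polarVar` dominates every `⟪z, v i⟫`.
-/
theorem polarVar_lt_subset (h : IsCenteredIsotropic u c) (t : ℝ) :
    {z | polarVar u z < t} ⊆ {z | ∀ i, inner ℝ z (liftVec u i) < t} := fun z hz i => by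
  refine lt_of_le_of_lt ?_ hz
  rw [liftVec, inner_eq_inner_tailVec, real_inner_smul_right, polarVar, add_comm, mul_comm (z 0)]
  have := h.inner_le_gauge_polarBody (tailVec z) i
  gcongr

theorem subset_hullVar_le (h : IsCenteredIsotropic u c) (hn : 1 ≤ n) (t : ℝ) :
    {y | ∃ a : Fin k → ℝ, (∀ i, a i ≤ t) ∧
      y = ∑ i, ((n + 1) / n * c i * a i) • liftVec u i} ⊆ {z | hullVar u z ≤ t} := by
  rintro _ ⟨a, ha, rfl⟩
  have hn' : (0 : ℝ) < n := by exact_mod_cast hn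
  have hα : √((n : ℝ) / (n + 1)) * √((n : ℝ) / (n + 1)) = n / (n + 1) :=
    Real.mul_self_sqrt (by positivity)
  have hβ : √(1 / ((n : ℝ) + 1)) * √(1 / ((n : ℝ) + 1)) = 1 / (n + 1) :=
    Real.mul_self_sqrt (by positivity)
  have hα0 : 0 ≤ √((n : ℝ) / (n + 1)) := Real.sqrt_nonneg _
  change hullVar u _ ≤ t
  rw [hullVar, tailVec_sum_smul]
  simp only [liftVec, tailVec_consVec]
  set α := √((n : ℝ) / (n + 1)) with hα'
  set β := √(1 / ((n : ℝ) + 1)) with hβ'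
  have h1 : (∑ i, ((n + 1) / n * c i * a i) • consVec β (α • u i)) 0 =
      (n + 1) / n * β * ∑ i, c i * a i := by
    have : (∑ i, ((n + 1) / n * c i * a i) • consVec β (α • u i)) 0 =
        ∑ i, ((n + 1) / n * c i * a i) * consVec β (α • u i) 0 := by simp
    rw [this, Finset.mul_sum]
    exact Finset.sum_congr rfl fun i _ => by rw [consVec_zero]; ring
  -- Centring allows a multiple of `t ∑ c i u i = 0` to be added. The new coefficients are
  -- nonnegative because `a i ≤ t`, so the gauge is at most their sum; the contribution of the
  -- zeroth coordinate then makes the total exactly `t`.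
  have h2 : -∑ i, ((n + 1) / n * c i * a i) • α • u i =
      ∑ i, ((n + 1) / n * α * (c i * (t - a i))) • u i := by
    have h3 : ∀ i, ((n + 1) / n * α * (c i * (t - a i))) • u i =
        (((n : ℝ) + 1) / n * α * t) • (c i • u i) - ((n + 1) / n * c i * a i) • α • u i := fun i => by
      rw [smul_smul, smul_smul, ← sub_smul]; congr 1; ring
    simp only [h3, Finset.sum_sub_distrib, ← Finset.smul_sum, h.centered]
    simp
  rw [h1, h2]
  have h4 := gauge_sum_smul_le (s := u) (a := fun i => (n + 1) / n * α * (c i * (t - a i)))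
    fun i => mul_nonneg (by positivity) (mul_nonneg (h.weight_pos i).le (sub_nonneg.2 (ha i)))
  have h5 : ∑ i, (n + 1) / n * α * (c i * (t - a i)) =
      (n + 1) / n * α * (n * t - ∑ i, c i * a i) := by
    rw [← Finset.mul_sum, ← h.sum_weights, Finset.sum_mul, ← Finset.sum_sub_distrib]
    congr 1
    exact Finset.sum_congr rfl fun i _ => by ring
  rw [h5] at h4
  calc _ ≤ α * (1 / n * ((n + 1) / n * α * (n * t - ∑ i, c i * a i))) +
        β * ((n + 1) / n * β * ∑ i, c i * a i) := by gcongr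
    _ = (α * α) * ((n + 1) / n) * (1 / n) * (n * t - ∑ i, c i * a i) +
        (β * β) * ((n + 1) / n) * ∑ i, c i * a i := by ring
    _ = t := by rw [hα, hβ]; field_simp; ring

theorem polarVar_le_hullVar (h : IsCenteredIsotropic u c) (hn : 1 ≤ n)
    (hu : ∀ i j, -(1 / n : ℝ) ≤ inner ℝ (u i) (u j)) (z : EuclideanSpace ℝ (Fin (n + 1))) :
    polarVar u z ≤ hullVar u z := by
  unfold polarVar hullVar
  have := h.mul_gauge_polarBody_le hn hu (tailVec z)
  gcongr

end IsCenteredIsotropic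

/-! ### Near-extremality forces a small spread -/

section Spread

open IsCenteredIsotropic

variable {m k l : ℕ} {u : Fin k → EuclideanSpace ℝ (Fin (m + 1))} {c : Fin k → ℝ}
  {p : Fin l → EuclideanSpace ℝ (Fin (m + 1))} {w : Fin l → ℝ}

/-- If `ℓ(C)` or `ℓ(C°)` is nearly that of a regular simplex then the lifted frame has a small
spread. -/
theorem spreadDeficit_le_of_ellNorm (h : IsCenteredIsotropic u c) (hp : IsCenteredIsotropic p w)
    (hpp : ∀ i j, -(1 / ((m + 1 : ℕ) : ℝ)) ≤ inner ℝ (p i) (p j)) {ε : ℝ} (hε : 0 ≤ ε)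
    (hℓ : (1 - ε) * ellNorm (convexHull ℝ (Set.range p)) ≤ ellNorm (convexHull ℝ (Set.range u)) ∨
      ellNorm (polarBody (convexHull ℝ (Set.range u))) ≤
        (1 + ε) * ellNorm (polarBody (convexHull ℝ (Set.range p)))) :
    IsTightFrame.spreadDeficit m (frameSpread (liftVec u) fun i =>
      (((m + 1 : ℕ) : ℝ) + 1) / ((m + 1 : ℕ) : ℝ) * c i) ≤ 2 ^ (m + 4) * ((m + 1 : ℕ) : ℝ) * ε := by
  have hn : 1 ≤ m + 1 := by omega
  have hn' : (0 : ℝ) < ((m + 1 : ℕ) : ℝ) := by positivity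
  have hF := h.isTightFrame_liftVec hn
  have hG := hp.isTightFrame_liftVec hn
  set s := frameSpread (liftVec u) fun i => (((m + 1 : ℕ) : ℝ) + 1) / ((m + 1 : ℕ) : ℝ) * c i
  set d := IsTightFrame.spreadDeficit m s with hd
  have hd0 : 0 ≤ d := by
    have : 0 ≤ s := hF.frameSpread_nonneg
    rw [hd]; unfold IsTightFrame.spreadDeficit; positivity
  set α := √(((m + 1 : ℕ) : ℝ) / (((m + 1 : ℕ) : ℝ) + 1)) with hα
  have hα1 : α ≤ 1 := by
    rw [hα, Real.sqrt_le_left zero_le_one, one_pow, div_le_one (by positivity)]; linarith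
  have hα0 : 0 ≤ α := Real.sqrt_nonneg _
  have hup : ∀ t, stdGaussian _ {z | polarVar p z < t} ≤ ENNReal.ofReal (gaussCdf t ^ (m + 2)) :=
    fun t => (measure_mono (hp.polarVar_lt_subset t)).trans (by
      have := hG.measure_halfspaces_le t
      rwa [finrank_euclideanSpace_fin] at this)
  have hlow : ∀ t, ENNReal.ofReal (gaussCdf t ^ (m + 2)) ≤ stdGaussian _ {z | hullVar p z ≤ t} :=
    fun t => by
      have := hG.ofReal_gaussCdf_pow_le_measure t
      rw [finrank_euclideanSpace_fin] at this
      exact this.trans (measure_mono (hp.subset_hullVar_le hn t))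
  have hle := hp.polarVar_le_hullVar hn hpp
  rcases hℓ with hℓ | hℓ
  -- The reverse inequality has a multiplicative deficit, so the factor `Φ(t)^(m+2) ≥ (1/2)^(m+2)`
  -- appears. Together with the half in `d/2` and the interval length `1/2` it accounts for
  -- `2^(m+4)`.
  · have key := mul_sub_le_integral_sub_of_measure_le (X := hullVar u) (Y := hullVar p)
      (a := 2) (b := 5 / 2) (d := (1 / 2) ^ (m + 2) * (d / 2)) (h.continuous_hullVar hn).measurable
      (hp.continuous_hullVar hn).measurable (h.integrable_hullVar hn) (hp.integrable_hullVar hn)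
      (by positivity) (fun t => ?_) (fun t ht => ?_)
    · rw [h.integral_hullVar hn, hp.integral_hullVar hn, ← hα] at key
      have h1 := hp.ellNorm_convexHull_le hn
      have h2 : α * (1 / ((m + 1 : ℕ) : ℝ) * ellNorm (convexHull ℝ (Set.range p))) -
          α * (1 / ((m + 1 : ℕ) : ℝ) * ellNorm (convexHull ℝ (Set.range u))) ≤
          ((m + 1 : ℕ) : ℝ) * ε := by
        calc _ = α * (1 / ((m + 1 : ℕ) : ℝ) * (ellNorm (convexHull ℝ (Set.range p)) -
              ellNorm (convexHull ℝ (Set.range u)))) := by ring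
          _ ≤ α * (1 / ((m + 1 : ℕ) : ℝ) * (ε * (((m + 1 : ℕ) : ℝ) * ((m + 1 : ℕ) : ℝ)))) := by
              have h3 : ellNorm (convexHull ℝ (Set.range p)) -
                  ellNorm (convexHull ℝ (Set.range u)) ≤
                  ε * (((m + 1 : ℕ) : ℝ) * ((m + 1 : ℕ) : ℝ)) := by nlinarith
              gcongr
          _ ≤ 1 * (1 / ((m + 1 : ℕ) : ℝ) * (ε * (((m + 1 : ℕ) : ℝ) * ((m + 1 : ℕ) : ℝ)))) := by
              gcongr
          _ = _ := by field_simp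
      have h4 := key.trans h2
      calc d = 2 ^ (m + 4) * ((1 / 2) ^ (m + 2) * (d / 2) * (5 / 2 - 2)) := by
            rw [one_div, inv_pow]; field_simp; ring
        _ ≤ 2 ^ (m + 4) * (((m + 1 : ℕ) : ℝ) * ε) := by gcongr
        _ = _ := by ring
    · have h1 := hF.ofReal_gaussCdf_pow_le_measure t
      rw [finrank_euclideanSpace_fin] at h1
      exact (measure_mono fun z hz => lt_of_le_of_lt (hle z) hz).trans
        ((hup t).trans (h1.trans (measure_mono (h.subset_hullVar_le hn t))))
    · have h1 := hF.gaussCdf_pow_add_le_measure inner_consVec_liftVec ht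
      refine le_trans ?_ (h1.trans (measure_mono (h.subset_hullVar_le hn t)))
      have h2 : 1 / 2 ≤ gaussCdf t := by
        rw [← gaussCdf_zero]; exact strictMono_gaussCdf.monotone (by linarith [ht.1])
      rw [mul_add, mul_one, ENNReal.ofReal_add (by positivity) (by positivity)]
      refine add_le_add ((measure_mono fun z hz => lt_of_le_of_lt (hle z) hz).trans (hup t)) ?_
      exact ENNReal.ofReal_le_ofReal (by gcongr)
  · have key := mul_sub_le_integral_sub_of_measure_le (X := polarVar p) (Y := polarVar u)
      (a := 2) (b := 5 / 2) (d := d / 2) hp.continuous_polarVar.measurable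
      h.continuous_polarVar.measurable hp.integrable_polarVar h.integrable_polarVar
      (by positivity) (fun t => ?_) (fun t ht => ?_)
    · rw [h.integral_polarVar, hp.integral_polarVar, ← hα] at key
      have h1 := hp.ellNorm_polarBody_le hn
      have h2 : α * ellNorm (polarBody (convexHull ℝ (Set.range u))) -
          α * ellNorm (polarBody (convexHull ℝ (Set.range p))) ≤ ((m + 1 : ℕ) : ℝ) * ε := by
        calc _ = α * (ellNorm (polarBody (convexHull ℝ (Set.range u))) -
              ellNorm (polarBody (convexHull ℝ (Set.range p)))) := by ring
          _ ≤ α * (ε * ((m + 1 : ℕ) : ℝ)) := by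
              have h3 : ellNorm (polarBody (convexHull ℝ (Set.range u))) -
                  ellNorm (polarBody (convexHull ℝ (Set.range p))) ≤ ε * ((m + 1 : ℕ) : ℝ) := by
                nlinarith
              gcongr
          _ ≤ 1 * (ε * ((m + 1 : ℕ) : ℝ)) := by gcongr
          _ = _ := by ring
      have h4 : (4 : ℝ) ≤ 2 ^ (m + 4) := by
        calc (4 : ℝ) = 2 ^ 2 := by norm_num
          _ ≤ 2 ^ (m + 4) := pow_le_pow_right₀ (by norm_num) (by omega)
      calc d = 4 * (d / 2 * (5 / 2 - 2)) := by ring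
        _ ≤ 2 ^ (m + 4) * (((m + 1 : ℕ) : ℝ) * ε) := by
            have := key.trans h2
            gcongr
        _ = _ := by ring
    · have h1 := hF.measure_halfspaces_le t
      rw [finrank_euclideanSpace_fin] at h1
      exact (measure_mono (h.polarVar_lt_subset t)).trans (h1.trans ((hlow t).trans
        (measure_mono fun z hz => (hle z).trans hz)))
    · have h1 := hF.measure_halfspaces_add_le inner_consVec_liftVec ht
      refine le_trans ?_ (h1.trans ((hlow t).trans (measure_mono fun z hz => (hle z).trans hz)))
      gcongr
      exact fun hz => h.polarVar_lt_subset t hz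

end Spread

/-! ### From a small spread to a nearly orthonormal basis -/

namespace IsTightFrame

variable {V ι : Type*} [NormedAddCommGroup V] [InnerProductSpace ℝ V] [Fintype ι]
  {v : ι → V} {c : ι → ℝ}

theorem inner_sq_mul_le_of_frameSpread_le (h : IsTightFrame v c) {τ δ : ℝ} (hτ : 0 < τ)
    (hδ : frameSpread v c ≤ τ ^ 2 * δ) {i j : ι} (hi : τ ≤ c i) (hj : τ ≤ c j) :
    inner ℝ (v i) (v j) ^ 2 * (1 - inner ℝ (v i) (v j)) ≤ δ := by
  have hnn : ∀ i j, 0 ≤ inner ℝ (v i) (v j) ^ 2 * (1 - inner ℝ (v i) (v j)) := fun i j => by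
    have := real_inner_le_norm (v i) (v j)
    rw [h.norm_eq_one, h.norm_eq_one] at this
    exact mul_nonneg (sq_nonneg _) (by linarith)
  have hc := fun i => (h.weight_pos i).le
  have h1 : c i * c j * (inner ℝ (v i) (v j) ^ 2 * (1 - inner ℝ (v i) (v j))) ≤
      frameSpread v c :=
    (Finset.single_le_sum (f := fun j => c i * c j *
      (inner ℝ (v i) (v j) ^ 2 * (1 - inner ℝ (v i) (v j))))
      (fun j _ => mul_nonneg (mul_nonneg (hc i) (hc j)) (hnn i j)) (Finset.mem_univ j)).trans
    (Finset.single_le_sum (f := fun i => ∑ j, c i * c j *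
      (inner ℝ (v i) (v j) ^ 2 * (1 - inner ℝ (v i) (v j))))
      (fun i _ => Finset.sum_nonneg fun j _ => mul_nonneg (mul_nonneg (hc i) (hc j)) (hnn i j))
      (Finset.mem_univ i))
  have h2 : τ ^ 2 ≤ c i * c j := by rw [pow_two]; exact mul_le_mul hi hj hτ.le (hc i)
  have h3 := mul_le_mul_of_nonneg_right h2 (hnn i j)
  exact le_of_mul_le_mul_left (h3.trans (h1.trans hδ)) (by positivity)

open Classical in
/-- A frame with a small spread contains a nearly orthonormal basis. -/
theorem exists_nearly_orthonormal [FiniteDimensional ℝ V] (h : IsTightFrame v c) {τ δ : ℝ}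
    (hτ : 0 < τ) (hk : Fintype.card ι * τ ≤ 1 / 2) (hδ : frameSpread v c ≤ τ ^ 2 * δ)
    (hδ0 : 0 ≤ δ) (hδ1 : 16 * δ * Module.finrank ℝ V < 1) :
    ∃ i : Fin (Module.finrank ℝ V) → ι, Function.Injective i ∧
      ∀ a b, a ≠ b → inner ℝ (v (i a)) (v (i b)) ^ 2 ≤ 2 * δ := by
  set N := Module.finrank ℝ V with hN
  have hkey := fun i j => h.inner_sq_mul_le_of_frameSpread_le hτ hδ (i := i) (j := j)
  -- `I` is a largest set of heavy vectors with pairwise inner products below `1/2`. By maximality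
  -- every heavy vector lies in the cluster `cls i` of some `i ∈ I`.
  obtain ⟨I, hI, hmax⟩ := Finset.exists_max_image
    (Finset.univ.filter fun I : Finset ι => (∀ i ∈ I, τ ≤ c i) ∧
      ∀ i ∈ I, ∀ j ∈ I, i ≠ j → inner ℝ (v i) (v j) < (1 / 2 : ℝ)) Finset.card ⟨∅, by simp⟩
  simp only [Finset.mem_filter, Finset.mem_univ, true_and] at hI hmax
  obtain ⟨hIc, hIo⟩ := hI
  let cls : ι → Finset ι := fun i =>
    Finset.univ.filter fun j => τ ≤ c j ∧ 1 / 2 ≤ inner ℝ (v i) (v j)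
  have hcov : ∀ j, τ ≤ c j → ∃ i ∈ I, j ∈ cls i := fun j hj => by
    by_contra! hcon
    simp only [cls, Finset.mem_filter, Finset.mem_univ, true_and, not_and, not_le] at hcon
    have hjI : j ∉ I := fun hjI => by
      have := hcon j hjI hj
      rw [real_inner_self_eq_norm_sq, h.norm_eq_one] at this
      norm_num at this
    have := hmax (insert j I) ⟨fun i hi => ?_, fun a ha b hb hab => ?_⟩
    · rw [Finset.card_insert_of_notMem hjI] at this; omega
    · rcases Finset.mem_insert.1 hi with rfl | hi
      exacts [hj, hIc i hi]
    · rcases Finset.mem_insert.1 ha with ha' | ha' <;> rcases Finset.mem_insert.1 hb with hb' | hb'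
      · exact absurd (ha'.trans hb'.symm) hab
      · rw [ha', real_inner_comm]; exact hcon b hb' hj
      · rw [hb']; exact hcon a ha' hj
      · exact hIo a ha' b hb' hab
  -- Inside a cluster `ρ ≥ 1/2`, so `ρ²(1 - ρ) ≤ δ` gives `1 - ρ ≤ 4δ` and `ρ² ≥ 1 - 8δ`; now use `∑
  -- c j ⟪v i, v j⟫² = 1`.
  have hcls : ∀ i ∈ I, (1 - 8 * δ) * ∑ j ∈ cls i, c j ≤ 1 := fun i hi => by
    have h1 := h.sum_inner_sq (v i)
    rw [h.norm_eq_one, one_pow] at h1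
    refine le_trans ?_ h1.le
    rw [Finset.mul_sum]
    refine (Finset.sum_le_sum fun j hj => ?_).trans (Finset.sum_le_sum_of_subset_of_nonneg
      (Finset.subset_univ (cls i)) fun j _ _ => mul_nonneg (h.weight_pos j).le (sq_nonneg _))
    simp only [cls, Finset.mem_filter, Finset.mem_univ, true_and] at hj
    have h2 := hkey i j (hIc i hi) hj.1
    have h3 := real_inner_le_norm (v i) (v j)
    rw [h.norm_eq_one, h.norm_eq_one] at h3
    set ρ : ℝ := inner ℝ (v i) (v j)
    have h4 : 1 - ρ ≤ 4 * δ := by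
      have : (1 / 2) ^ 2 ≤ ρ ^ 2 := pow_le_pow_left₀ (by norm_num) hj.2 2
      nlinarith
    have h5 : 1 - 8 * δ ≤ ρ ^ 2 := by nlinarith
    rw [mul_comm]
    exact mul_le_mul_of_nonneg_left h5 (h.weight_pos j).le
  -- The light vectors have total weight at most `card ι · τ ≤ 1/2`. With fewer than `N` clusters
  -- the remaining weight `N - 1/2` could not be accommodated when `16 δ N < 1`.
  have hsum : (N : ℝ) - 1 / 2 ≤ ∑ i ∈ I, ∑ j ∈ cls i, c j := by
    have h1 : ∑ j with τ ≤ c j, c j ≤ ∑ i ∈ I, ∑ j ∈ cls i, c j := by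
      have h2 : ∀ i, ∑ j ∈ cls i, c j = ∑ j, if j ∈ cls i then c j else 0 := fun i => by simp
      simp only [h2]
      rw [Finset.sum_comm, Finset.sum_filter]
      have hnn : ∀ j i, 0 ≤ if j ∈ cls i then c j else 0 := fun j i => by
        split_ifs
        exacts [(h.weight_pos j).le, le_rfl]
      refine Finset.sum_le_sum fun j _ => ?_
      split_ifs with hj
      · obtain ⟨i, hi, hji⟩ := hcov j hj
        refine le_trans ?_ (Finset.single_le_sum (f := fun i => if j ∈ cls i then c j else 0)
          (fun i _ => hnn j i) hi)
        simp only [if_pos hji, le_refl]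
      · exact Finset.sum_nonneg fun i _ => hnn j i
    have h2 : ∑ j with ¬ τ ≤ c j, c j ≤ 1 / 2 := by
      refine le_trans ?_ hk
      calc ∑ j with ¬ τ ≤ c j, c j ≤ ∑ j with ¬ τ ≤ c j, τ :=
            Finset.sum_le_sum fun j hj => (not_le.1 (Finset.mem_filter.1 hj).2).le
        _ ≤ ∑ j : ι, τ := Finset.sum_le_sum_of_subset_of_nonneg (Finset.subset_univ _)
            fun _ _ _ => hτ.le
        _ = _ := by simp
    have h3 := h.sum_weights
    rw [← Finset.sum_filter_add_sum_filter_not Finset.univ (fun j => τ ≤ c j)] at h3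
    linarith
  have hcard : N ≤ I.card := by
    by_contra! hlt
    have h1 : (1 - 8 * δ) * ∑ i ∈ I, ∑ j ∈ cls i, c j ≤ I.card := by
      rw [Finset.mul_sum]
      simpa using Finset.sum_le_sum hcls
    have h2 : (I.card : ℝ) ≤ N - 1 := by
      have : (I.card : ℝ) + 1 ≤ N := by exact_mod_cast hlt
      linarith
    have hN1 : (1 : ℝ) ≤ N := by linarith [(Nat.cast_nonneg I.card : (0 : ℝ) ≤ I.card)]
    have h3 : 0 ≤ 1 - 8 * δ := by nlinarith
    have h4 := mul_le_mul_of_nonneg_left hsum h3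
    nlinarith
  obtain ⟨f⟩ := Function.Embedding.nonempty_of_card_le (α := Fin N) (β := I) (by simpa using hcard)
  refine ⟨fun a => f a, fun a b hab => f.injective (Subtype.ext hab), fun a b hab => ?_⟩
  have hne : (f a : ι) ≠ f b := fun hab' => hab (f.injective (Subtype.ext hab'))
  have h1 := hIo _ (f a).2 _ (f b).2 hne
  have h2 := hkey _ _ (hIc _ (f a).2) (hIc _ (f b).2)
  -- For `ρ < 1/2` the factor `1 - ρ` exceeds `1/2`, so `ρ²(1 - ρ) ≤ δ` yields `ρ² ≤ 2δ`.
  nlinarith [sq_nonneg (inner ℝ (v (f a)) (v (f b)) : ℝ)]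

end IsTightFrame

/-! ### From nearby Gram matrices to an isometry -/

/-- Vectors whose Gram matrix is close to that of a balanced tight frame are close to the image of
this frame under an isometry. -/
theorem exists_isometry_norm_sub_le {n : ℕ} (hn : 1 ≤ n)
    {p u : Fin (n + 1) → EuclideanSpace ℝ (Fin n)}
    (hp : IsTightFrame p fun _ => (n : ℝ) / (n + 1)) (hp0 : ∑ i, p i = 0)
    (hpp : ∀ a b, a ≠ b → inner ℝ (p a) (p b) = -(1 / n : ℝ)) {θ : ℝ}
    (hθ : ∀ a b, |inner ℝ (u a) (u b) - inner ℝ (p a) (p b)| ≤ θ) (hθ1 : n * θ < 1) :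
    ∃ U : EuclideanSpace ℝ (Fin n) ≃ₗᵢ[ℝ] EuclideanSpace ℝ (Fin n),
      ∀ a, ‖u a - U (p a)‖ ≤ √θ + n * θ := by
  have hn' : (0 : ℝ) < n := by exact_mod_cast hn
  have hθ0 : 0 ≤ θ := (abs_nonneg _).trans (hθ 0 0)
  -- If the Gram matrices agreed, `A` would be the isometry taking `p a` to `u a`. In general `‖A
  -- x‖²` and `‖x‖²` are the same quadratic expression in the frame coefficients, evaluated with two
  -- nearby Gram matrices.
  let A : EuclideanSpace ℝ (Fin n) →L[ℝ] EuclideanSpace ℝ (Fin n) :=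
    ∑ a, ((n : ℝ) / (n + 1)) • InnerProductSpace.rankOne ℝ (u a) (p a)
  have hA : ∀ x, A x = ∑ a, ((n : ℝ) / (n + 1) * inner ℝ x (p a)) • u a := fun x => by
    simp only [A, sum_apply, smul_apply, InnerProductSpace.rankOne_apply, smul_smul,
      real_inner_comm]
  have hsq : ∀ x, ∑ a, inner ℝ x (p a) ^ 2 = (n + 1) / n * ‖x‖ ^ 2 := fun x => by
    rw [← hp.sum_inner_sq x, ← Finset.mul_sum]; field_simp
  have hnorm : ∀ x, |‖A x‖ ^ 2 - ‖x‖ ^ 2| ≤ n * θ * ‖x‖ ^ 2 := fun x => by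
    have h1 : ‖A x‖ ^ 2 = (n / (n + 1)) ^ 2 * ∑ a, ∑ b, inner ℝ x (p a) * inner ℝ x (p b) *
        inner ℝ (u a) (u b) := by
      rw [← real_inner_self_eq_norm_sq, hA, sum_inner, Finset.mul_sum]
      refine Finset.sum_congr rfl fun a _ => ?_
      rw [inner_sum, Finset.mul_sum]
      refine Finset.sum_congr rfl fun b _ => ?_
      rw [real_inner_smul_left, real_inner_smul_right]; ring
    have h2 : ‖x‖ ^ 2 = (n / (n + 1)) ^ 2 * ∑ a, ∑ b, inner ℝ x (p a) * inner ℝ x (p b) *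
        inner ℝ (p a) (p b) := by
      rw [← real_inner_self_eq_norm_sq]
      conv_lhs => rw [← hp.expand x]
      rw [sum_inner, Finset.mul_sum]
      refine Finset.sum_congr rfl fun a _ => ?_
      rw [inner_sum, Finset.mul_sum]
      refine Finset.sum_congr rfl fun b _ => ?_
      rw [real_inner_smul_left, real_inner_smul_right]; ring
    have h3 : ‖A x‖ ^ 2 - ‖x‖ ^ 2 = (n / (n + 1)) ^ 2 * ∑ a, ∑ b, inner ℝ x (p a) *
        inner ℝ x (p b) * (inner ℝ (u a) (u b) - inner ℝ (p a) (p b)) := by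
      rw [h1, h2, ← mul_sub, ← Finset.sum_sub_distrib]
      congr 1
      refine Finset.sum_congr rfl fun a _ => ?_
      rw [← Finset.sum_sub_distrib]
      exact Finset.sum_congr rfl fun b _ => by ring
    rw [h3, abs_mul, abs_of_nonneg (by positivity)]
    calc _ ≤ ((n : ℝ) / (n + 1)) ^ 2 * ∑ a, ∑ b, |inner ℝ x (p a)| * |inner ℝ x (p b)| * θ := by
          gcongr
          refine (Finset.abs_sum_le_sum_abs _ _).trans (Finset.sum_le_sum fun a _ => ?_)
          refine (Finset.abs_sum_le_sum_abs _ _).trans (Finset.sum_le_sum fun b _ => ?_)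
          rw [abs_mul, abs_mul]
          have := hθ a b
          gcongr
      _ = ((n : ℝ) / (n + 1)) ^ 2 * θ * (∑ a, |inner ℝ x (p a)|) ^ 2 := by
          rw [pow_two (∑ a, |inner ℝ x (p a)|), Finset.sum_mul_sum, mul_assoc]
          congr 1
          rw [Finset.mul_sum]
          refine Finset.sum_congr rfl fun a _ => ?_
          rw [Finset.mul_sum]
          exact Finset.sum_congr rfl fun b _ => by ring
      _ ≤ ((n : ℝ) / (n + 1)) ^ 2 * θ * ((n + 1) * ∑ a, |inner ℝ x (p a)| ^ 2) := by
          have := sq_sum_le_card_mul_sum_sq (s := Finset.univ)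
            (f := fun a : Fin (n + 1) => |inner ℝ x (p a)|)
          simp only [Finset.card_univ, Fintype.card_fin, Nat.cast_add, Nat.cast_one] at this
          gcongr
      _ = n * θ * ‖x‖ ^ 2 := by
          simp only [sq_abs, hsq]; field_simp
  -- the orthogonal factor of the polar decomposition of `A`
  have hsym : (A.adjoint ∘L A : EuclideanSpace ℝ (Fin n) →ₗ[ℝ] _).IsSymmetric := fun x y => by
    simp only [ContinuousLinearMap.coe_coe, ContinuousLinearMap.comp_apply,
      ContinuousLinearMap.adjoint_inner_left, ContinuousLinearMap.adjoint_inner_right]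
  have hfr : Module.finrank ℝ (EuclideanSpace ℝ (Fin n)) = n := finrank_euclideanSpace_fin
  let b := hsym.eigenvectorBasis hfr
  have horth : ∀ i j, i ≠ j → inner ℝ (A (b i)) (A (b j)) = (0 : ℝ) := fun i j hij => by
    rw [← ContinuousLinearMap.adjoint_inner_right]
    have h1 : A.adjoint (A (b j)) = (hsym.eigenvalues hfr j : ℝ) • b j :=
      hsym.apply_eigenvectorBasis hfr j
    rw [h1, real_inner_smul_right, b.orthonormal.2 hij, mul_zero]
  have hb : ∀ i, |‖A (b i)‖ ^ 2 - 1| ≤ n * θ := fun i => by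
    have := hnorm (b i)
    rwa [b.orthonormal.norm_eq_one, one_pow, mul_one] at this
  have hb0 : ∀ i, 0 < ‖A (b i)‖ := fun i => by
    have := (abs_le.1 (hb i)).1
    by_contra! hcon
    have h0 : ‖A (b i)‖ = 0 := le_antisymm hcon (norm_nonneg _)
    rw [h0] at this
    linarith
  have hb1 : ∀ i, |1 - ‖A (b i)‖| ≤ n * θ := fun i => by
    refine le_trans ?_ (hb i)
    rw [show ‖A (b i)‖ ^ 2 - 1 = (‖A (b i)‖ - 1) * (‖A (b i)‖ + 1) by ring, abs_mul, abs_sub_comm]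
    refine le_mul_of_one_le_right (abs_nonneg _) ?_
    rw [abs_of_pos (by linarith [hb0 i])]
    linarith [hb0 i]
  let f : Fin n → EuclideanSpace ℝ (Fin n) := fun i => ‖A (b i)‖⁻¹ • A (b i)
  have hf : Orthonormal ℝ f := by
    refine ⟨fun i => ?_, fun i j hij => ?_⟩
    · simp only [f, norm_smul, norm_inv, norm_norm]
      exact inv_mul_cancel₀ (hb0 i).ne'
    · simp only [f]
      rw [real_inner_smul_left, real_inner_smul_right, horth i j hij]; simp
  have hcard : Fintype.card (Fin n) = Module.finrank ℝ (EuclideanSpace ℝ (Fin n)) := by simp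
  let g : OrthonormalBasis (Fin n) ℝ (EuclideanSpace ℝ (Fin n)) := OrthonormalBasis.mk hf
    (by rw [hf.linearIndependent.span_eq_top_of_card_eq_finrank' hcard])
  have hg : ∀ i, g i = f i := fun i => by simp [g]
  let U := b.equiv g (Equiv.refl _)
  have hU : ∀ x, ‖A x - U x‖ ≤ n * θ * ‖x‖ := fun x => by
    have h1 : A x - U x = ∑ i, (inner ℝ (b i) x * (‖A (b i)‖ - 1)) • g i := by
      conv_lhs => rw [← b.sum_repr' x]
      rw [map_sum, map_sum, ← Finset.sum_sub_distrib]
      refine Finset.sum_congr rfl fun i _ => ?_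
      have hUb : U (b i) = g i := by simp [U]
      have hAb : A (b i) = ‖A (b i)‖ • g i := by
        rw [hg]; simp only [f]; rw [smul_smul, mul_inv_cancel₀ (hb0 i).ne', one_smul]
      rw [map_smul, map_smul, hUb, mul_sub, mul_one, sub_smul, mul_smul, ← hAb]
    refine (sq_le_sq₀ (norm_nonneg _) (by positivity)).1 ?_
    rw [h1, ← real_inner_self_eq_norm_sq, g.orthonormal.inner_sum]
    have h2 : ‖x‖ ^ 2 = ∑ i, inner ℝ (b i) x ^ 2 := by
      have := b.sum_sq_norm_inner_right x
      simpa using this.symm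
    rw [mul_pow, h2, Finset.mul_sum]
    refine Finset.sum_le_sum fun i _ => ?_
    have h3 : (‖A (b i)‖ - 1) ^ 2 ≤ (n * θ) ^ 2 := by
      rw [← sq_abs, abs_sub_comm]
      exact pow_le_pow_left₀ (abs_nonneg _) (hb1 i) 2
    have h4 := mul_le_mul_of_nonneg_right h3 (sq_nonneg (inner ℝ (b i) x))
    simp only [conj_trivial]
    linarith
  refine ⟨U, fun a => ?_⟩
  -- The squared norm is the sum of the Gram entries, which vanishes for `p`. Taking the root here
  -- is what costs `√θ` instead of `θ`, hence the exponent `1/4` of `ε` in the end.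
  have hs : ‖∑ a, u a‖ ≤ (n + 1) * √θ := by
    refine (sq_le_sq₀ (norm_nonneg _) (by positivity)).1 ?_
    rw [mul_pow, Real.sq_sqrt hθ0, ← real_inner_self_eq_norm_sq, sum_inner]
    have h1 : ∑ a, ∑ b, inner ℝ (p a) (p b) = (0 : ℝ) := by
      simp only [← inner_sum, hp0, inner_zero_right, Finset.sum_const_zero]
    have h2 : ∑ a, ∑ b, (inner ℝ (u a) (u b) - inner ℝ (p a) (p b)) ≤
        ∑ a : Fin (n + 1), ∑ b : Fin (n + 1), θ :=
      Finset.sum_le_sum fun a _ => Finset.sum_le_sum fun b _ => (abs_le.1 (hθ a b)).2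
    simp only [Finset.sum_sub_distrib, h1, sub_zero] at h2
    simp only [inner_sum]
    refine h2.trans (le_of_eq ?_)
    simp; ring
  have hAp : u a - A (p a) = ((n : ℝ) + 1)⁻¹ • ∑ b, u b := by
    have h1 : ∀ b, ((n : ℝ) / (n + 1) * inner ℝ (p a) (p b)) • u b =
        (if a = b then u b else 0) - ((n : ℝ) + 1)⁻¹ • u b := fun b => by
      split_ifs with hab
      · subst hab
        rw [real_inner_self_eq_norm_sq, hp.norm_eq_one]
        nth_rewrite 2 [← one_smul ℝ (u a)]
        rw [← sub_smul]; congr 1; field_simp; ring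
      · rw [hpp a b hab, zero_sub, ← neg_smul]; congr 1; field_simp
    rw [hA]
    simp only [h1, Finset.sum_sub_distrib, Finset.sum_ite_eq, Finset.mem_univ, if_true,
      ← Finset.smul_sum]
    abel
  calc ‖u a - U (p a)‖ = ‖(u a - A (p a)) + (A (p a) - U (p a))‖ := by congr 1; abel
    _ ≤ ‖u a - A (p a)‖ + ‖A (p a) - U (p a)‖ := norm_add_le _ _
    _ ≤ √θ + n * θ := by
      refine add_le_add ?_ ?_
      · rw [hAp, norm_smul, norm_inv, Real.norm_of_nonneg (by positivity),
          inv_mul_le_iff₀ (by positivity)]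
        exact hs
      · simpa [hp.norm_eq_one] using hU (p a)

/-- Jordan's inequality in the form `cos φ ≤ 1 - 2φ²/π²`, with `‖x - y‖² = 2 - 2 cos φ` and `π ≤ 4`.
-/
theorem angle_le_two_mul_norm_sub {V : Type*} [NormedAddCommGroup V] [InnerProductSpace ℝ V]
    {x y : V} (hx : ‖x‖ = 1) (hy : ‖y‖ = 1) : InnerProductGeometry.angle x y ≤ 2 * ‖x - y‖ := by
  have h0 := InnerProductGeometry.angle_nonneg x y
  have h1 := InnerProductGeometry.angle_le_pi x y
  have h2 : Real.cos (InnerProductGeometry.angle x y) = inner ℝ x y := by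
    rw [InnerProductGeometry.cos_angle, hx, hy]; simp
  set φ := InnerProductGeometry.angle x y
  have h3 := Real.cos_le_one_sub_mul_cos_sq (x := φ) (by rw [abs_of_nonneg h0]; exact h1)
  have h4 : ‖x - y‖ ^ 2 = 2 - 2 * inner ℝ x y := by
    rw [norm_sub_sq_real, hx, hy]; ring
  refine (sq_le_sq₀ h0 (by positivity)).1 ?_
  have h5 : 2 / Real.pi ^ 2 * φ ^ 2 ≤ ‖x - y‖ ^ 2 / 2 := by rw [h4, ← h2]; linarith
  rw [div_mul_eq_mul_div, div_le_iff₀ (by positivity)] at h5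
  have h6 : Real.pi ^ 2 ≤ 16 := by nlinarith [Real.pi_le_four, Real.pi_pos]
  nlinarith [sq_nonneg ‖x - y‖]

/-! ### Inscribed regular simplices -/

section Simplex

variable {n : ℕ} {S : Affine.Simplex ℝ (EuclideanSpace ℝ (Fin n)) n}

namespace IsInscribedRegular

/-- The image of a regular simplex under a linear isometry. -/
theorem map_isometry (hS : IsInscribedRegular S)
    (U : EuclideanSpace ℝ (Fin n) ≃ₗᵢ[ℝ] EuclideanSpace ℝ (Fin n)) :
    IsInscribedRegular (S.map U.toLinearEquiv.toLinearMap.toAffineMap U.injective) := by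
  have hmap : ∀ j, (S.map U.toLinearEquiv.toLinearMap.toAffineMap U.injective).points j =
      U (S.points j) := fun _ => rfl
  refine ⟨fun σ => ?_, fun j => ?_⟩
  · obtain ⟨x, hx⟩ := hS.1 σ
    refine ⟨(U.symm.toIsometryEquiv.trans x).trans U.toIsometryEquiv, ?_⟩
    funext j
    have := congrFun hx j
    simp only [Function.comp_apply] at this
    simp [hmap, this]
  · rw [hmap, U.norm_map, hS.2]

/-- The `n + 1` vertices are linearly dependent in `ℝⁿ`. Pairing a relation with each vertex, and
using that all off-diagonal inner products equal some `β ≠ 1`, shows that its coefficients are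
equal. So the vertices sum to zero, and `1 + nβ = 0`. -/
theorem inner_eq (hS : IsInscribedRegular S) {a b : Fin (n + 1)} (hab : a ≠ b) :
    inner ℝ (S.points a) (S.points b) = -(1 / n : ℝ) ∧ ∑ i, S.points i = 0 := by
  obtain ⟨r, hr⟩ := hS.1.equilateral
  set β : ℝ := 1 - r ^ 2 / 2 with hβ
  have hin : ∀ i j, i ≠ j → inner ℝ (S.points i) (S.points j) = β := fun i j hij => by
    have h1 := norm_sub_sq_real (S.points i) (S.points j)
    rw [← dist_eq_norm, hr i j hij, hS.2, hS.2] at h1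
    rw [hβ]; linarith
  have hβ1 : β ≠ 1 := fun h => by
    have h1 : S.points a = S.points b :=
      (inner_eq_one_iff_of_norm_eq_one (𝕜 := ℝ) (hS.2 a) (hS.2 b)).1 ((hin a b hab).trans h)
    exact hab (S.independent.injective h1)
  have hdep : ¬ LinearIndependent ℝ S.points := fun h => by
    have := h.fintype_card_le_finrank
    simp at this
  obtain ⟨g, hg, i, hi⟩ := Fintype.not_linearIndependent_iff.1 hdep
  have h1 : ∀ j, (1 - β) * g j + β * ∑ i, g i = 0 := fun j => by
    have h2 := congrArg (fun y => inner ℝ (S.points j) y) hg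
    simp only [inner_sum, real_inner_smul_right, inner_zero_right] at h2
    have h3 : ∀ i, g i * inner ℝ (S.points j) (S.points i) =
        β * g i + if j = i then (1 - β) * g i else 0 := fun i => by
      split_ifs with hji
      · subst hji
        rw [real_inner_self_eq_norm_sq, hS.2]; ring
      · rw [hin j i hji]; ring
    simp only [h3, Finset.sum_add_distrib, Finset.sum_ite_eq, Finset.mem_univ, if_true,
      ← Finset.mul_sum] at h2
    linarith
  have hconst : ∀ j, g j = g i := fun j => by
    have := (h1 j).trans (h1 i).symm
    exact mul_left_cancel₀ (sub_ne_zero.2 hβ1.symm) (by linarith)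
  have hn : (n : ℝ) ≠ 0 := fun h => by
    have : n = 0 := by exact_mod_cast h
    subst this
    exact hab (Fin.ext (by omega))
  have h2 := h1 i
  simp only [hconst, Finset.sum_const, Finset.card_univ, Fintype.card_fin, nsmul_eq_mul] at h2
  refine ⟨?_, ?_⟩
  · rw [hin a b hab]
    have h3 : g i * (1 + β * n) = 0 := by push_cast at h2; linarith
    have h4 := (mul_eq_zero.1 h3).resolve_left hi
    field_simp
    linarith
  · simp only [hconst, ← Finset.smul_sum] at hg
    exact (smul_eq_zero.1 hg).resolve_left hi

theorem isCenteredIsotropic (hS : IsInscribedRegular S) (hn : 1 ≤ n) :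
    IsCenteredIsotropic S.points fun _ => (n : ℝ) / (n + 1) := by
  have hn' : (0 : ℝ) < n := by exact_mod_cast hn
  have hne : (0 : Fin (n + 1)) ≠ Fin.last n := fun h => by
    have := congrArg Fin.val h
    simp at this
    omega
  have hsum := (hS.inner_eq hne).2
  refine ⟨hS.2, fun _ => by positivity, ?_, by rw [← Finset.smul_sum, hsum, smul_zero]⟩
  refine ContinuousLinearMap.coe_injective (LinearMap.ext_on_range (v := S.points) ?_ fun b => ?_)
  · have h1 := S.independent.affineSpan_eq_top_iff_card_eq_finrank_add_one.2 (by simp)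
    refine eq_top_iff.2 ?_
    have h2 := affineSpan_subset_span (k := ℝ) (s := Set.range S.points)
    rw [h1] at h2
    exact fun x _ => h2 (AffineSubspace.mem_top ℝ _ x)
  · simp only [ContinuousLinearMap.coe_coe, sum_apply, smul_apply,
      InnerProductSpace.rankOne_apply, ContinuousLinearMap.id_apply, smul_smul]
    have h3 : ∀ a, ((n : ℝ) / (n + 1) * inner ℝ (S.points a) (S.points b)) • S.points a =
        (if b = a then S.points a else 0) - ((n : ℝ) + 1)⁻¹ • S.points a := fun a => by
      split_ifs with hab
      · subst hab
        rw [real_inner_self_eq_norm_sq, hS.2]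
        nth_rewrite 2 [← one_smul ℝ (S.points b)]
        rw [← sub_smul]; congr 1; field_simp; ring
      · rw [(hS.inner_eq (Ne.symm hab)).1, zero_sub, ← neg_smul]; congr 1; field_simp
    simp only [h3, Finset.sum_sub_distrib, Finset.sum_ite_eq, Finset.mem_univ, if_true,
      ← Finset.smul_sum, hsum, smul_zero, sub_zero]

end IsInscribedRegular

end Simplex

/-! ### Constants, dimension one and the conclusion -/

/-- The dimensional constants in the stability estimate are bounded by a power of the dimension. -/
theorem stability_constant_le {n : ℝ} {m : ℕ} (hm : 1 ≤ m) (hn : n = (m + 1 : ℕ)) :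
    16 * (1 + n) ^ 4 * (8 * (16 * n ^ 4 * (2 ^ 26 * (57 * (4 * (m + 2 : ℝ)) ^ 4 *
      (43 * (m + 2 : ℝ)) ^ (m + 2)) * (2 ^ (m + 4) * n)))) ≤ n ^ (60 * (m + 1)) := by
  have h2 : (2 : ℝ) ≤ n := by rw [hn]; exact_mod_cast by omega
  have h1 : (1 : ℝ) ≤ n := by linarith
  have hm2 : (m + 2 : ℝ) = n + 1 := by rw [hn]; push_cast; ring
  have hpow : ∀ j : ℕ, (2 : ℝ) ^ j ≤ n ^ j := fun j => pow_le_pow_left₀ (by norm_num) h2 j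
  have hle : ∀ {a b : ℕ}, a ≤ b → n ^ a ≤ n ^ b := fun hab => pow_le_pow_right₀ h1 hab
  have e1 : 1 + n ≤ n ^ 2 := by nlinarith
  have e2 : 4 * (n + 1) ≤ n ^ 4 := by
    have := hpow 2
    nlinarith
  have e3 : 43 * (n + 1) ≤ n ^ 8 := by
    have a1 : (64 : ℝ) ≤ n ^ 6 := by have := hpow 6; norm_num at this; exact this
    calc 43 * (n + 1) ≤ 64 * n ^ 2 := by nlinarith
      _ ≤ n ^ 6 * n ^ 2 := by gcongr
      _ = n ^ 8 := by ring
  have c1 : (16 : ℝ) ≤ n ^ 4 := by have := hpow 4; norm_num at this; exact this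
  have c2 : (8 : ℝ) ≤ n ^ 3 := by have := hpow 3; norm_num at this; exact this
  have c3 : (57 : ℝ) ≤ n ^ 6 := by have := hpow 6; norm_num at this; linarith
  rw [hm2]
  calc _ ≤ n ^ 4 * (n ^ 2) ^ 4 * (n ^ 3 * (n ^ 4 * n ^ 4 * (n ^ 26 * (n ^ 6 * (n ^ 4) ^ 4 *
      (n ^ 8) ^ (m + 2)) * (n ^ (m + 4) * n)))) := by
        have := hpow 26
        have := hpow (m + 4)
        gcongr
    _ = n ^ (92 + 9 * m) := by ring
    -- `92 + 9m ≤ 60(m + 1)` holds because `m ≥ 1`.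
    _ ≤ _ := hle (by omega)

/-- In dimension one every unit vector belongs to every centred isotropic family. -/
theorem exists_eq_of_dim_one {k : ℕ} {u : Fin k → EuclideanSpace ℝ (Fin 1)} {c : Fin k → ℝ}
    (h : IsCenteredIsotropic u c) {p : EuclideanSpace ℝ (Fin 1)} (hp : ‖p‖ = 1) :
    ∃ i, u i = p := by
  have hsq : ∀ x : EuclideanSpace ℝ (Fin 1), ‖x‖ = 1 → x 0 = 1 ∨ x 0 = -1 := fun x hx => by
    have := EuclideanSpace.real_norm_sq_eq x
    rw [hx, Fin.sum_univ_one] at this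
    exact mul_self_eq_one_iff.1 (by nlinarith)
  have hext : ∀ x : EuclideanSpace ℝ (Fin 1), x 0 = p 0 → x = p := fun x hx => by
    ext i
    rw [Fin.fin_one_eq_zero i, hx]
  by_contra! hcon
  have hneg : ∀ i, u i 0 = -p 0 := fun i => by
    have := fun hx => hcon i (hext _ hx)
    rcases hsq _ (h.norm_eq_one i) with h1 | h1 <;> rcases hsq _ hp with h2 | h2
    · exact absurd (h1.trans h2.symm) this
    · rw [h1, h2, neg_neg]
    · rw [h1, h2]
    · exact absurd (h1.trans h2.symm) this
  have h1 : (∑ i, c i • u i) 0 = ∑ i, c i * u i 0 := by simp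
  rw [h.centered] at h1
  simp only [hneg, ← Finset.sum_mul, h.sum_weights] at h1
  have : p 0 = 0 := by simpa using h1
  rcases hsq _ hp with h2 | h2 <;> rw [this] at h2 <;> norm_num at h2

/-- The stability of the extremal `ℓ`-norm of the regular simplex, with a rotation of the given
simplex as the approximating simplex. -/
theorem exists_isometry_angle_le {m k : ℕ} (hm : 1 ≤ m) (hk : k ≤ 2 * (m + 1) ^ 2)
    {u : Fin k → EuclideanSpace ℝ (Fin (m + 1))} {c : Fin k → ℝ} (huc : IsCenteredIsotropic u c)
    {Δ : Affine.Simplex ℝ (EuclideanSpace ℝ (Fin (m + 1))) (m + 1)} (hΔ : IsInscribedRegular Δ)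
    {ε η : ℝ} (hε₀ : 0 < ε) (hη0 : 0 < η) (hη1 : η < 1)
    (hη : η ^ 4 = ((m + 1 : ℕ) : ℝ) ^ (60 * (m + 1)) * ε)
    (hℓ : (1 - ε) * ellNorm (simplexBody Δ) ≤ ellNorm (convexHull ℝ (Set.range u)) ∨
      ellNorm (polarBody (convexHull ℝ (Set.range u))) ≤
        (1 + ε) * ellNorm (polarBody (simplexBody Δ))) :
    ∃ U : EuclideanSpace ℝ (Fin (m + 1)) ≃ₗᵢ[ℝ] EuclideanSpace ℝ (Fin (m + 1)),
      ∃ i : Fin (m + 1 + 1) → Fin k, Function.Injective i ∧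
        ∀ j, InnerProductGeometry.angle (u (i j)) (U (Δ.points j)) ≤ η := by
  set n : ℝ := ((m + 1 : ℕ) : ℝ) with hn
  have h2 : (2 : ℝ) ≤ n := by rw [hn]; exact_mod_cast by omega
  have hn1 : 1 ≤ m + 1 := by omega
  have hp := hΔ.isCenteredIsotropic hn1
  have hpp : ∀ a b, a ≠ b → inner ℝ (Δ.points a) (Δ.points b) = -(1 / n : ℝ) := fun a b hab =>
    (hΔ.inner_eq hab).1
  have hp0 : ∑ i, Δ.points i = 0 := (hΔ.inner_eq (a := 0) (b := 1) (by simp)).2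
  have hspread := spreadDeficit_le_of_ellNorm huc hp (fun i j => by
    by_cases hij : i = j
    · rw [hij, real_inner_self_eq_norm_sq, hΔ.2]
      have : 0 ≤ 1 / n := by positivity
      linarith
    · exact (hpp i j hij).ge) hε₀.le hℓ
  have hF := huc.isTightFrame_liftVec hn1
  rw [← hn] at hspread hF
  set C : ℝ := 57 * (4 * (m + 2 : ℝ)) ^ 4 * (43 * (m + 2 : ℝ)) ^ (m + 2) with hC
  have hC0 : 0 < C := by positivity
  -- Chosen so that `τ² δ`, with `τ = 1/(4n²)`, equals the bound on the spread: `16 n⁴ = τ⁻²`, and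
  -- `2^26 C` inverts the constant of `spreadDeficit`.
  set δ : ℝ := 16 * n ^ 4 * (2 ^ 26 * C * (2 ^ (m + 4) * n)) * ε with hδ
  have hδ0 : 0 ≤ δ := by positivity
  have hconst : 16 * (1 + n) ^ 4 * (8 * δ) ≤ η ^ 4 := by
    rw [hη]
    have := mul_le_mul_of_nonneg_right (stability_constant_le hm hn) hε₀.le
    rw [hδ, hC]
    linarith
  have hη4 : η ^ 4 ≤ 1 := pow_le_one₀ hη0.le hη1.le
  have hδ1 : 16 * δ * (n + 1) < 1 := by
    have a1 : (1 + n) ^ 4 * (8 * δ) * 16 ≤ 1 := by linarith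
    have a2 : 3 * (1 + n) ≤ (1 + n) ^ 4 := by
      nlinarith [pow_le_pow_left₀ (by norm_num) (show (3 : ℝ) ≤ 1 + n by linarith) 3]
    nlinarith
  -- The bound `k ≤ 2n²` enters here: it lets vectors of weight below `1/(4n²)` be discarded.
  have hcard : (Fintype.card (Fin k) : ℝ) * (1 / (4 * n ^ 2)) ≤ 1 / 2 := by
    have : (k : ℝ) ≤ 2 * n ^ 2 := by rw [hn]; exact_mod_cast hk
    rw [Fintype.card_fin, mul_one_div, div_le_div_iff₀ (by positivity) two_pos]
    linarith
  have hQ : frameSpread (liftVec u) (fun i => (n + 1) / n * c i) ≤ (1 / (4 * n ^ 2)) ^ 2 * δ := by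
    rw [IsTightFrame.spreadDeficit, ← hC] at hspread
    set Q := frameSpread (liftVec u) (fun i => (n + 1) / n * c i)
    have e : (1 / (4 * n ^ 2)) ^ 2 * δ = 2 ^ 26 * C * (2 ^ (m + 4) * n * ε) := by
      rw [hδ]
      field_simp
      ring
    calc Q = 2 ^ 26 * C * ((1 / 2 ^ 13) ^ 2 * (1 / C) * Q) := by
          field_simp
      _ ≤ _ := by
          rw [e]
          gcongr
  obtain ⟨i, hi, hiv⟩ := hF.exists_nearly_orthonormal (τ := 1 / (4 * n ^ 2)) (δ := δ)
    (by positivity) hcard hQ hδ0 (by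
      rw [finrank_euclideanSpace_fin]
      push_cast at hn ⊢
      rwa [← hn])
  have hdim : m + 1 + 1 = Module.finrank ℝ (EuclideanSpace ℝ (Fin (m + 1 + 1))) := by
    rw [finrank_euclideanSpace_fin]
  set i' : Fin (m + 1 + 1) → Fin k := i ∘ Fin.cast hdim with hi'
  have hinj : Function.Injective i' := hi.comp (Fin.cast_injective _)
  -- The lifted inner products are at most `√(2δ)` in absolute value, and undoing the lift
  -- multiplies them by `(n+1)/n ≤ 2`.
  set θ : ℝ := √(8 * δ) with hθ
  have hθsq : θ ^ 2 = 8 * δ := Real.sq_sqrt (by positivity)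
  have hθ0 : 0 ≤ θ := Real.sqrt_nonneg _
  have hbound : ∀ a b, |inner ℝ (u (i' a)) (u (i' b)) - inner ℝ (Δ.points a) (Δ.points b)| ≤ θ := by
    intro a b
    by_cases hab : a = b
    · rw [hab, real_inner_self_eq_norm_sq, real_inner_self_eq_norm_sq, hΔ.2, huc.norm_eq_one,
        sub_self, abs_zero]
      exact hθ0
    · have h1 := hiv (Fin.cast hdim a) (Fin.cast hdim b)
        fun h => hab (Fin.cast_injective _ h)
      rw [inner_liftVec, ← hn] at h1
      rw [hpp a b hab]
      refine Real.abs_le_sqrt ?_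
      change ((n * inner ℝ (u (i' a)) (u (i' b)) + 1) / (n + 1)) ^ 2 ≤ 2 * δ at h1
      set x := inner ℝ (u (i' a)) (u (i' b))
      have e : x - -(1 / n) = (n + 1) / n * ((n * x + 1) / (n + 1)) := by
        field_simp
        ring
      have e2 : ((n + 1) / n) ^ 2 ≤ 4 := by
        have : (n + 1) / n ≤ 2 := by
          rw [div_le_iff₀ (by linarith)]
          linarith
        calc _ ≤ (2 : ℝ) ^ 2 := by gcongr
          _ = 4 := by norm_num
      calc _ = ((n + 1) / n) ^ 2 * ((n * x + 1) / (n + 1)) ^ 2 := by rw [e, mul_pow]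
        _ ≤ 4 * (2 * δ) := by gcongr
        _ = 8 * δ := by ring
  have hroot : √θ ^ 2 = θ := Real.sq_sqrt hθ0
  have h4 : (2 * ((1 + n) * √θ)) ^ 4 ≤ η ^ 4 := by
    have : (2 * ((1 + n) * √θ)) ^ 4 = 16 * (1 + n) ^ 4 * ((√θ ^ 2) ^ 2) := by ring
    rwa [this, hroot, hθsq]
  have hle : 2 * ((1 + n) * √θ) ≤ η := le_of_pow_le_pow_left₀ (by norm_num) hη0.le h4
  have hroot0 := Real.sqrt_nonneg θ
  have hθle : θ ≤ √θ := by
    have h3 : 3 * √θ ≤ (1 + n) * √θ := by gcongr; linarith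
    have h1 : √θ ≤ 1 := by linarith
    calc θ = √θ * √θ := by rw [← sq, hroot]
      _ ≤ 1 * √θ := by gcongr
      _ = √θ := one_mul _
  have hnθ' : √θ + n * θ ≤ (1 + n) * √θ := by
    have : n * θ ≤ n * √θ := by gcongr
    linarith
  have hnθ : n * θ < 1 := by linarith
  obtain ⟨U, hU⟩ := exists_isometry_norm_sub_le (u := fun j => u (i' j)) hn1
    (by simpa using hp.isTightFrame) hp0 hpp hbound hnθ
  refine ⟨U, i', hinj, fun j => ?_⟩
  have := hU j
  have := angle_le_two_mul_norm_sub (huc.norm_eq_one (i' j))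
    (show ‖U (Δ.points j)‖ = 1 by rw [U.norm_map, hΔ.2])
  linarith

theorem proposition7p1 (n k : ℕ) (hk₁ : n + 1 ≤ k) (hk₂ : k ≤ 2 * n ^ 2)
    (u : Fin k → EuclideanSpace ℝ (Fin n)) (c : Fin k → ℝ) (huc : IsCenteredIsotropic u c)
    (Δ : Affine.Simplex ℝ (EuclideanSpace ℝ (Fin n)) n) (hΔ : IsInscribedRegular Δ)
    (ε η : ℝ) (hε₀ : 0 < ε) (hε₁ : ε < ((n : ℝ) ^ (60 * n))⁻¹)
    (hη : η = (n : ℝ) ^ (15 * n) * ε ^ (1 / 4 : ℝ))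
    (hℓ : (1 - ε) * ellNorm (simplexBody Δ) ≤ ellNorm (convexHull ℝ (Set.range u)) ∨
      ellNorm (polarBody (convexHull ℝ (Set.range u))) ≤
        (1 + ε) * ellNorm (polarBody (simplexBody Δ))) :
    (0 < η ∧ η < 1) ∧
      ∃ W : Affine.Simplex ℝ (EuclideanSpace ℝ (Fin n)) n, IsInscribedRegular W ∧
        ∃ i : Fin (n + 1) → Fin k, Function.Injective i ∧
          ∀ j, InnerProductGeometry.angle (u (i j)) (W.points j) ≤ η := by
  obtain _ | _ | m := n
  -- Dimension zero is excluded by `1 ≤ k ≤ 0`.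
  · omega
  -- In dimension one powers of `n` cannot absorb constants, but here the vertices of `Δ` themselves
  -- occur among the `u i`, so all angles are zero.
  · have hη0 : 0 < η := by rw [hη]; simpa using Real.rpow_pos_of_pos hε₀ _
    have hη1 : η < 1 := by
      rw [hη]
      simpa using Real.rpow_lt_one hε₀.le (by simpa using hε₁) (by norm_num : (0 : ℝ) < 1 / 4)
    refine ⟨⟨hη0, hη1⟩, Δ, hΔ, ?_⟩
    choose i hi using fun j => exists_eq_of_dim_one huc (hΔ.2 j)
    refine ⟨i, fun a b hab => Δ.independent.injective ?_, fun j => ?_⟩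
    · rw [← hi a, ← hi b, hab]
    · rw [hi, InnerProductGeometry.angle_self (by
        rw [← norm_ne_zero_iff, hΔ.2]
        exact one_ne_zero)]
      exact hη0.le
  · have hn0 : (0 : ℝ) < ((m + 1 + 1 : ℕ) : ℝ) := by positivity
    have hη0 : 0 < η := by
      rw [hη]
      exact mul_pos (pow_pos hn0 _) (Real.rpow_pos_of_pos hε₀ _)
    have hη4 : η ^ 4 = ((m + 1 + 1 : ℕ) : ℝ) ^ (60 * (m + 1 + 1)) * ε := by
      rw [hη, mul_pow, ← pow_mul, ← Real.rpow_natCast (ε ^ _), ← Real.rpow_mul hε₀.le]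
      norm_num
      left
      ring
    have hη1 : η < 1 := by
      refine lt_of_pow_lt_pow_left₀ 4 zero_le_one ?_
      rw [hη4, one_pow]
      calc _ < ((m + 1 + 1 : ℕ) : ℝ) ^ (60 * (m + 1 + 1)) *
            (((m + 1 + 1 : ℕ) : ℝ) ^ (60 * (m + 1 + 1)))⁻¹ := by gcongr
        _ = 1 := mul_inv_cancel₀ (pow_pos hn0 _).ne'
    obtain ⟨U, i, hi, hU⟩ := exists_isometry_angle_le (by omega) hk₂ huc hΔ hε₀ hη0 hη1 hη4 hℓ
    exact ⟨⟨hη0, hη1⟩, _, hΔ.map_isometry U, i, hi, hU⟩
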